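/- Let $k$ be a field of characteristic $0$, let $Y$ be an integral scheme smooth over $k$ (for example a smooth irreducible variety), let $\mathcal I\subset\mathcal O_Y$ be a quasi-coherent ideal sheaf, and let $p\in Y$ be a point with $\mathcal I_p\neq(1)$. **Valuative $\mathbb Q$-ideals and centers.** Let $\mathbf{ZR}(Y)$ be the set of valuation rings $R_v$ of $K(Y)$ extending to a morphism $\operatorname{Spec}R_v\to Y$; write $v:K(Y)^*\to\Gamma_v$ for the valuation (additively), put $v(0)=\infty$, and compare values in $(\Gamma_v\otimes\mathbb Q)\cup\{\infty\}$. The ideal $\mathcal I$ defines the family $v(\mathcal I)$ whose value at $v$ is the minimum of $v(f)$ over the local sections $f$ of $\mathcal I$ at the image in $Y$ of the closed point of $\operatorname{Spec}R_v$. A center at $p$ is a family $J=(x_1^{a_1},\ldots,x_k^{a_k})$, $J_v=\min_i a_i\,v(x_i)$, defined over a neighbourhood of $p$, where $x_1,\ldots,x_k\in\mathcal O_{Y,p}$ is part of a regular system of parameters and $0<a_1\le\cdots\le a_k$ are rational numbers; its invariant is $(a_1,\ldots,a_k)$. For $k=0$, $J_v=\infty$. The center $J$ is $\mathcal I$-admissible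 at $p$ if $J_v\le v(\mathcal I)_v$ for all $v\in\mathbf{ZR}(U)$, for some open neighbourhood $U$ of $p$; two centers at $p$ are equal if they have the same values at all $v\in\mathbf{ZR}(U)$ for some such $U$. Invariants are ordered lexicographically, truncated sequences being considered larger. **The invariant and the associated centers.** Let $\mathcal D^{\le1}\mathcal I$ be the ideal generated by $\mathcal I$ and its images under $k$-derivations, $\mathcal D^{\le i}$ the $i$-th iterate of $\mathcal D^{\le 1}$, and let $$C(\mathcal I,a)=\sum_{\sum_{i<a}(a-i)b_i\,\ge\, a!}\ \prod_{i=0}^{a-1}(\mathcal D^{\le i}\mathcal I)^{b_i}.$$ If $\mathcal I_p=0$, then $\operatorname{inv}_p(\mathcal I)=()$, with the empty sequence of parameters. Otherwise put $a_1=\operatorname{ord}_p(\mathcal I)=\max\{a:\mathcal I_p\subseteq\mathfrak m_p^a\}$, choose $x_1\in(\mathcal D^{\le a_1-1}\mathcal I)_p$ with $x_1\in\mathfrak m_p\smallsetminus\mathfrak m_p^2$ (a maximal contact element), let $\mathcal I[2]$ be the restriction of $C(\mathcal I,a_1)$ to $V(x_1)$, and set $$\operatorname{inv}_p(\mathcal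 I)=\bigl(a_1,\ \operatorname{inv}_p(\mathcal I[2])/(a_1-1)!\bigr),$$ where $x_2,\ldots,x_k$ are arbitrary lifts to $\mathcal O_{Y,p}$ of the parameters obtained from $\mathcal I[2]$. The center $J=(x_1^{a_1},\ldots,x_k^{a_k})$ formed from $(a_1,\ldots,a_k)=\operatorname{inv}_p(\mathcal I)$ and such parameters is said to be associated to $\mathcal I$ at $p$. **Theorem.** This procedure can be carried out, and $\operatorname{inv}_p(\mathcal I)$ does not depend on the choices made. Moreover: 1. Every $J=(x_1^{a_1},\ldots,x_k^{a_k})$ associated to $\mathcal I$ at $p$ is a center at $p$, and it is $\mathcal I$-admissible at $p$. 2. $\operatorname{inv}_p(\mathcal I)$ is the maximum, in the above lexicographic order, of the invariants of all centers at $p$ that are $\mathcal I$-admissible at $p$. 3. If $J$ is associated to $\mathcal I$ at $p$, then every center at $p$ that is $\mathcal I$-admissible at $p$ and has invariant $\operatorname{inv}_p(\mathcal I)$ is equal to $J$. -/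

import Mathlib

open AlgebraicGeometry CategoryTheory
open scoped Nat

universe u v

namespace WeightedCenters

section LocalAlgebra

/-- `D^{≤ 1} I`: the ideal generated by `I` and all `∂ f` with `f ∈ I` and `∂` a `k`-derivation. -/
def derivIdeal (k : Type u) [CommRing k] {R : Type v} [CommRing R] [Algebra k R] (I : Ideal R) :
    Ideal R :=
  I ⊔ Ideal.span {g | ∃ (d : Derivation k R R) (f : R), f ∈ I ∧ g = d f}

/-- `D^{≤ i} I`, the `i`-fold iterate of `D^{≤ 1}`. (On a smooth variety in characteristic `0` the
differential operators of order `≤ i` are generated by the products of at most `i` derivations.) -/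
def derivIdealIter (k : Type u) [CommRing k] {R : Type v} [CommRing R] [Algebra k R] (i : ℕ)
    (I : Ideal R) : Ideal R :=
  (derivIdeal k)^[i] I

/-- The graded piece `G_j` of the algebra generated by placing `D^{≤ a - i} I` in degree `i`: the
sum of the products `∏_{i < a} (D^{≤ i} I)^{b_i}` of weighted degree `∑ (a - i) b_i ≥ j`. -/
def gradedPiece (k : Type u) [CommRing k] {R : Type v} [CommRing R] [Algebra k R] (I : Ideal R)
    (a j : ℕ) : Ideal R :=
  ⨆ (b : Fin a → ℕ) (_ : j ≤ ∑ i : Fin a, (a - (i : ℕ)) * b i),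
    ∏ i : Fin a, derivIdealIter k (i : ℕ) I ^ b i

/-- The coefficient ideal `C(I, a) = G_{a!}`. -/
def coefficientIdeal (k : Type u) [CommRing k] {R : Type v} [CommRing R] [Algebra k R]
    (I : Ideal R) (a : ℕ) : Ideal R :=
  gradedPiece k I a a !

/-- `I` has order `a` at the closed point: `a` is the largest integer with `I ≤ m ^ a`. -/
def HasOrder {R : Type v} [CommRing R] [IsLocalRing R] (I : Ideal R) (a : ℕ) : Prop :=
  IsGreatest {c : ℕ | I ≤ IsLocalRing.maximalIdeal R ^ c} a

/-- `x` is a maximal contact element for an ideal `I` of order `a ≥ 1`: a regular parameter (an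
element of `m` outside `m ^ 2`) that lies in `D^{≤ a - 1} I`. -/
def IsMaximalContact (k : Type u) [CommRing k] {R : Type v} [CommRing R] [IsLocalRing R]
    [Algebra k R] (I : Ideal R) (a : ℕ) (x : R) : Prop :=
  x ∈ derivIdealIter k (a - 1) I ∧ x ∈ IsLocalRing.maximalIdeal R ∧
    x ∉ IsLocalRing.maximalIdeal R ^ 2

/-- `IsAssociated k bs R I xs`: the integers `bs = (b_1, …, b_k)` and the parameters
`xs = (x_1, …, x_k)` of the local ring `R` arise from `I` by the inductive procedure. It stops, with
empty sequences, when `I = 0`. Otherwise `b_1` is the order of `I`, `x_1` is a maximal contact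
element, and one continues with the ideal `I[2] = C(I, b_1)|_{V(x_1)}` of `R / (x_1)`, the elements
`x_2, …, x_k` of `R` being arbitrary lifts of the parameters that are found there. -/
def IsAssociated (k : Type u) [CommRing k] : List ℕ →
    ∀ (R : Type v) [CommRing R] [IsLocalRing R] [Algebra k R], Ideal R → List R → Prop
  | [], _, _, _, _, I, xs => I = ⊥ ∧ xs = []
  | b :: bs, R, _, _, _, I, xs =>
      1 ≤ b ∧ HasOrder I b ∧
      ∃ (x : R) (ys : List R), xs = x :: ys ∧ IsMaximalContact k I b x ∧
        ∃ _ : IsLocalRing (R ⧸ Ideal.span {x}),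
          IsAssociated k bs (R ⧸ Ideal.span {x})
            ((coefficientIdeal k I b).map (Ideal.Quotient.mk (Ideal.span {x})))
            (ys.map (Ideal.Quotient.mk (Ideal.span {x})))

/-- The rational exponents `(a_1, …, a_k)` computed from the orders `(b_1, …, b_k)`: `a_1 = b_1`,
and `(a_2, …, a_k)` are the exponents computed from `(b_2, …, b_k)`, divided by `(b_1 - 1)!`. -/
def exponents : List ℕ → List ℚ
  | [] => []
  | b :: bs => (b : ℚ) :: (exponents bs).map (fun q => q / ((b - 1)! : ℚ))

/-- The lexicographic order on invariants, in which a truncated sequence is the larger one. -/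
def InvLE : List ℚ → List ℚ → Prop
  | _, [] => True
  | [], _ :: _ => False
  | a :: l, b :: m => a < b ∨ (a = b ∧ InvLE l m)

/-- `xs` is part of a regular system of parameters of the regular local ring `R`: its elements lie
in `m` and are linearly independent in `m / m ^ 2`. -/
def IsPartialParameterSystem {R : Type v} [CommRing R] [IsLocalRing R] (xs : List R) : Prop :=
  ∃ h : ∀ i : Fin xs.length, xs.get i ∈ IsLocalRing.maximalIdeal R,
    LinearIndependent (IsLocalRing.ResidueField R)
      (fun i : Fin xs.length =>
        ((IsLocalRing.maximalIdeal R).toCotangent ⟨xs.get i, h i⟩ : IsLocalRing.CotangentSpace R))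

/-- `(x_1^{a_1}, …, x_k^{a_k})` presents a center with invariant `(a_1, …, a_k)`: the `x_i` are part
of a regular system of parameters, and the exponents are positive rationals written in
nondecreasing order. -/
def IsCenter {R : Type v} [CommRing R] [IsLocalRing R] (xs : List R) (as : List ℚ) : Prop :=
  xs.length = as.length ∧ IsPartialParameterSystem xs ∧ (∀ a ∈ as, 0 < a) ∧
    as.Pairwise (· ≤ ·)

end LocalAlgebra

section Valuations

/-- The value group `Γ = K^* / V^*` of a valuation ring `V` of `K`, written additively. Below, the
class of `f` in Mathlib's multiplicative value group is inverted, so that `f ∈ V` means `v(f) ≥ 0`. -/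
abbrev AddValueGroup {K : Type u} [Field K] (V : ValuationSubring K) : Type u :=
  Additive (V.ValueGroup)ˣ

/-- `Γ_ℚ = Γ ⊗ ℚ`, with a largest element `⊤` added as the value of `0`. -/
abbrev QValues {K : Type u} [Field K] (V : ValuationSubring K) : Type u :=
  WithTop (DivisibleHull (AddValueGroup V))

open Classical in
/-- The additive valuation `v : K → Γ_ℚ ∪ {⊤}` of a valuation ring, multiplied by the rational
number `q`: the function `f ↦ q · v(f)`, with value `⊤` at `f = 0`. -/
noncomputable def scaledVal {K : Type u} [Field K] (V : ValuationSubring K) (q : ℚ) (f : K) :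
    QValues V :=
  if h : f = 0 then ⊤
  else
    ((q • DivisibleHull.coe (Additive.ofMul
      (Units.mk0 (V.valuation f) ((Valuation.ne_zero_iff V.valuation).mpr h))⁻¹) :
        DivisibleHull (AddValueGroup V)) : QValues V)

end Valuations

section Geometry

/-- A point of the Zariski–Riemann space of an integral scheme `Y`: a valuation ring of the function
field for which `Spec` of the function field `→ Y` extends to `Spec` of the valuation ring. Such an
extension is given by the image `center` of the closed point, whose local ring is dominated by the
valuation ring. -/
structure ZRPoint (Y : Scheme.{u}) [IsIntegral Y] where
  ring : ValuationSubring Y.functionField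
  center : Y
  stalk_le : ∀ f : Y.presheaf.stalk center, algebraMap _ Y.functionField f ∈ ring
  dominates : ∀ f ∈ IsLocalRing.maximalIdeal (Y.presheaf.stalk center),
    ring.valuation (algebraMap _ Y.functionField f) < 1

/-- The stalk `I_y` of a quasi-coherent ideal sheaf `I`. -/
noncomputable def stalkIdeal {Y : Scheme.{u}} (I : Y.IdealSheafData) (y : Y) : Ideal (Y.presheaf.stalk y) :=
  ⨆ (U : Y.affineOpens) (h : y ∈ U.1), (I.ideal U).map (Y.presheaf.germ U.1 y h).hom

/-- The structure map `k → O_{Y,y}` of a `k`-scheme `Y`. -/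
noncomputable def stalkStructureMap {k : Type u} [Field k] {Y : Scheme.{u}}
    (f : Y ⟶ Spec (CommRingCat.of k)) (y : Y) : k →+* Y.presheaf.stalk y :=
  ((Scheme.ΓSpecIso (CommRingCat.of k)).inv ≫ f.appTop ≫
    Y.presheaf.germ ⊤ y trivial).hom

/-- The integers `bs` and the parameters `xs ∈ O_{Y,p}` arise from the ideal sheaf `I` at `p` by the
inductive procedure of taking orders, maximal contact elements and restricted coefficient ideals. -/
def IsAssociatedAt {k : Type u} [Field k] {Y : Scheme.{u}} (f : Y ⟶ Spec (CommRingCat.of k))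
    (I : Y.IdealSheafData) (p : Y) (bs : List ℕ) (xs : List (Y.presheaf.stalk p)) : Prop :=
  letI : Algebra k (Y.presheaf.stalk p) := (stalkStructureMap f p).toAlgebra
  IsAssociated k bs (Y.presheaf.stalk p) (stalkIdeal I p) xs

open Classical in
/-- The invariant `inv_p(I)`: the exponents obtained from some run of the inductive procedure. (The
default `[]` is not used, and the result does not depend on the run: both facts are claimed in the
theorem.) -/
noncomputable def invariantAt {k : Type u} [Field k] {Y : Scheme.{u}}
    (f : Y ⟶ Spec (CommRingCat.of k)) (I : Y.IdealSheafData) (p : Y) : List ℚ :=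
  if h : ∃ bs : List ℕ, ∃ xs : List (Y.presheaf.stalk p), IsAssociatedAt f I p bs xs
  then exponents h.choose else []

/-- The valuative `ℚ`-ideal `(x_1^{a_1}, …, x_k^{a_k})`: the family `v ↦ min_i a_i · v(x_i)`. The
`x_i` are germs at `p`, so only its values at points `v` over a small neighbourhood of `p` are
meaningful. The minimum over the empty sequence is `⊤`. -/
noncomputable def centerValue {Y : Scheme.{u}} [IsIntegral Y] {p : Y}
    (xs : List (Y.presheaf.stalk p)) (as : List ℚ) (v : ZRPoint Y) : QValues v.ring :=
  (List.zipWith (fun x a => scaledVal v.ring a (algebraMap _ Y.functionField x)) xs as).foldr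
    min ⊤

/-- `g` is the value at `v` of the valuative ideal `v(I)`: the minimal element of the image of `I`
under the valuation. -/
def IsIdealValue {Y : Scheme.{u}} [IsIntegral Y] (I : Y.IdealSheafData) (v : ZRPoint Y)
    (g : QValues v.ring) : Prop :=
  IsLeast ((fun h : Y.presheaf.stalk v.center =>
    scaledVal v.ring 1 (algebraMap _ Y.functionField h)) '' (stalkIdeal I v.center)) g

/-- `J = (x_1^{a_1}, …, x_k^{a_k})` is `I`-admissible at `p`: the inequality `J ≤ v(I)` of valuative
`ℚ`-ideals holds on a neighbourhood `U` of `p`, that is, at all points of the Zariski–Riemann space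
of `U`. -/
def IsAdmissibleAt {Y : Scheme.{u}} [IsIntegral Y] (I : Y.IdealSheafData) {p : Y}
    (xs : List (Y.presheaf.stalk p)) (as : List ℚ) : Prop :=
  ∃ U : Y.Opens, p ∈ U ∧ ∀ v : ZRPoint Y, v.center ∈ U →
    ∃ g, IsIdealValue I v g ∧ centerValue xs as v ≤ g

/-- Two presentations give the same center, as a valuative `ℚ`-ideal on a neighbourhood of `p`. -/
def SameCenterAt {Y : Scheme.{u}} [IsIntegral Y] {p : Y}
    (xs : List (Y.presheaf.stalk p)) (as : List ℚ)
    (ys : List (Y.presheaf.stalk p)) (bs : List ℚ) : Prop :=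
  ∃ U : Y.Opens, p ∈ U ∧ ∀ v : ZRPoint Y, v.center ∈ U →
    centerValue xs as v = centerValue ys bs v

end Geometry

end WeightedCenters

/-! A center J = (x_1^{a_1}, …, x_k^{a_k}) determines a filtration of O_{Y,p} by ideals J_{≥ t}: the
smallest multiplicative filtration with x_i in degree 1/a_i (`weightedIdeal`). The key point is that
J is I-admissible at p exactly when I_p ⊆ J_{≥ 1}, and that centers with the same filtration are
equal; the rest is local algebra.

If I_p ⊆ J_{≥ 1}: the germs h with v(h) ≥ t · J_v near p form a filtration having x_i in degree
1/a_i, hence containing J_{≥ t}; finitely many generators of I then give one neighbourhood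
(`isAdmissibleAt_of_stalkIdeal_le`). Conversely, complete the x_i to generators of the maximal
ideal, the new ones having very small weight. The associated graded ring is a domain, so the
weighted order is a valuation centered at p; testing admissibility on it gives I_p ⊆ J_{≥ 1} + m^n
for every n, and Krull's theorem concludes (`HasParameters.mem_weightedIdeal_of_valuation`).

Smoothness enters only through `HasParameters`: O_{Y,p} is Noetherian and every functional on m/m²
comes from a derivation. This passes to R/(x) for a parameter x, so all inductions run along
hypersurfaces. If ∂x = 1 and x has the largest weight, then f lies in the filtration as soon as the
restrictions of its derivatives ∂^i f to V(x) have the right degrees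
(`mem_weightedIdeal_of_iterate`). This Taylor criterion yields that the graded ring is a domain and
hence that the J_{≥ t} are integrally closed.

An associated center is admissible: for f in I the powers (∂^i f)^{a!/(a-i)} lie in C(I, a), whose
restriction to V(x_1) is controlled by induction; integral closedness extracts the roots, and the
Taylor criterion applies (`IsAssociated.isCenter_and_le`).

It is maximal and unique: if (c_1 ≤ c_2 ≤ …) is the invariant of an admissible center, then I_p ⊆
m^⌈c_1⌉, so c_1 ≤ a_1. In case of equality derivations lower degrees by at most 1/a_1, so x_1 has
degree 1/a_1 and C(I, a_1) has degree (a_1 - 1)!. Being a parameter, x_1 can replace one of the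
given parameters; restrict to V(x_1), rescale, and use induction (`IsAssociated.invLE_and_eq`).
Independence of the choices is then formal: of two associated centers each is admissible, so neither
invariant exceeds the other. -/

namespace WeightedCenters

/-! ### Rational filtrations and the weighted filtration of a list of elements. -/

section Filtrations

variable {R S : Type*} [CommRing R] [CommRing S]

/-- A decreasing multiplicative filtration of a ring by ideals, indexed by the rational numbers. -/
structure IsFiltration (K : ℚ → Ideal R) : Prop where
  antitone : Antitone K
  eq_top : ∀ t ≤ 0, K t = ⊤
  mul_le : ∀ s t, K s * K t ≤ K (s + t)

namespace IsFiltration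

variable {K : ℚ → Ideal R} (hK : IsFiltration K)
include hK

theorem mem_of_nonpos {t : ℚ} (ht : t ≤ 0) (f : R) : f ∈ K t := by
  rw [hK.eq_top t ht]; trivial

theorem mem_of_le {s t : ℚ} (h : s ≤ t) {f : R} (hf : f ∈ K t) : f ∈ K s := hK.antitone h hf

theorem mul_mem {s t : ℚ} {f g : R} (hf : f ∈ K s) (hg : g ∈ K t) : f * g ∈ K (s + t) :=
  hK.mul_le s t (Ideal.mul_mem_mul hf hg)

theorem pow_le (t : ℚ) (n : ℕ) : K t ^ n ≤ K (n * t) := by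
  induction n with
  | zero => simp [hK.eq_top 0 le_rfl]
  | succ n ih =>
    rw [pow_succ]
    refine (Ideal.mul_mono_left ih).trans ((hK.mul_le _ _).trans (le_of_eq ?_))
    congr 1; push_cast; ring

theorem pow_mem {t : ℚ} {f : R} (hf : f ∈ K t) (n : ℕ) : f ^ n ∈ K (n * t) :=
  hK.pow_le t n (Ideal.pow_mem_pow hf n)

theorem prod_le {ι : Type*} (s : Finset ι) (A : ι → Ideal R) (t : ι → ℚ)
    (h : ∀ i ∈ s, A i ≤ K (t i)) : ∏ i ∈ s, A i ≤ K (∑ i ∈ s, t i) := by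
  classical
  induction s using Finset.induction_on with
  | empty => simp [hK.eq_top 0 le_rfl]
  | insert a s ha ih =>
    rw [Finset.prod_insert ha, Finset.sum_insert ha]
    exact (Ideal.mul_mono (h a (by simp)) (ih fun i hi => h i (by simp [hi]))).trans
      (hK.mul_le _ _)

theorem comap {R' : Type*} [CommRing R'] (e : R' →+* R) :
    IsFiltration fun t => (K t).comap e where
  antitone _ _ h := Ideal.comap_mono (hK.antitone h)
  eq_top t ht := by simp [hK.eq_top t ht]
  mul_le s t := Ideal.mul_le.2 fun f hf g hg => by
    simp only [Ideal.mem_comap, map_mul] at *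
    exact hK.mul_mem hf hg

theorem map (e : R →+* S) : IsFiltration fun t => (K t).map e where
  antitone _ _ h := Ideal.map_mono (hK.antitone h)
  eq_top t ht := by rw [hK.eq_top t ht, Ideal.map_top]
  mul_le s t := by rw [← Ideal.map_mul]; exact Ideal.map_mono (hK.mul_le s t)

theorem scale {c : ℚ} (hc : 0 < c) : IsFiltration fun t => K (c * t) where
  antitone _ _ h := hK.antitone (mul_le_mul_of_nonneg_left h hc.le)
  eq_top t ht := hK.eq_top _ (mul_nonpos_of_nonneg_of_nonpos hc.le ht)
  mul_le s t := by rw [mul_add]; exact hK.mul_le _ _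

theorem sup (N : Ideal R) : IsFiltration fun t => K t ⊔ N where
  antitone _ _ h := sup_le_sup_right (hK.antitone h) N
  eq_top t ht := by simp [hK.eq_top t ht]
  mul_le s t := by
    refine Ideal.mul_le.2 fun f hf g hg => ?_
    obtain ⟨f1, hf1, f2, hf2, rfl⟩ := Submodule.mem_sup.1 hf
    obtain ⟨g1, hg1, g2, hg2, rfl⟩ := Submodule.mem_sup.1 hg
    rw [show (f1 + f2) * (g1 + g2) = f1 * g1 + (f1 * g2 + f2 * (g1 + g2)) by ring]
    exact add_mem (Ideal.mem_sup_left (hK.mul_mem hf1 hg1)) (Ideal.mem_sup_right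
      (add_mem (Ideal.mul_mem_left _ _ hg2) (Ideal.mul_mem_right _ _ hf2)))

end IsFiltration

/-- The powers of an ideal, as a filtration in which the `n`-th power has degree `n`. -/
theorem isFiltration_pow (N : Ideal R) {c : ℚ} (hc : 0 < c) :
    IsFiltration fun t => N ^ ⌈c * t⌉₊ where
  antitone _ _ h := Ideal.pow_le_pow_right (Nat.ceil_mono (mul_le_mul_of_nonneg_left h hc.le))
  eq_top t ht := by
    simp [Nat.ceil_eq_zero.2 (mul_nonpos_of_nonneg_of_nonpos hc.le ht)]
  mul_le s t := by
    rw [← pow_add]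
    refine Ideal.pow_le_pow_right ?_
    rw [mul_add]
    exact Nat.ceil_add_le _ _

/-- The trivial filtration, which jumps from the unit ideal to zero. -/
theorem isFiltration_trivial : IsFiltration fun t : ℚ => if t ≤ 0 then (⊤ : Ideal R) else ⊥ where
  antitone s t h := by
    dsimp only
    split_ifs with h1 h2
    · exact le_rfl
    · exact absurd (h.trans h1) h2
    · exact bot_le
    · exact le_rfl
  eq_top t ht := by simp [ht]
  mul_le s t := by
    by_cases hs : s ≤ 0 <;> by_cases ht : t ≤ 0
    · simp [add_nonpos hs ht]
    all_goals simp [hs, ht]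

/-- The ideals `J_{≥ t}` of the weighted filtration with weights `w_i` on `x_i`: the smallest
filtration with `x_i` in degree `w_i`. The center `(x_1^{a_1}, …, x_k^{a_k})` has weights
`1 / a_i`. -/
def weightedIdeal (L : List (R × ℚ)) (t : ℚ) : Ideal R :=
  sInf {N | ∃ K : ℚ → Ideal R, IsFiltration K ∧ (∀ p ∈ L, p.1 ∈ K p.2) ∧ N = K t}

theorem weightedIdeal_le {L : List (R × ℚ)} {K : ℚ → Ideal R} (hK : IsFiltration K)
    (h : ∀ p ∈ L, p.1 ∈ K p.2) (t : ℚ) : weightedIdeal L t ≤ K t :=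
  sInf_le ⟨K, hK, h, rfl⟩

theorem isFiltration_weightedIdeal (L : List (R × ℚ)) : IsFiltration (weightedIdeal L) where
  antitone s t h := le_sInf <| by
    rintro _ ⟨K, hK, hL, rfl⟩
    exact (weightedIdeal_le hK hL t).trans (hK.antitone h)
  eq_top t ht := eq_top_iff.2 <| le_sInf <| by
    rintro _ ⟨K, hK, hL, rfl⟩
    rw [hK.eq_top t ht]
  mul_le s t := le_sInf <| by
    rintro _ ⟨K, hK, hL, rfl⟩
    exact (Ideal.mul_mono (weightedIdeal_le hK hL s) (weightedIdeal_le hK hL t)).trans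
      (hK.mul_le s t)

theorem mem_weightedIdeal {L : List (R × ℚ)} {p : R × ℚ} (hp : p ∈ L) :
    p.1 ∈ weightedIdeal L p.2 := by
  refine (Submodule.mem_sInf).2 ?_
  rintro _ ⟨K, hK, hL, rfl⟩
  exact hL p hp

theorem weightedIdeal_mono {L L' : List (R × ℚ)} (h : ∀ p ∈ L, p.1 ∈ weightedIdeal L' p.2)
    (t : ℚ) : weightedIdeal L t ≤ weightedIdeal L' t :=
  weightedIdeal_le (isFiltration_weightedIdeal L') h t

theorem weightedIdeal_mono_of_subset {L L' : List (R × ℚ)} (h : L ⊆ L') (t : ℚ) :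
    weightedIdeal L t ≤ weightedIdeal L' t :=
  weightedIdeal_mono (fun _ hp => mem_weightedIdeal (h hp)) t

theorem weightedIdeal_nil {t : ℚ} (ht : 0 < t) : weightedIdeal ([] : List (R × ℚ)) t = ⊥ := by
  have := weightedIdeal_le (L := []) (isFiltration_trivial (R := R)) (by simp) t
  rwa [if_neg (not_le.2 ht), le_bot_iff] at this

/-- Adding a fixed ideal to every step of a filtration gives a filtration; here the first element
acquires every degree. -/
theorem weightedIdeal_cons_le (p : R × ℚ) (L : List (R × ℚ)) (t : ℚ) :
    weightedIdeal (p :: L) t ≤ weightedIdeal L t ⊔ Ideal.span {p.1} := by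
  refine weightedIdeal_le (K := fun t => weightedIdeal L t ⊔ Ideal.span {p.1})
    ((isFiltration_weightedIdeal L).sup _) ?_ t
  intro q hq
  rcases List.mem_cons.1 hq with rfl | hq
  · exact Ideal.mem_sup_right (Ideal.mem_span_singleton_self _)
  · exact Ideal.mem_sup_left (mem_weightedIdeal hq)

/-- Multiply all weights by `c`. -/
def scaleWeights (c : ℚ) (L : List (R × ℚ)) : List (R × ℚ) := L.map fun p => (p.1, c * p.2)

theorem weightedIdeal_scaleWeights {c : ℚ} (hc : 0 < c) (L : List (R × ℚ)) (t : ℚ) :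
    weightedIdeal (scaleWeights c L) (c * t) = weightedIdeal L t := by
  apply le_antisymm
  · have h := weightedIdeal_le (L := scaleWeights c L)
      ((isFiltration_weightedIdeal L).scale (inv_pos.2 hc)) ?_ (c * t)
    · rwa [inv_mul_cancel_left₀ hc.ne'] at h
    · simp only [scaleWeights, List.mem_map]
      rintro _ ⟨p, hp, rfl⟩
      dsimp only
      rw [inv_mul_cancel_left₀ hc.ne']
      exact mem_weightedIdeal hp
  · refine weightedIdeal_le (K := fun t => weightedIdeal (scaleWeights c L) (c * t))
      ((isFiltration_weightedIdeal _).scale hc) ?_ t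
    intro p hp
    exact mem_weightedIdeal (L := scaleWeights c L) (p := (p.1, c * p.2))
      (List.mem_map.2 ⟨p, hp, rfl⟩)

/-- Apply a ring homomorphism to all elements of a weighted list. -/
def mapElems (e : R →+* S) (L : List (R × ℚ)) : List (S × ℚ) := L.map fun p => (e p.1, p.2)

theorem map_weightedIdeal (e : R →+* S) (L : List (R × ℚ)) (t : ℚ) :
    (weightedIdeal L t).map e = weightedIdeal (mapElems e L) t := by
  apply le_antisymm
  · rw [Ideal.map_le_iff_le_comap]
    refine weightedIdeal_le (K := fun t => (weightedIdeal (mapElems e L) t).comap e)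
      ((isFiltration_weightedIdeal _).comap e) ?_ t
    intro p hp
    exact mem_weightedIdeal (L := mapElems e L) (p := (e p.1, p.2)) (List.mem_map.2 ⟨p, hp, rfl⟩)
  · refine weightedIdeal_le (K := fun t => (weightedIdeal L t).map e)
      ((isFiltration_weightedIdeal L).map e) ?_ t
    simp only [mapElems, List.mem_map]
    rintro _ ⟨p, hp, rfl⟩
    exact Ideal.mem_map_of_mem e (mem_weightedIdeal hp)

theorem mk_mem_weightedIdeal_iff (x : R) (L : List (R × ℚ)) (t : ℚ) (f : R) :
    Ideal.Quotient.mk (Ideal.span {x}) f ∈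
        weightedIdeal (mapElems (Ideal.Quotient.mk (Ideal.span {x})) L) t ↔
      f ∈ weightedIdeal L t ⊔ Ideal.span {x} := by
  rw [← map_weightedIdeal, ← Ideal.mem_comap,
    Ideal.comap_map_of_surjective _ Ideal.Quotient.mk_surjective, ← RingHom.ker_eq_comap_bot,
    Ideal.mk_ker]

theorem mk_mem_weightedIdeal_of_cons {x : R} {w : ℚ} {L : List (R × ℚ)} {t : ℚ} {f : R}
    (hf : f ∈ weightedIdeal ((x, w) :: L) t) :
    Ideal.Quotient.mk (Ideal.span {x}) f ∈
      weightedIdeal (mapElems (Ideal.Quotient.mk (Ideal.span {x})) L) t :=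
  (mk_mem_weightedIdeal_iff x L t f).2 (weightedIdeal_cons_le (x, w) L t hf)

theorem exists_of_mk_mem_weightedIdeal {x : R} (w : ℚ) {L : List (R × ℚ)} {t : ℚ} {f : R}
    (hf : Ideal.Quotient.mk (Ideal.span {x}) f ∈
      weightedIdeal (mapElems (Ideal.Quotient.mk (Ideal.span {x})) L) t) :
    ∃ h ∈ weightedIdeal ((x, w) :: L) t, ∃ r, f = h + x * r := by
  rw [mk_mem_weightedIdeal_iff] at hf
  obtain ⟨h, hh, y, hy, rfl⟩ := Submodule.mem_sup.1 hf
  obtain ⟨r, rfl⟩ := Ideal.mem_span_singleton.1 hy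
  exact ⟨h, weightedIdeal_mono_of_subset (List.subset_cons_self _ _) t hh, r, rfl⟩

/-- Comparison with the `N`-adic filtration. It bounds orders by weighted degrees, both for the
estimate of the first exponent and for separatedness. -/
theorem weightedIdeal_le_pow {N : Ideal R} {c : ℚ} (hc : 0 < c) {L : List (R × ℚ)}
    (h : ∀ p ∈ L, p.1 ∈ N ∧ c * p.2 ≤ 1) (t : ℚ) : weightedIdeal L t ≤ N ^ ⌈c * t⌉₊ := by
  refine weightedIdeal_le (isFiltration_pow N hc) ?_ t
  intro p hp
  obtain ⟨h1, h2⟩ := h p hp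
  have h3 : ⌈c * p.2⌉₊ ≤ 1 := Nat.ceil_le.2 (by simpa using h2)
  exact Ideal.pow_le_pow_right h3 (by simpa using h1)

/-- If all elements have weight at least `1 / n`, ... the powers of the span of the elements are
contained in the filtration. -/
theorem pow_mem_weightedIdeal {L : List (R × ℚ)} {p : R × ℚ} (hp : p ∈ L) (n : ℕ) :
    p.1 ^ n ∈ weightedIdeal L (n * p.2) :=
  (isFiltration_weightedIdeal L).pow_mem (mem_weightedIdeal hp) n

/-! ### Derivations, the ideals D^{≤ i} I and coefficient ideals in a filtered ring. -/

section Derivations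

variable {k : Type*} [CommRing k] [Algebra k R]

/-- All derivations lower the degree by at most `β`. -/
def DerivationsLower (k : Type*) [CommRing k] [Algebra k R] (K : ℚ → Ideal R) (β : ℚ) : Prop :=
  ∀ (d : Derivation k R R) (t : ℚ) (f : R), f ∈ K t → d f ∈ K (t - β)

/-- By the Leibniz rule the elements of degree t whose derivative has degree t - β form again a
filtration, so minimality of the weighted filtration reduces the claim to the generators. -/
theorem derivation_mem_weightedIdeal (d : Derivation k R R) {β : ℚ} (hβ : 0 ≤ β)
    {L : List (R × ℚ)} (hd : ∀ p ∈ L, d p.1 ∈ weightedIdeal L (p.2 - β)) {t : ℚ} {f : R}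
    (hf : f ∈ weightedIdeal L t) : d f ∈ weightedIdeal L (t - β) := by
  have hJ := isFiltration_weightedIdeal L
  let K : ℚ → Ideal R := fun t =>
    { carrier := {f | f ∈ weightedIdeal L t ∧ d f ∈ weightedIdeal L (t - β)}
      zero_mem' := by simp
      add_mem' := by
        rintro a b ⟨ha, ha'⟩ ⟨hb, hb'⟩
        exact ⟨add_mem ha hb, by rw [map_add]; exact add_mem ha' hb'⟩
      smul_mem' := by
        rintro c a ⟨ha, ha'⟩
        refine ⟨Ideal.mul_mem_left _ _ ha, ?_⟩
        rw [smul_eq_mul, d.leibniz, smul_eq_mul, smul_eq_mul]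
        exact add_mem (Ideal.mul_mem_left _ _ ha')
          (Ideal.mul_mem_right _ _ (hJ.mem_of_le (by linarith) ha)) }
  have hK : IsFiltration K :=
    { antitone := fun s t h f hf =>
        ⟨hJ.mem_of_le h hf.1, hJ.mem_of_le (by linarith) hf.2⟩
      eq_top := fun t ht => eq_top_iff.2 fun f _ =>
        ⟨hJ.mem_of_nonpos ht _, hJ.mem_of_nonpos (by linarith) _⟩
      mul_le := fun s t => Ideal.mul_le.2 fun f hf g hg => by
        refine ⟨hJ.mul_mem hf.1 hg.1, ?_⟩
        rw [d.leibniz, smul_eq_mul, smul_eq_mul]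
        refine add_mem (hJ.mem_of_le (le_of_eq ?_) (hJ.mul_mem hf.1 hg.2))
          (hJ.mem_of_le (le_of_eq ?_) (hJ.mul_mem hg.1 hf.2)) <;> ring }
  exact (weightedIdeal_le hK (fun p hp => ⟨mem_weightedIdeal hp, hd p hp⟩) t hf).2

theorem derivationsLower_weightedIdeal {β : ℚ} (hβ : 0 ≤ β) {L : List (R × ℚ)}
    (hL : ∀ p ∈ L, p.2 ≤ β) : DerivationsLower k (weightedIdeal L) β := fun d _ _ hf =>
  derivation_mem_weightedIdeal d hβ
    (fun p hp => (isFiltration_weightedIdeal L).mem_of_nonpos (by linarith [hL p hp]) _) hf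

theorem derivation_mem_pow (d : Derivation k R R) (N : Ideal R) {n : ℕ} {f : R}
    (hf : f ∈ N ^ (n + 1)) : d f ∈ N ^ n := by
  induction n generalizing f with
  | zero => simp
  | succ n ih =>
    rw [pow_succ] at hf
    refine Submodule.mul_induction_on hf ?_ ?_
    · intro a ha b hb
      rw [d.leibniz, smul_eq_mul, smul_eq_mul]
      refine add_mem (Ideal.mul_mem_right _ _ ha) ?_
      rw [pow_succ, mul_comm]
      exact Ideal.mul_mem_mul hb (ih ha)
    · intro a b ha hb
      rw [map_add]; exact add_mem ha hb

theorem derivationsLower_pow (N : Ideal R) : DerivationsLower k (fun t => N ^ ⌈t⌉₊) 1 := by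
  intro d t f hf
  rcases le_or_gt t 1 with ht | ht
  · simp [Nat.ceil_eq_zero.2 (show t - 1 ≤ 0 by linarith)]
  · refine derivation_mem_pow d N ?_
    rwa [Nat.ceil_sub_one, Nat.sub_add_cancel (Nat.one_le_ceil_iff.2 (by linarith))]

variable {K : ℚ → Ideal R} {β : ℚ}

theorem derivIdealIter_succ (I : Ideal R) (i : ℕ) :
    derivIdealIter k (i + 1) I = derivIdeal k (derivIdealIter k i I) :=
  Function.iterate_succ_apply' _ _ _

theorem derivation_mem_derivIdealIter (d : Derivation k R R) {I : Ideal R} {i : ℕ} {f : R}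
    (hf : f ∈ derivIdealIter k i I) : d f ∈ derivIdealIter k (i + 1) I := by
  rw [derivIdealIter_succ]
  exact Ideal.mem_sup_right (Ideal.subset_span ⟨d, f, hf, rfl⟩)

theorem iterate_derivation_mem_derivIdealIter (d : Derivation k R R) {I : Ideal R} (i : ℕ) {f : R}
    (hf : f ∈ I) : d^[i] f ∈ derivIdealIter k i I := by
  induction i with
  | zero => exact hf
  | succ i ih =>
    rw [Function.iterate_succ_apply']
    exact derivation_mem_derivIdealIter d ih

theorem DerivationsLower.derivIdealIter_le (hd : DerivationsLower k K β) (hK : IsFiltration K)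
    (hβ : 0 ≤ β) {I : Ideal R} {t : ℚ} (hI : I ≤ K t) (i : ℕ) :
    derivIdealIter k i I ≤ K (t - i * β) := by
  induction i with
  | zero => simpa [derivIdealIter] using hI
  | succ i ih =>
    rw [derivIdealIter_succ]
    have e1 : t - ((i + 1 : ℕ) : ℚ) * β = t - i * β - β := by push_cast; ring
    rw [e1]
    refine sup_le (ih.trans (hK.antitone (by linarith))) (Ideal.span_le.2 ?_)
    rintro _ ⟨d, f, hf, rfl⟩
    exact hd d _ f (ih hf)

/-- The ideal D^{≤ i} I has degree (a - i)β, so the weights in the definition of G_j are exactly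
those that produce degree jβ. The lemma serves both the powers of an ideal and the filtration of a
center. -/
theorem DerivationsLower.gradedPiece_le (hd : DerivationsLower k K β) (hK : IsFiltration K)
    (hβ : 0 ≤ β) {I : Ideal R} {a : ℕ} (hI : I ≤ K (a * β)) (j : ℕ) :
    gradedPiece k I a j ≤ K (j * β) := by
  refine iSup₂_le fun b hb => ?_
  refine (hK.prod_le Finset.univ _ (fun i => (b i : ℚ) * (a * β - (i : ℕ) * β)) ?_).trans
    (hK.antitone ?_)
  · intro i _
    exact (Ideal.pow_right_mono (hd.derivIdealIter_le hK hβ hI i) _).trans (hK.pow_le _ _)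
  · have h : (j : ℚ) ≤ ∑ i : Fin a, ((a : ℚ) - (i : ℕ)) * b i := by
      have := (Nat.cast_le (α := ℚ)).2 hb
      refine this.trans (le_of_eq ?_)
      push_cast
      refine Finset.sum_congr rfl fun i _ => ?_
      rw [Nat.cast_sub i.2.le]
    calc (j : ℚ) * β ≤ (∑ i : Fin a, ((a : ℚ) - (i : ℕ)) * b i) * β :=
          mul_le_mul_of_nonneg_right h hβ
      _ = _ := by
          rw [Finset.sum_mul]
          exact Finset.sum_congr rfl fun i _ => by ring

theorem coefficientIdeal_le_pow {N I : Ideal R} {a : ℕ} (hI : I ≤ N ^ a) :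
    coefficientIdeal k I a ≤ N ^ a ! := by
  have h := (derivationsLower_pow (k := k) N).gradedPiece_le (I := I) (a := a)
    (by simpa using isFiltration_pow N one_pos) zero_le_one (by simpa using hI) a !
  simpa [coefficientIdeal] using h

theorem pow_mem_coefficientIdeal {I : Ideal R} {a i : ℕ} (hi : i < a) {f : R}
    (hf : f ∈ derivIdealIter k i I) : f ^ (a ! / (a - i)) ∈ coefficientIdeal k I a := by
  have hdvd : a - i ∣ a ! := Nat.dvd_factorial (by omega) (by omega)
  -- The exponent vector is concentrated at i; as a - i divides a!, its weighted degree is exactly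
  -- a!.
  refine Submodule.mem_iSup_of_mem (Pi.single ⟨i, hi⟩ (a ! / (a - i)))
    (Submodule.mem_iSup_of_mem ?_ ?_)
  · rw [Finset.sum_eq_single ⟨i, hi⟩]
    · rw [Pi.single_eq_same, Nat.mul_div_cancel' hdvd]
    · intro j _ hj; rw [Pi.single_eq_of_ne hj, mul_zero]
    · simp
  · rw [Finset.prod_eq_single ⟨i, hi⟩]
    · rw [Pi.single_eq_same]; exact Ideal.pow_mem_pow hf _
    · intro j _ hj; rw [Pi.single_eq_of_ne hj, pow_zero]
    · simp

end Derivations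

end Filtrations

end WeightedCenters

namespace WeightedCenters

/-! ### Taylor expansion along a parameter x with d x = 1. -/

section Taylor

variable {k R : Type*} [Field k] [CommRing R] [Algebra k R]

variable (k) in
theorem isUnit_natCast_of_charZero [CharZero k] {n : ℕ} (hn : n ≠ 0) : IsUnit (n : R) := by
  have : IsUnit (n : k) := isUnit_iff_ne_zero.2 (Nat.cast_ne_zero.2 hn)
  simpa using this.map (algebraMap k R)

theorem derivation_iterate_mul (d : Derivation k R R) (n : ℕ) (f g : R) :
    d^[n] (f * g) =
      ∑ ij ∈ Finset.HasAntidiagonal.antidiagonal n, (n.choose ij.1 : R) * (d^[ij.1] f * d^[ij.2] g) := by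
  induction n with
  | zero => simp
  | succ n ih =>
    rw [Finset.sum_antidiagonal_choose_succ_mul (fun i j => d^[i] f * d^[j] g),
      Function.iterate_succ_apply', ih, map_sum, ← Finset.sum_add_distrib]
    refine Finset.sum_congr rfl fun ij hij => ?_
    have h : (n.choose ij.2 : R) = n.choose ij.1 := by
      rw [← Finset.HasAntidiagonal.mem_antidiagonal.1 hij, Nat.choose_symm_add]
    simp only [d.leibniz, smul_eq_mul, Function.iterate_succ_apply', h]
    simp only [Derivation.map_natCast]
    ring

/-- The j-th derivative reads off the coefficient of x^j modulo x, up to the factor j!, which is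
invertible in characteristic 0. -/
theorem derivation_iterate_pow_mul (d : Derivation k R R) {x : R} (hx : d x = 1) (j : ℕ) (u : R) :
    ∃ r, d^[j] (x ^ j * u) = (j ! : R) * u + x * r := by
  induction j generalizing u with
  | zero => exact ⟨0, by simp⟩
  | succ j ih =>
    obtain ⟨r, hr⟩ := ih ((j + 1 : ℕ) * u + x * d u)
    refine ⟨(j ! : R) * d u + r, ?_⟩
    have h : d (x ^ (j + 1) * u) = x ^ j * ((j + 1 : ℕ) * u + x * d u) := by
      rw [d.leibniz, d.leibniz_pow, hx]
      simp only [smul_eq_mul, nsmul_eq_mul, Nat.add_sub_cancel]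
      ring
    rw [Function.iterate_succ_apply, h, hr, Nat.factorial_succ]
    push_cast; ring

theorem derivation_iterate_add (d : Derivation k R R) (j : ℕ) (f g : R) :
    d^[j] (f + g) = d^[j] f + d^[j] g := by
  induction j generalizing f g with
  | zero => rfl
  | succ j ih => simp only [Function.iterate_succ_apply, map_add, ih]

variable {d : Derivation k R R} {x : R} {w : ℚ} {L : List (R × ℚ)}

theorem iterate_mem_weightedIdeal
    (hL : ∀ p ∈ L, p.2 ≤ w) (hw : 0 < w) {t : ℚ} {f : R}
    (hf : f ∈ weightedIdeal ((x, w) :: L) t) (i : ℕ) :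
    d^[i] f ∈ weightedIdeal ((x, w) :: L) (t - i * w) := by
  induction i with
  | zero => simpa using hf
  | succ i ih =>
    rw [Function.iterate_succ_apply']
    have e1 : t - ((i + 1 : ℕ) : ℚ) * w = t - i * w - w := by push_cast; ring
    rw [e1]
    refine derivationsLower_weightedIdeal hw.le ?_ d _ _ ih
    simpa using hL

/-- A Taylor expansion criterion for membership in a weighted filtration: it suffices to look at
the restrictions to `V(x)` of the iterated derivatives. -/
theorem mem_weightedIdeal_of_iterate [CharZero k] (hx : d x = 1) (hw : 0 < w) (hL : ∀ p ∈ L, p.2 ≤ w)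
    {t : ℚ} {f : R}
    (hf : ∀ i : ℕ, Ideal.Quotient.mk (Ideal.span {x}) (d^[i] f) ∈
      weightedIdeal (mapElems (Ideal.Quotient.mk (Ideal.span {x})) L) (t - i * w)) :
    f ∈ weightedIdeal ((x, w) :: L) t := by
  have hJ := isFiltration_weightedIdeal ((x, w) :: L)
  have hxm (n : ℕ) : x ^ n ∈ weightedIdeal ((x, w) :: L) (n * w) :=
    pow_mem_weightedIdeal (p := (x, w)) (by simp) n
  -- The Taylor coefficients of f are peeled off one at a time: the remainder x^j u is divisible by
  -- ever higher powers of x.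
  have key : ∀ j : ℕ, ∃ h ∈ weightedIdeal ((x, w) :: L) t, ∃ u, f = h + x ^ j * u := by
    intro j
    induction j with
    | zero => exact ⟨0, zero_mem _, f, by simp⟩
    | succ j ih =>
      obtain ⟨h, hh, u, rfl⟩ := ih
      obtain ⟨r, hr⟩ := derivation_iterate_pow_mul d hx j u
      have h1 := hf j
      have h2 := mk_mem_weightedIdeal_of_cons (iterate_mem_weightedIdeal (d := d) hL hw hh j)
      rw [derivation_iterate_add, hr] at h1
      -- The j-th derivative of h already has degree t - jw, so what remains of that of f, namely j!
      -- u modulo x, has it too.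
      have h3 : Ideal.Quotient.mk (Ideal.span {x}) ((j ! : R) * u) ∈
          weightedIdeal (mapElems (Ideal.Quotient.mk (Ideal.span {x})) L) (t - j * w) := by
        have h4 := sub_mem h1 h2
        have h5 : Ideal.Quotient.mk (Ideal.span {x}) (x * r) = 0 :=
          Ideal.Quotient.eq_zero_iff_mem.2 (Ideal.mem_span_singleton.2 ⟨r, rfl⟩)
        rwa [map_add, map_add, h5, add_zero, add_sub_cancel_left] at h4
      obtain ⟨c, hc⟩ := isUnit_natCast_of_charZero k (R := R) (Nat.factorial_ne_zero j)
      have h6 : Ideal.Quotient.mk (Ideal.span {x}) u ∈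
          weightedIdeal (mapElems (Ideal.Quotient.mk (Ideal.span {x})) L) (t - j * w) := by
        have := Ideal.mul_mem_left _ (Ideal.Quotient.mk (Ideal.span {x}) ↑c⁻¹) h3
        rwa [← map_mul, ← hc, Units.inv_mul_cancel_left] at this
      obtain ⟨h', hh', r', rfl⟩ := exists_of_mk_mem_weightedIdeal w h6
      refine ⟨h + x ^ j * h', add_mem hh ?_, r', by ring⟩
      have := hJ.mul_mem (hxm j) hh'
      rwa [add_sub_cancel] at this
  -- Once jw ≥ t the power x^j alone has degree t, so no completeness of the ring is needed.
  obtain ⟨j, hj⟩ := exists_nat_ge (t / w)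
  obtain ⟨h, hh, u, rfl⟩ := key j
  exact add_mem hh (Ideal.mul_mem_right _ _ (hJ.mem_of_le ((div_le_iff₀ hw).1 hj) (hxm j)))

end Taylor

/-! ### The associated graded ring is a domain; integral closedness. -/

section GradedDomain

/-- The associated graded ring of the weighted filtration, in integral degrees, is a domain. -/
def IsGradedDomain {R : Type*} [CommRing R] (L : List (R × ℚ)) : Prop :=
  ∀ (s t : ℤ) (f g : R), f ∈ weightedIdeal L s → g ∈ weightedIdeal L t →
    f * g ∈ weightedIdeal L ((s + t + 1 : ℤ) : ℚ) →
      f ∈ weightedIdeal L ((s + 1 : ℤ) : ℚ) ∨ g ∈ weightedIdeal L ((t + 1 : ℤ) : ℚ)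

theorem isGradedDomain_nil {R : Type*} [CommRing R] [IsDomain R] :
    IsGradedDomain ([] : List (R × ℚ)) := by
  intro s t f g hf hg hfg
  have hJ := isFiltration_weightedIdeal ([] : List (R × ℚ))
  by_cases hs : s + 1 ≤ 0
  · exact Or.inl (hJ.mem_of_nonpos (by exact_mod_cast hs) f)
  by_cases ht : t + 1 ≤ 0
  · exact Or.inr (hJ.mem_of_nonpos (by exact_mod_cast ht) g)
  rw [weightedIdeal_nil (by norm_cast; omega), Ideal.mem_bot, mul_eq_zero] at hfg
  rcases hfg with rfl | rfl
  · exact Or.inl (zero_mem _)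
  · exact Or.inr (zero_mem _)

variable {k R : Type*} [Field k] [CharZero k] [CommRing R] [Algebra k R]

/-- The argument of Gauss's lemma. Let i and j be the first indices at which the derivatives of f
and g, restricted to V(x), fail to have the higher degree. In the (i+j)-th derivative of fg every
other Leibniz term has the higher degree, so the product of the two exceptional ones has it too,
against the hypothesis on V(x). The weight n is an integer so that the shifted degrees s - in stay
integral. -/
theorem IsGradedDomain.cons {d : Derivation k R R} {x : R} (hx : d x = 1) {n : ℕ} (hn : 0 < n)
    {L : List (R × ℚ)} (hL : ∀ p ∈ L, p.2 ≤ n)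
    (h : IsGradedDomain (mapElems (Ideal.Quotient.mk (Ideal.span {x})) L)) :
    IsGradedDomain ((x, (n : ℚ)) :: L) := by
  classical
  have hn' : (0 : ℚ) < n := Nat.cast_pos.2 hn
  set q := Ideal.Quotient.mk (Ideal.span {x})
  have hJ := isFiltration_weightedIdeal (mapElems q L)
  have hall (s : ℚ) (f : R) (hf : f ∈ weightedIdeal ((x, (n : ℚ)) :: L) s) (i : ℕ) :
      q (d^[i] f) ∈ weightedIdeal (mapElems q L) (s - i * n) :=
    mk_mem_weightedIdeal_of_cons (iterate_mem_weightedIdeal hL hn' hf i)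
  have hex (s : ℤ) (f : R) (hf : f ∉ weightedIdeal ((x, (n : ℚ)) :: L) ((s + 1 : ℤ) : ℚ)) :
      ∃ i : ℕ, q (d^[i] f) ∉ weightedIdeal (mapElems q L) (((s + 1 : ℤ) : ℚ) - i * n) := by
    by_contra! hc
    exact hf (mem_weightedIdeal_of_iterate hx hn' hL hc)
  intro s t f g hf hg hfg
  by_contra! hcon
  have hif := hex s f hcon.1
  have hig := hex t g hcon.2
  set i := Nat.find hif with hi
  set j := Nat.find hig with hj
  have hi1 := Nat.find_spec hif
  have hj1 := Nat.find_spec hig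
  rw [← hi] at hi1
  rw [← hj] at hj1
  have hsum := hall _ _ hfg (i + j)
  rw [derivation_iterate_mul, map_sum, ← Finset.add_sum_erase _ _
    (show (i, j) ∈ Finset.HasAntidiagonal.antidiagonal (i + j) by simp)] at hsum
  have hrest : ∑ ij ∈ (Finset.HasAntidiagonal.antidiagonal (i + j)).erase (i, j),
      q (((i + j).choose ij.1 : R) * (d^[ij.1] f * d^[ij.2] g)) ∈
        weightedIdeal (mapElems q L) (((s + t + 1 : ℤ) : ℚ) - ((i + j : ℕ) : ℚ) * n) := by
    refine Ideal.sum_mem _ fun ab hab => ?_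
    obtain ⟨a, b⟩ := ab
    simp only [Finset.mem_erase, Finset.HasAntidiagonal.mem_antidiagonal, ne_eq, Prod.mk.injEq] at hab
    obtain ⟨hne, hab⟩ := hab
    rw [map_mul]
    refine Ideal.mul_mem_left _ _ ?_
    rw [map_mul]
    have hab' : ((i + j : ℕ) : ℚ) = a + b := by rw [← hab]; push_cast; rfl
    rw [hab']
    rcases lt_or_ge a i with ha | ha
    · have h1 := not_not.1 (Nat.find_min hif ha)
      refine hJ.mem_of_le (le_of_eq ?_) (hJ.mul_mem h1 (hall _ _ hg b))
      push_cast; ring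
    · have h1 := not_not.1 (Nat.find_min hig (show b < j by omega))
      refine hJ.mem_of_le (le_of_eq ?_) (hJ.mul_mem (hall _ _ hf a) h1)
      push_cast; ring
  have hmain := (Ideal.add_mem_iff_left _ hrest).1 hsum
  dsimp only at hmain
  have hmain2 : q (d^[i] f) * q (d^[j] g) ∈
      weightedIdeal (mapElems q L) (((s + t + 1 : ℤ) : ℚ) - ((i + j : ℕ) : ℚ) * n) := by
    obtain ⟨c, hc⟩ := isUnit_natCast_of_charZero k (R := R)
      (Nat.choose_pos (Nat.le_add_right i j)).ne'
    have := Ideal.mul_mem_left _ (q ↑c⁻¹) hmain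
    rwa [← map_mul, ← hc, Units.inv_mul_cancel_left, map_mul] at this
  have := h (s - i * n) (t - j * n) (q (d^[i] f)) (q (d^[j] g))
    (by have := hall _ _ hf i; push_cast; exact this)
    (by have := hall _ _ hg j; push_cast; exact this)
    (hJ.mem_of_le (le_of_eq (by push_cast; ring)) hmain2)
  rcases this with h1 | h1
  · exact hi1 (hJ.mem_of_le (le_of_eq (by push_cast; ring)) h1)
  · exact hj1 (hJ.mem_of_le (le_of_eq (by push_cast; ring)) h1)

variable {L : List (R × ℚ)}

/-- The weighted filtration is integrally closed in integral degrees. -/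
theorem IsGradedDomain.mem_of_pow_mem {R : Type*} [CommRing R] {L : List (R × ℚ)}
    (h : IsGradedDomain L) {N : ℕ} {t : ℤ} {f : R} (hf : f ^ N ∈ weightedIdeal L (N * t))
    (hN : N ≠ 0) : f ∈ weightedIdeal L t := by
  have hJ := isFiltration_weightedIdeal L
  have key : ∀ m : ℕ, (m : ℤ) ≤ t → f ∈ weightedIdeal L m := by
    intro m
    induction m with
    | zero => intro _; exact hJ.mem_of_nonpos (by simp) f
    | succ m ih =>
      intro hm
      have hfm : f ∈ weightedIdeal L ((m : ℤ) : ℚ) := by simpa using ih (by push_cast at hm; omega)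
      by_contra hcon
      have hpow : ∀ j : ℕ, f ^ j ∈ weightedIdeal L ((j * m : ℤ) : ℚ) := fun j => by
        simpa using hJ.pow_mem hfm j
      -- If f has order exactly m then f^j has order exactly jm; for j = N this contradicts the
      -- hypothesis, because m < t gives Nm + 1 ≤ Nt.
      have hnot : ∀ j : ℕ, 1 ≤ j → f ^ j ∉ weightedIdeal L ((j * m + 1 : ℤ) : ℚ) := by
        intro j hj
        induction j, hj using Nat.le_induction with
        | base => simpa using hcon
        | succ j hj ihj =>
          intro hmem
          rw [pow_succ] at hmem
          rcases h (j * m) m _ _ (hpow j) hfm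
            (hJ.mem_of_le (le_of_eq (by push_cast; ring)) hmem) with h1 | h1
          · exact ihj h1
          · exact hcon (by simpa using h1)
      refine hnot N (by omega) (hJ.mem_of_le ?_ hf)
      have : (N : ℤ) * m + 1 ≤ N * t := by
        have h1 : (1 : ℤ) ≤ N := by omega
        push_cast at hm
        nlinarith
      exact_mod_cast this
  rcases le_or_gt t 0 with ht | ht
  · exact hJ.mem_of_nonpos (by exact_mod_cast ht) f
  · have := key t.toNat (by omega)
    have e1 : ((t.toNat : ℕ) : ℚ) = (t : ℚ) := by
      have : ((t.toNat : ℕ) : ℤ) = t := Int.toNat_of_nonneg ht.le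
      exact_mod_cast congrArg (Int.cast : ℤ → ℚ) this
    rwa [e1] at this

end GradedDomain

end WeightedCenters

namespace WeightedCenters

open IsLocalRing

/-! ### Local rings with enough derivations and their hypersurfaces. -/

section Local

/-- A Noetherian local `k`-algebra in which the derivations separate tangent directions: every
functional on `m / m ^ 2` (given by a function on `m` that is linear modulo `m`) comes from a
`k`-derivation. -/
structure HasParameters (k R : Type*) [Field k] [CommRing R] [IsLocalRing R] [Algebra k R] :
    Prop where
  noetherian : IsNoetherianRing R
  exists_derivation : ∀ l : R → R,
    (∀ y ∈ maximalIdeal R, ∀ z ∈ maximalIdeal R, l (y + z) - (l y + l z) ∈ maximalIdeal R) →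
    (∀ r, ∀ z ∈ maximalIdeal R, l (r * z) - r * l z ∈ maximalIdeal R) →
    ∃ d : Derivation k R R, ∀ z ∈ maximalIdeal R, d z - l z ∈ maximalIdeal R

variable {k R : Type*} [Field k] [CommRing R] [IsLocalRing R] [Algebra k R]

theorem isLocalRing_quotient {x : R} (hx : x ∈ maximalIdeal R) :
    IsLocalRing (R ⧸ Ideal.span {x}) := by
  have : Nontrivial (R ⧸ Ideal.span {x}) := Ideal.Quotient.nontrivial_iff.2 fun h =>
    (maximalIdeal.isMaximal R).ne_top (top_le_iff.1 (h ▸ (Ideal.span_singleton_le_iff_mem _).2 hx))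
  exact IsLocalRing.of_surjective' _ Ideal.Quotient.mk_surjective

section Quotient

variable {x : R} [IsLocalRing (R ⧸ Ideal.span {x})]

theorem mem_maximalIdeal_of_isLocalRing_quotient (x : R) [IsLocalRing (R ⧸ Ideal.span {x})] :
    x ∈ maximalIdeal R := by
  rw [mem_maximalIdeal, mem_nonunits_iff]
  intro h
  exact zero_ne_one (α := R ⧸ Ideal.span {x})
    ((Ideal.Quotient.subsingleton_iff.2 (Ideal.span_singleton_eq_top.2 h)).elim 0 1)

theorem mk_mem_maximalIdeal_iff {f : R} :
    Ideal.Quotient.mk (Ideal.span {x}) f ∈ maximalIdeal (R ⧸ Ideal.span {x}) ↔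
      f ∈ maximalIdeal R := by
  have := IsLocalHom.of_surjective _ (Ideal.Quotient.mk_surjective (I := Ideal.span {x}))
  rw [mem_maximalIdeal, mem_maximalIdeal, map_mem_nonunits_iff]

theorem map_maximalIdeal_mk :
    (maximalIdeal R).map (Ideal.Quotient.mk (Ideal.span {x})) =
      maximalIdeal (R ⧸ Ideal.span {x}) := by
  apply le_antisymm
  · rw [Ideal.map_le_iff_le_comap]
    intro f hf
    exact mk_mem_maximalIdeal_iff.2 hf
  · intro f hf
    obtain ⟨f, rfl⟩ := Ideal.Quotient.mk_surjective f
    exact Ideal.mem_map_of_mem _ (mk_mem_maximalIdeal_iff.1 hf)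

theorem mk_mem_maximalIdeal_pow_iff {f : R} {n : ℕ} :
    Ideal.Quotient.mk (Ideal.span {x}) f ∈ maximalIdeal (R ⧸ Ideal.span {x}) ^ n ↔
      f ∈ maximalIdeal R ^ n ⊔ Ideal.span {x} := by
  rw [← map_maximalIdeal_mk, ← Ideal.map_pow, ← Ideal.mem_comap,
    Ideal.comap_map_of_surjective _ Ideal.Quotient.mk_surjective, ← RingHom.ker_eq_comap_bot,
    Ideal.mk_ker]

end Quotient

theorem HasParameters.exists_derivation_dual (h : HasParameters k R)
    (l : CotangentSpace R →ₗ[ResidueField R] ResidueField R) :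
    ∃ d : Derivation k R R, ∀ z : maximalIdeal R,
      residue R (d z) = l ((maximalIdeal R).toCotangent z) := by
  classical
  let s := Function.surjInv (residue_surjective (R := R))
  have hs (a) : residue R (s a) = a := Function.surjInv_eq _ a
  let l' : R → R := fun z =>
    if hz : z ∈ maximalIdeal R then s (l ((maximalIdeal R).toCotangent ⟨z, hz⟩)) else 0
  have hl' (z : R) (hz : z ∈ maximalIdeal R) :
      residue R (l' z) = l ((maximalIdeal R).toCotangent ⟨z, hz⟩) := by
    simp only [l', hz, dif_pos, hs]
  have ⟨d, hd⟩ : ∃ d : Derivation k R R, ∀ z ∈ maximalIdeal R, d z - l' z ∈ maximalIdeal R := by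
    apply h.exists_derivation l'
    · intro y hy z hz
      rw [← residue_eq_zero_iff, map_sub, map_add, hl' y hy, hl' z hz, hl' _ (add_mem hy hz),
        ← map_add, ← map_add, sub_eq_zero]
      rfl
    · intro r z hz
      rw [← residue_eq_zero_iff, map_sub, map_mul, hl' z hz, hl' _ (Ideal.mul_mem_left _ _ hz),
        sub_eq_zero]
      have h1 : (maximalIdeal R).toCotangent ⟨r * z, Ideal.mul_mem_left _ r hz⟩ =
          residue R r • (maximalIdeal R).toCotangent ⟨z, hz⟩ :=
        (maximalIdeal R).toCotangent.map_smul r ⟨z, hz⟩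
      rw [h1, map_smul, smul_eq_mul]
  refine ⟨d, fun z => ?_⟩
  have := hd z z.2
  rw [← residue_eq_zero_iff, map_sub, sub_eq_zero] at this
  rw [this, hl' z z.2]

theorem HasParameters.exists_derivation_eq_one (h : HasParameters k R) {x : R}
    (hx : x ∈ maximalIdeal R) (hx2 : x ∉ maximalIdeal R ^ 2) :
    ∃ d : Derivation k R R, d x = 1 := by
  have hne : (maximalIdeal R).toCotangent ⟨x, hx⟩ ≠ 0 := by
    rwa [Ne, Ideal.toCotangent_eq_zero]
  obtain ⟨l, hl⟩ := Module.Projective.exists_dual_eq_one (ResidueField R)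
    (V := CotangentSpace R) hne
  obtain ⟨d, hd⟩ := h.exists_derivation_dual l
  have hu : IsUnit (d x) := by
    rw [← residue_ne_zero_iff_isUnit, hd ⟨x, hx⟩, hl]
    exact one_ne_zero
  obtain ⟨u, hu⟩ := hu
  exact ⟨(↑u⁻¹ : R) • d, by simp [← hu]⟩

theorem exists_quotient_derivation {R : Type*} [CommRing R] [Algebra k R] (d : Derivation k R R) {x : R} (hx : d x = 0) :
    ∃ e : Derivation k (R ⧸ Ideal.span {x}) (R ⧸ Ideal.span {x}),
      ∀ f, e (Ideal.Quotient.mk _ f) = Ideal.Quotient.mk _ (d f) := by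
  set q := Ideal.Quotient.mk (Ideal.span {x})
  have hq : Function.Surjective q := Ideal.Quotient.mk_surjective
  let e : R ⧸ Ideal.span {x} → R ⧸ Ideal.span {x} := fun a => q (d (Function.surjInv hq a))
  have he (f : R) : e (q f) = q (d f) := by
    change q (d (Function.surjInv hq (q f))) = q (d f)
    obtain ⟨r, hr⟩ := Ideal.mem_span_singleton.1
      (Ideal.Quotient.eq.1 (Function.surjInv_eq hq (q f)))
    rw [Ideal.Quotient.eq, ← map_sub, hr, d.leibniz, hx, smul_zero, add_zero, smul_eq_mul]
    exact Ideal.mul_mem_right _ _ (Ideal.mem_span_singleton_self x)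
  let E : (R ⧸ Ideal.span {x}) →ₗ[k] (R ⧸ Ideal.span {x}) :=
    { toFun := e
      map_add' := fun a b => by
        obtain ⟨a, rfl⟩ := hq a
        obtain ⟨b, rfl⟩ := hq b
        rw [← map_add, he, he, he, map_add, map_add]
      map_smul' := fun c a => by
        obtain ⟨a, rfl⟩ := hq a
        change e (c • q a) = c • e (q a)
        have hs (b : R) : c • q b = q (c • b) := rfl
        rw [he, hs, hs, he, Derivation.map_smul] }
  refine ⟨Derivation.mk' E fun a b => ?_, he⟩
  obtain ⟨a, rfl⟩ := hq a
  obtain ⟨b, rfl⟩ := hq b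
  change e (q a * q b) = q a • e (q b) + q b • e (q a)
  rw [← map_mul, he, he, he, d.leibniz, map_add]
  simp [smul_eq_mul]

/-- The class of local rings with enough derivations is stable under passing to the hypersurface of
a regular parameter. -/
theorem HasParameters.quotient (h : HasParameters k R) {x : R} (hx2 : x ∉ maximalIdeal R ^ 2)
    [IsLocalRing (R ⧸ Ideal.span {x})] : HasParameters k (R ⧸ Ideal.span {x}) := by
  have hx := mem_maximalIdeal_of_isLocalRing_quotient x
  have := h.noetherian
  refine ⟨inferInstance, fun l hadd hmul => ?_⟩
  set q := Ideal.Quotient.mk (Ideal.span {x})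
  have hq : Function.Surjective q := Ideal.Quotient.mk_surjective
  let l' : R → R := fun z => Function.surjInv hq (l (q z))
  have hl' (z : R) : q (l' z) = l (q z) := Function.surjInv_eq hq _
  have ⟨d, hd⟩ : ∃ d : Derivation k R R, ∀ z ∈ maximalIdeal R, d z - l' z ∈ maximalIdeal R := by
    apply h.exists_derivation l'
    · intro y hy z hz
      rw [← mk_mem_maximalIdeal_iff (x := x), map_sub, map_add, hl', hl', hl', map_add]
      exact hadd _ (mk_mem_maximalIdeal_iff.2 hy) _ (mk_mem_maximalIdeal_iff.2 hz)
    · intro r z hz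
      rw [← mk_mem_maximalIdeal_iff (x := x), map_sub, map_mul, hl', hl', map_mul]
      exact hmul _ _ (mk_mem_maximalIdeal_iff.2 hz)
  obtain ⟨d1, hd1⟩ := h.exists_derivation_eq_one hx hx2
  have hlx : l' x ∈ maximalIdeal R := by
    rw [← mk_mem_maximalIdeal_iff (x := x), hl']
    have h0 : q x = 0 := Ideal.Quotient.eq_zero_iff_mem.2 (Ideal.mem_span_singleton_self x)
    have := hmul 0 0 (zero_mem _)
    rwa [mul_zero, zero_mul, sub_zero, ← h0] at this
  have hdx : d x ∈ maximalIdeal R := by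
    have := add_mem (hd x hx) hlx
    rwa [sub_add_cancel] at this
  -- Only a derivation that kills x descends to R/(x). The correction does not change the
  -- functional, as d x lies in m.
  obtain ⟨e, he⟩ := exists_quotient_derivation (d - d x • d1) (x := x) (by simp [hd1])
  refine ⟨e, fun z hz => ?_⟩
  obtain ⟨z, rfl⟩ := hq z
  rw [he, ← hl', ← map_sub, mk_mem_maximalIdeal_iff]
  have h1 : (d - d x • d1) z - l' z = (d z - l' z) - d x * d1 z := by
    simp only [Derivation.sub_apply, Derivation.smul_apply, smul_eq_mul]; ring
  rw [h1]
  exact sub_mem (hd z (mk_mem_maximalIdeal_iff.1 hz)) (Ideal.mul_mem_right _ _ hdx)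

theorem exists_mem_maximalIdeal_not_mem_sq [IsNoetherianRing R] (h : maximalIdeal R ≠ ⊥) :
    ∃ x ∈ maximalIdeal R, x ∉ maximalIdeal R ^ 2 := by
  by_contra! hc
  refine h (Submodule.eq_bot_of_le_smul_of_le_jacobson_bot (maximalIdeal R) (maximalIdeal R)
    (IsNoetherian.noetherian _) ?_ (IsLocalRing.jacobson_eq_maximalIdeal ⊥ bot_ne_top).ge)
  rw [smul_eq_mul, ← pow_two]
  exact hc

theorem exists_not_mem_maximalIdeal_pow [IsNoetherianRing R] {f : R} (hf : f ≠ 0) :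
    ∃ n, f ∉ maximalIdeal R ^ n := by
  by_contra! hc
  refine hf ?_
  have := Ideal.iInf_pow_eq_bot_of_isLocalRing (maximalIdeal R) (maximalIdeal.isMaximal R).ne_top
  rw [← Ideal.mem_bot, ← this]
  exact (Submodule.mem_iInf _).2 hc

/-- The maximal ideal of the hypersurface of a regular parameter needs one generator less. -/
theorem exists_span_eq_maximalIdeal_quotient {n : ℕ} {s : Finset R} (hs : s.card ≤ n + 1)
    (hspan : Ideal.span (s : Set R) = maximalIdeal R) {x : R} (hx2 : x ∉ maximalIdeal R ^ 2)
    [IsLocalRing (R ⧸ Ideal.span {x})] :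
    ∃ t : Finset (R ⧸ Ideal.span {x}), t.card ≤ n ∧
      Ideal.span (t : Set (R ⧸ Ideal.span {x})) = maximalIdeal (R ⧸ Ideal.span {x}) := by
  classical
  have hx := mem_maximalIdeal_of_isLocalRing_quotient x
  set q := Ideal.Quotient.mk (Ideal.span {x})
  have hx' := hx
  rw [← hspan] at hx'
  obtain ⟨c, hc⟩ := Submodule.mem_span_finset.1 hx'
  have hsm (z : R) (hz : z ∈ s) : z ∈ maximalIdeal R := hspan ▸ Ideal.subset_span hz
  -- As x is not in m², some coefficient of x is a unit; modulo x the corresponding generator is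
  -- redundant.
  obtain ⟨z, hz, hcz⟩ : ∃ z ∈ s, c z ∉ maximalIdeal R := by
    by_contra! hall
    refine hx2 ?_
    rw [← hc.2, pow_two]
    exact Ideal.sum_mem _ fun z hz => Ideal.mul_mem_mul (hall z hz) (hsm z hz)
  refine ⟨(s.erase z).image q, ?_, ?_⟩
  · refine Finset.card_image_le.trans ?_
    rw [Finset.card_erase_of_mem hz]; omega
  · rw [← map_maximalIdeal_mk, ← hspan, Ideal.map_span]
    apply le_antisymm
    · exact Ideal.span_mono (by
        rw [Finset.coe_image]; exact Set.image_mono (by simp))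
    · rw [Ideal.span_le]
      rintro _ ⟨y, hy, rfl⟩
      by_cases hyz : y = z
      · subst hyz
        obtain ⟨u, hu⟩ := notMem_maximalIdeal.1 hcz
        have h0 : q x = 0 := Ideal.Quotient.eq_zero_iff_mem.2 (Ideal.mem_span_singleton_self x)
        have h0' := (congrArg q hc.2).trans h0
        rw [← Finset.add_sum_erase _ _ hz, map_add, smul_eq_mul, map_mul,
          add_eq_zero_iff_eq_neg] at h0'
        have h1 : q y = q ↑u⁻¹ * -q (∑ a ∈ s.erase y, c a • a) := by
          rw [← h0', ← map_mul, ← map_mul, ← hu, Units.inv_mul_cancel_left]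
        rw [SetLike.mem_coe, h1]
        refine Ideal.mul_mem_left _ _ (neg_mem ?_)
        rw [map_sum]
        refine Ideal.sum_mem _ fun a ha => ?_
        rw [smul_eq_mul, map_mul]
        exact Ideal.mul_mem_left _ _ (Ideal.subset_span (Finset.mem_image_of_mem _ ha))
      · exact Ideal.subset_span (Finset.mem_image_of_mem _ (Finset.mem_erase.2 ⟨hyz, hy⟩))

/-- If W bounds the weights, elements of degree t lie in m^⌈t/W⌉, and the m-adic filtration is
separated by Krull's intersection theorem. -/
theorem exists_not_mem_weightedIdeal [IsNoetherianRing R] {L : List (R × ℚ)}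
    (hL : ∀ p ∈ L, p.1 ∈ maximalIdeal R) {f : R} (hf : f ≠ 0) :
    ∃ t : ℕ, f ∉ weightedIdeal L t := by
  obtain ⟨n, hn⟩ := exists_not_mem_maximalIdeal_pow hf
  obtain ⟨W, hW0, hW⟩ : ∃ W : ℚ, 0 < W ∧ ∀ p ∈ L, p.2 ≤ W := by
    clear hL
    induction L with
    | nil => exact ⟨1, one_pos, by simp⟩
    | cons p L ih =>
      obtain ⟨W, h0, hW⟩ := ih
      refine ⟨max W p.2, lt_max_of_lt_left h0, fun r hr => ?_⟩
      rcases List.mem_cons.1 hr with rfl | hr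
      · exact le_max_right _ _
      · exact (hW r hr).trans (le_max_left _ _)
  obtain ⟨t, ht⟩ := exists_nat_ge (n * W)
  refine ⟨t, fun hft => hn ?_⟩
  have h1 := weightedIdeal_le_pow (N := maximalIdeal R) (inv_pos.2 hW0) (L := L)
    (fun p hp => ⟨hL p hp, by rw [inv_mul_le_iff₀ hW0, mul_one]; exact hW p hp⟩) t hft
  refine Ideal.pow_le_pow_right ?_ h1
  rw [← Nat.cast_le (α := ℚ)]
  refine le_trans ?_ (Nat.le_ceil _)
  rwa [le_inv_mul_iff₀ hW0, mul_comm]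

/-- The order of a nonzero element with respect to a separated weighted filtration. -/
theorem exists_mem_weightedIdeal_not_mem_succ {R : Type*} [CommRing R] {L : List (R × ℚ)} {f : R}
    (hf : ∃ t : ℕ, f ∉ weightedIdeal L t) :
    ∃ m : ℕ, f ∈ weightedIdeal L (m : ℤ) ∧ f ∉ weightedIdeal L ((m + 1 : ℤ) : ℚ) := by
  classical
  obtain ⟨m, hm⟩ : ∃ m, Nat.find hf = m + 1 := by
    refine Nat.exists_eq_succ_of_ne_zero fun h0 => ?_
    have := Nat.find_spec hf
    rw [h0] at this
    exact this ((isFiltration_weightedIdeal L).mem_of_nonpos (by simp) f)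
  refine ⟨m, ?_, ?_⟩
  · simpa using not_not.1 (Nat.find_min hf (show m < Nat.find hf by omega))
  · have := Nat.find_spec hf
    rw [hm] at this
    simpa using this

theorem IsGradedDomain.mul_ne_zero {R : Type*} [CommRing R] {L : List (R × ℚ)}
    (h : IsGradedDomain L) (hL : ∀ f : R, f ≠ 0 → ∃ t : ℕ, f ∉ weightedIdeal L t) {f g : R}
    (hf : f ≠ 0) (hg : g ≠ 0) : f * g ≠ 0 := by
  obtain ⟨m, hm, hm'⟩ := exists_mem_weightedIdeal_not_mem_succ (hL f hf)
  obtain ⟨n, hn, hn'⟩ := exists_mem_weightedIdeal_not_mem_succ (hL g hg)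
  intro h0
  rcases h m n f g hm hn (h0 ▸ zero_mem _) with h1 | h1
  · exact hm' h1
  · exact hn' h1

/-- Induction on the number of generators of m. If R/(x) is a domain, then the graded ring of the
filtration with x in degree 1 is a domain, and the filtration is separated, so R is a domain. -/
theorem HasParameters.isDomain_aux [CharZero k] (n : ℕ) : ∀ {R : Type v} [CommRing R]
    [IsLocalRing R] [Algebra k R], HasParameters k R → ∀ s : Finset R, s.card ≤ n →
      Ideal.span (s : Set R) = maximalIdeal R → IsDomain R := by
  induction n with
  | zero =>
    intro R _ _ _ h s hs hspan
    rw [Nat.le_zero, Finset.card_eq_zero] at hs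
    subst hs
    rw [Finset.coe_empty, Ideal.span_empty] at hspan
    exact (IsLocalRing.isField_iff_maximalIdeal_eq.2 hspan.symm).isDomain
  | succ n ih =>
    intro R _ _ _ h s hs hspan
    have := h.noetherian
    by_cases hm : maximalIdeal R = ⊥
    · exact (IsLocalRing.isField_iff_maximalIdeal_eq.2 hm).isDomain
    · obtain ⟨x, hx, hx2⟩ := exists_mem_maximalIdeal_not_mem_sq hm
      have := isLocalRing_quotient hx
      obtain ⟨t, ht, htspan⟩ := exists_span_eq_maximalIdeal_quotient hs hspan hx2
      have hdom := ih (h.quotient hx2) t ht htspan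
      obtain ⟨d, hd⟩ := h.exists_derivation_eq_one hx hx2
      have hgr : IsGradedDomain [(x, ((1 : ℕ) : ℚ))] :=
        IsGradedDomain.cons hd one_pos (by simp) isGradedDomain_nil
      have hnz {f g : R} (hf : f ≠ 0) (hg : g ≠ 0) : f * g ≠ 0 :=
        hgr.mul_ne_zero (fun f hf => exists_not_mem_weightedIdeal (by simpa using hx) hf) hf hg
      have : NoZeroDivisors R := ⟨fun {a b} hab => by
        by_contra! hc
        exact hnz hc.1 hc.2 hab⟩
      exact NoZeroDivisors.to_isDomain R

theorem HasParameters.isDomain [CharZero k] (h : HasParameters k R) : IsDomain R := by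
  have := h.noetherian
  obtain ⟨s, hs⟩ := IsNoetherian.noetherian (maximalIdeal R)
  exact HasParameters.isDomain_aux s.card h s le_rfl hs

end Local

end WeightedCenters

namespace WeightedCenters

open IsLocalRing

/-! ### Partial systems of parameters, by induction along hypersurfaces. -/

section Independence

/-- The elements of `xs` lie in `m` and are linearly independent modulo `m ^ 2`. -/
def IsIndependent {R : Type*} [CommRing R] [IsLocalRing R] (xs : List R) : Prop :=
  (∀ x ∈ xs, x ∈ maximalIdeal R) ∧
    ∀ c : ℕ → R, ∑ i ∈ Finset.range xs.length, c i * xs.getD i 0 ∈ maximalIdeal R ^ 2 →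
      ∀ i < xs.length, c i ∈ maximalIdeal R

variable {R : Type*} [CommRing R] [IsLocalRing R]

theorem isIndependent_nil : IsIndependent ([] : List R) := by
  simp [IsIndependent]

theorem isPartialParameterSystem_iff {xs : List R} :
    IsPartialParameterSystem xs ↔ IsIndependent xs := by
  have key (h : ∀ i : Fin xs.length, xs.get i ∈ maximalIdeal R) (c : ℕ → R) :
      ∑ i ∈ Finset.range xs.length, c i * xs.getD i 0 ∈ maximalIdeal R ^ 2 ↔
        ∑ i : Fin xs.length, residue R (c i) •
          ((maximalIdeal R).toCotangent ⟨xs.get i, h i⟩ : CotangentSpace R) = 0 := by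
    have h1 : ∑ i : Fin xs.length, residue R (c i) •
          ((maximalIdeal R).toCotangent ⟨xs.get i, h i⟩ : CotangentSpace R) =
        (maximalIdeal R).toCotangent (∑ i : Fin xs.length, c i • ⟨xs.get i, h i⟩) := by
      rw [map_sum]
      exact Finset.sum_congr rfl fun i _ => ((maximalIdeal R).toCotangent.map_smul _ _).symm
    rw [h1, Ideal.toCotangent_eq_zero, ← Fin.sum_univ_eq_sum_range]
    simp
  constructor
  · rintro ⟨h, hli⟩
    refine ⟨fun x hx => ?_, fun c hc i hi => ?_⟩
    · obtain ⟨i, rfl⟩ := List.get_of_mem hx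
      exact h i
    · rw [key h] at hc
      exact residue_eq_zero_iff _ |>.1
        (Fintype.linearIndependent_iff.1 hli (fun i => residue R (c i)) hc ⟨i, hi⟩)
  · rintro ⟨h, hc⟩
    refine ⟨fun i => h _ (List.get_mem _ _), Fintype.linearIndependent_iff.2 fun g hg i => ?_⟩
    let c : ℕ → R := fun j => if hj : j < xs.length then
      Function.surjInv (residue_surjective (R := R)) (g ⟨j, hj⟩) else 0
    have hcg (i : Fin xs.length) : residue R (c i) = g i := by
      simp only [c, i.2, dif_pos]
      exact Function.surjInv_eq _ _
    have := hc c ((key (fun i => h _ (List.get_mem _ _)) c).2 (by simpa only [hcg] using hg)) i i.2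
    rw [← hcg, residue_eq_zero_iff]
    exact this

/-- This recursion matches that of `IsAssociated`, and makes parameter systems accessible to
induction along V(x). -/
theorem isIndependent_cons {x : R} {xs : List R} [IsLocalRing (R ⧸ Ideal.span {x})] :
    IsIndependent (x :: xs) ↔ x ∉ maximalIdeal R ^ 2 ∧
      IsIndependent (xs.map (Ideal.Quotient.mk (Ideal.span {x}))) := by
  have hx := mem_maximalIdeal_of_isLocalRing_quotient x
  set q := Ideal.Quotient.mk (Ideal.span {x})
  have hq : Function.Surjective q := Ideal.Quotient.mk_surjective
  have hsum (c : ℕ → R) :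
      ∑ i ∈ Finset.range (xs.map q).length, q (c i) * (xs.map q).getD i 0 =
        q (∑ i ∈ Finset.range xs.length, c i * xs.getD i 0) := by
    rw [map_sum, List.length_map]
    refine Finset.sum_congr rfl fun i _ => ?_
    rw [map_mul, ← List.getD_map (f := q), map_zero]
  have hsum' (c : ℕ → R) : ∑ i ∈ Finset.range (x :: xs).length, c i * (x :: xs).getD i 0 =
      ∑ i ∈ Finset.range xs.length, c (i + 1) * xs.getD i 0 + c 0 * x := by
    rw [List.length_cons, Finset.sum_range_succ']
    simp
  constructor
  · rintro ⟨hmem, hind⟩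
    refine ⟨fun hx2 => ?_, ?_, fun c hc i hi => ?_⟩
    · have := hind (fun i => if i = 0 then 1 else 0) (by rw [hsum']; simpa using hx2) 0 (by simp)
      exact (maximalIdeal.isMaximal R).ne_top ((Ideal.eq_top_iff_one _).2 (by simpa only [if_true] using this))
    · intro y hy
      obtain ⟨y, hy', rfl⟩ := List.mem_map.1 hy
      exact mk_mem_maximalIdeal_iff.2 (hmem y (List.mem_cons_of_mem _ hy'))
    · obtain ⟨c, rfl⟩ : ∃ c' : ℕ → R, c = fun i => q (c' i) :=
        ⟨fun i => Function.surjInv hq (c i), funext fun i => (Function.surjInv_eq hq _).symm⟩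
      rw [hsum, mk_mem_maximalIdeal_pow_iff] at hc
      obtain ⟨a, ha, b, hb, hab⟩ := Submodule.mem_sup.1 hc
      obtain ⟨r, rfl⟩ := Ideal.mem_span_singleton'.1 hb
      have := hind (fun i => if i = 0 then -r else c (i - 1)) (by
        rw [hsum']
        simp only [Nat.add_eq_zero_iff, one_ne_zero, and_false, if_false, Nat.add_sub_cancel,
          if_true]
        rw [← hab]
        simpa using ha) (i + 1) (by simpa using hi)
      exact mk_mem_maximalIdeal_iff.2 (by simpa using this)
  · rintro ⟨hx2, hmem, hind⟩
    have htail : ∀ y ∈ xs, y ∈ maximalIdeal R := fun y hy =>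
      mk_mem_maximalIdeal_iff.1 (hmem _ (List.mem_map_of_mem hy))
    refine ⟨by simpa using ⟨hx, htail⟩, fun c hc => ?_⟩
    rw [hsum'] at hc
    have h1 : ∀ i < xs.length, c (i + 1) ∈ maximalIdeal R := fun i hi =>
      mk_mem_maximalIdeal_iff.1 (hind (fun i => q (c (i + 1))) (by
        rw [hsum fun i => c (i + 1), mk_mem_maximalIdeal_pow_iff]
        refine Submodule.mem_sup.2 ⟨_, hc, -(c 0 * x), neg_mem (Ideal.mul_mem_left _ _
          (Ideal.mem_span_singleton_self x)), by ring⟩) i (by simpa using hi))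
    intro i hi
    cases i with
    | succ i => exact h1 i (by simpa using hi)
    | zero =>
      by_contra h0
      obtain ⟨u, hu⟩ := notMem_maximalIdeal.1 h0
      have h2 : ∑ i ∈ Finset.range xs.length, c (i + 1) * xs.getD i 0 ∈ maximalIdeal R ^ 2 := by
        refine Ideal.sum_mem _ fun i hi => ?_
        rw [pow_two]
        have hi' := Finset.mem_range.1 hi
        refine Ideal.mul_mem_mul (h1 i hi') ?_
        rw [List.getD_eq_getElem _ _ hi']
        exact htail _ (List.getElem_mem hi')
      have h3 := Ideal.mul_mem_left _ (↑u⁻¹ : R) ((Ideal.add_mem_iff_right _ h2).1 hc)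
      rw [← hu, Units.inv_mul_cancel_left] at h3
      exact hx2 h3

variable {k : Type*} [Field k]

/-- Part of a regular system of parameters extends to one that generates the maximal ideal. -/
theorem HasParameters.exists_extension_aux (n : ℕ) : ∀ {R : Type v} [CommRing R]
    [IsLocalRing R] [Algebra k R], HasParameters k R → ∀ s : Finset R, s.card ≤ n →
      Ideal.span (s : Set R) = maximalIdeal R → ∀ ys : List R, IsIndependent ys →
      ∃ zs : List R, IsIndependent (ys ++ zs) ∧
        maximalIdeal R ≤ Ideal.span {z | z ∈ ys ++ zs} := by
  induction n with
  | zero =>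
    intro R _ _ _ h s hs hspan ys hys
    rw [Nat.le_zero, Finset.card_eq_zero] at hs
    subst hs
    rw [Finset.coe_empty, Ideal.span_empty] at hspan
    exact ⟨[], by simpa using hys, by rw [← hspan]; exact bot_le⟩
  | succ n ih =>
    intro R _ _ _ h s hs hspan ys hys
    have := h.noetherian
    have step (x : R) (xs : List R) (hx : IsIndependent (x :: xs)) : ∃ zs : List R,
        IsIndependent (x :: xs ++ zs) ∧ maximalIdeal R ≤ Ideal.span {z | z ∈ x :: xs ++ zs} := by
      have := isLocalRing_quotient (hx.1 x (by simp))
      obtain ⟨hx2, hxs⟩ := isIndependent_cons.1 hx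
      obtain ⟨t, ht, htspan⟩ := exists_span_eq_maximalIdeal_quotient hs hspan hx2
      obtain ⟨zs, hzs, hzspan⟩ := ih (h.quotient hx2) t ht htspan _ hxs
      obtain ⟨zs, rfl⟩ : ∃ zs' : List R, zs = zs'.map (Ideal.Quotient.mk (Ideal.span {x})) :=
        ⟨zs.map (Function.surjInv Ideal.Quotient.mk_surjective), by
          simp [List.map_map, Function.comp_def, Function.surjInv_eq]⟩
      refine ⟨zs, ?_, fun f hf => ?_⟩
      · rw [List.cons_append, isIndependent_cons, List.map_append]
        exact ⟨hx2, hzs⟩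
      · have h1 := hzspan (mk_mem_maximalIdeal_iff.2 hf)
        have h2 : {z | z ∈ xs.map (Ideal.Quotient.mk (Ideal.span {x})) ++
            zs.map (Ideal.Quotient.mk (Ideal.span {x}))} =
            (Ideal.Quotient.mk (Ideal.span {x})) '' {z | z ∈ xs ++ zs} := by
          ext z; simp only [← List.map_append, List.mem_map, Set.mem_ofPred_eq, Set.mem_image]
        rw [h2, ← Ideal.map_span, ← Ideal.mem_comap,
          Ideal.comap_map_of_surjective _ Ideal.Quotient.mk_surjective,
          ← RingHom.ker_eq_comap_bot, Ideal.mk_ker] at h1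
        refine (sup_le (Ideal.span_mono ?_) (Ideal.span_mono ?_) :
          _ ≤ Ideal.span {z | z ∈ x :: xs ++ zs}) h1
        · intro z hz; exact List.mem_cons_of_mem _ hz
        · rintro z rfl; simp
    cases ys with
    | cons x xs => exact step x xs hys
    | nil =>
      by_cases hm : maximalIdeal R = ⊥
      · exact ⟨[], by simpa using hys, by rw [hm]; exact bot_le⟩
      · obtain ⟨x, hx, hx2⟩ := exists_mem_maximalIdeal_not_mem_sq hm
        have := isLocalRing_quotient hx
        obtain ⟨zs, hzs, hz⟩ := step x [] (isIndependent_cons.2 ⟨hx2, isIndependent_nil⟩)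
        exact ⟨x :: zs, hzs, hz⟩

theorem HasParameters.exists_extension [Algebra k R] (h : HasParameters k R) {ys : List R}
    (hys : IsIndependent ys) : ∃ zs : List R, IsIndependent (ys ++ zs) ∧
      maximalIdeal R ≤ Ideal.span {z | z ∈ ys ++ zs} := by
  have := h.noetherian
  obtain ⟨s, hs⟩ := IsNoetherian.noetherian (maximalIdeal R)
  exact HasParameters.exists_extension_aux s.card h s le_rfl hs ys hys

theorem mapElems_map_fst {R S : Type*} [CommRing R] [CommRing S] (e : R →+* S)
    (L : List (R × ℚ)) : (mapElems e L).map Prod.fst = (L.map Prod.fst).map e := by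
  simp [mapElems, Function.comp_def]

/-- Restriction to the hypersurface of the first entry. The weights are nonincreasing, so that entry
has the largest weight, as the Taylor criterion requires. -/
theorem HasParameters.isGradedDomain [CharZero k] (L : List (R × ℚ)) [Algebra k R]
    (h : HasParameters k R) (hL : IsIndependent (L.map Prod.fst))
    (hw : ∀ p ∈ L, ∃ n : ℕ, 0 < n ∧ p.2 = n) (hs : L.Pairwise fun p q => q.2 ≤ p.2) :
    IsGradedDomain L := by
  obtain ⟨n, hn⟩ : ∃ n, L.length = n := ⟨_, rfl⟩
  induction n generalizing R with
  | zero =>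
    rw [List.length_eq_zero_iff] at hn
    subst hn
    have := h.isDomain
    exact isGradedDomain_nil
  | succ n ih =>
    obtain ⟨⟨x, w⟩, L, rfl⟩ := List.exists_cons_of_length_eq_add_one hn
    obtain ⟨m, hm, hwm⟩ := hw (x, w) (by simp)
    dsimp only at hwm
    subst hwm
    rw [List.map_cons] at hL
    have hx := hL.1 x (by simp)
    have := isLocalRing_quotient hx
    obtain ⟨hx2, hL'⟩ := isIndependent_cons.1 hL
    obtain ⟨d, hd⟩ := h.exists_derivation_eq_one hx hx2
    obtain ⟨hs1, hs2⟩ := List.pairwise_cons.1 hs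
    refine IsGradedDomain.cons hd hm hs1 (ih _ (h.quotient hx2) ?_ ?_ ?_ ?_)
    · rwa [mapElems_map_fst]
    · intro p hp
      obtain ⟨p, hp', rfl⟩ := List.mem_map.1 hp
      exact hw p (List.mem_cons_of_mem _ hp')
    · exact List.pairwise_map.2 hs2
    · simpa [mapElems] using hn

theorem exists_common_denominator (l : List ℚ) :
    ∃ c : ℕ, 0 < c ∧ ∀ q ∈ l, ∃ z : ℤ, (c : ℚ) * q = z := by
  induction l with
  | nil => exact ⟨1, one_pos, by simp⟩
  | cons a l ih =>
    obtain ⟨c, hc, h⟩ := ih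
    refine ⟨c * a.den, Nat.mul_pos hc a.pos, fun q hq => ?_⟩
    rcases List.mem_cons.1 hq with rfl | hq
    · refine ⟨c * q.num, ?_⟩
      push_cast
      rw [mul_assoc, mul_comm (q.den : ℚ), Rat.mul_den_eq_num]
    · obtain ⟨z, hz⟩ := h q hq
      refine ⟨z * a.den, ?_⟩
      push_cast
      rw [← hz]; ring

theorem scaleWeights_map_fst {R : Type*} [CommRing R] (c : ℚ) (L : List (R × ℚ)) :
    (scaleWeights c L).map Prod.fst = L.map Prod.fst := by
  simp [scaleWeights, Function.comp_def]

theorem exists_nat_of_pos_of_eq_int {q : ℚ} (hq : 0 < q) {z : ℤ} (h : q = z) :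
    ∃ n : ℕ, 0 < n ∧ q = n := by
  have hz : 0 < z := by rw [h] at hq; exact_mod_cast hq
  obtain ⟨n, rfl⟩ := Int.eq_ofNat_of_zero_le hz.le
  exact ⟨n, by simpa using hz, by simpa using h⟩

/-- The weighted filtration of a partial system of parameters is integrally closed. -/
theorem HasParameters.mem_weightedIdeal_of_pow_mem [CharZero k] [Algebra k R]
    (h : HasParameters k R) {L : List (R × ℚ)} (hL : IsIndependent (L.map Prod.fst))
    (hw : ∀ p ∈ L, 0 < p.2) (hs : L.Pairwise fun p q => q.2 ≤ p.2) {f : R} {N : ℕ} (hN : N ≠ 0)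
    {t : ℚ} (hf : f ^ N ∈ weightedIdeal L (N * t)) : f ∈ weightedIdeal L t := by
  -- Multiplying all weights and t by a common denominator leads to the integral degrees in which
  -- the graded ring is known to be a domain.
  obtain ⟨c, hc, hcz⟩ := exists_common_denominator (t :: L.map Prod.snd)
  have hc' : (0 : ℚ) < c := Nat.cast_pos.2 hc
  obtain ⟨z, hz⟩ := hcz t (by simp)
  rw [← weightedIdeal_scaleWeights hc'] at hf ⊢
  rw [hz]
  refine IsGradedDomain.mem_of_pow_mem (N := N)
    (h.isGradedDomain _ (by rwa [scaleWeights_map_fst]) ?_ ?_) ?_ hN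
  · intro p hp
    obtain ⟨p, hp', rfl⟩ := List.mem_map.1 hp
    obtain ⟨z, hz⟩ := hcz p.2 (List.mem_cons_of_mem _ (List.mem_map_of_mem hp'))
    exact exists_nat_of_pos_of_eq_int (mul_pos hc' (hw p hp')) hz
  · exact List.pairwise_map.2 (hs.imp fun h => mul_le_mul_of_nonneg_left h hc'.le)
  · rwa [← hz, mul_left_comm]

end Independence

/-! ### Existence of maximal contact; the inductive procedure terminates. -/

section MaximalContact

variable {k R : Type*} [Field k] [CommRing R] [IsLocalRing R] [Algebra k R]

/-- Elements of `m ^ a` whose derivatives all lie in `m ^ a` are in `m ^ (a + 1)`. -/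
theorem HasParameters.mem_pow_succ_of_derivation [CharZero k] (h : HasParameters k R) {a : ℕ}
    (ha : a ≠ 0) {f : R} (hf : f ∈ maximalIdeal R ^ a)
    (hd : ∀ d : Derivation k R R, d f ∈ maximalIdeal R ^ a) : f ∈ maximalIdeal R ^ (a + 1) := by
  classical
  have := h.noetherian
  let b := Module.finBasis (ResidueField R) (CotangentSpace R)
  choose d hd' using fun i => h.exists_derivation_dual (b.coord i)
  choose x hx using fun i => (maximalIdeal R).toCotangent_surjective (b i)
  -- The Euler operator Σ x_i ∂_i: it acts on m^a / m^{a+1} as multiplication by a, which is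
  -- invertible in characteristic 0.
  let E : R → R := fun z => ∑ i, x i * d i z
  have hEmul (y z : R) : E (y * z) = y * E z + z * E y := by
    simp only [E, Derivation.leibniz, smul_eq_mul, Finset.mul_sum, ← Finset.sum_add_distrib]
    exact Finset.sum_congr rfl fun i _ => by ring
  have hEadd (y z : R) : E (y + z) = E y + E z := by
    simp only [E, map_add, mul_add, Finset.sum_add_distrib]
  have hE1 (z : R) (hz : z ∈ maximalIdeal R) : E z - z ∈ maximalIdeal R ^ 2 := by
    have h1 : (maximalIdeal R).toCotangent (∑ i, d i z • x i - ⟨z, hz⟩) = 0 := by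
      rw [map_sub, map_sum, sub_eq_zero, ← b.sum_repr ((maximalIdeal R).toCotangent ⟨z, hz⟩)]
      refine Finset.sum_congr rfl fun i _ => ?_
      have h2 := hd' i ⟨z, hz⟩
      rw [Module.Basis.coord_apply] at h2
      rw [← h2, map_smul, hx]
      rfl
    rw [Ideal.toCotangent_eq_zero] at h1
    simpa [E, mul_comm] using h1
  have hE (a : ℕ) : ∀ f ∈ maximalIdeal R ^ a, E f - a * f ∈ maximalIdeal R ^ (a + 1) := by
    induction a with
    | zero =>
      intro f _
      simpa [E] using Ideal.sum_mem _ fun i _ => Ideal.mul_mem_right _ _ (x i).2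
    | succ a ih =>
      intro f hf
      rw [pow_succ] at hf
      refine Submodule.mul_induction_on hf ?_ ?_
      · intro y hy z hz
        have e1 : E (y * z) - ((a + 1 : ℕ) : R) * (y * z) =
            y * (E z - z) + (E y - a * y) * z := by rw [hEmul]; push_cast; ring
        rw [e1]
        refine add_mem ?_ ?_
        · rw [show a + 1 + 1 = a + 2 by ring, pow_add]
          exact Ideal.mul_mem_mul hy (hE1 z hz)
        · rw [pow_succ]
          exact Ideal.mul_mem_mul (ih y hy) hz
      · intro y z hy hz
        have e1 : E (y + z) - ((a + 1 : ℕ) : R) * (y + z) =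
          (E y - ((a + 1 : ℕ) : R) * y) + (E z - ((a + 1 : ℕ) : R) * z) := by rw [hEadd]; ring
        rw [e1]
        exact add_mem hy hz
  have h1 : E f ∈ maximalIdeal R ^ (a + 1) := Ideal.sum_mem _ fun i _ => by
    rw [pow_succ']
    exact Ideal.mul_mem_mul (x i).2 (hd _)
  have h2 := sub_mem h1 (hE a f hf)
  rw [sub_sub_cancel] at h2
  obtain ⟨u, hu⟩ := isUnit_natCast_of_charZero k (R := R) ha
  have h3 := Ideal.mul_mem_left _ (↑u⁻¹ : R) h2
  rwa [← hu, Units.inv_mul_cancel_left] at h3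

theorem HasOrder.le_pow {I : Ideal R} {a : ℕ} (h : HasOrder I a) : I ≤ maximalIdeal R ^ a := h.1

theorem HasOrder.not_le_pow {I : Ideal R} {a : ℕ} (h : HasOrder I a) :
    ¬ I ≤ maximalIdeal R ^ (a + 1) := fun hle => by
  have := h.2 (show a + 1 ∈ {c : ℕ | I ≤ maximalIdeal R ^ c} from hle)
  omega

theorem exists_hasOrder [IsNoetherianRing R] {I : Ideal R} (h0 : I ≠ ⊥) (h1 : I ≠ ⊤) :
    ∃ a, 1 ≤ a ∧ HasOrder I a := by
  classical
  obtain ⟨f, hf, hf0⟩ := Submodule.exists_mem_ne_zero_of_ne_bot h0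
  have hex : ∃ n, ¬ I ≤ maximalIdeal R ^ n := by
    obtain ⟨n, hn⟩ := exists_not_mem_maximalIdeal_pow hf0
    exact ⟨n, fun h => hn (h hf)⟩
  have hspec := Nat.find_spec hex
  have h2 : 2 ≤ Nat.find hex := by
    rw [Nat.le_find_iff]
    intro m hm
    rw [not_not]
    refine (IsLocalRing.le_maximalIdeal h1).trans ?_
    interval_cases m <;> simp
  refine ⟨Nat.find hex - 1, by omega, not_not.1 (Nat.find_min hex (by omega)), fun c hc => ?_⟩
  by_contra hlt
  exact hspec ((show I ≤ _ from hc).trans (Ideal.pow_le_pow_right (by omega)))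

/-- An element of order exactly n ≥ 1 has a derivative of order exactly n - 1. Starting from an
element of I of order a, after a - 1 derivations one obtains an element of order 1. -/
theorem HasParameters.exists_isMaximalContact [CharZero k] (h : HasParameters k R) {I : Ideal R}
    {a : ℕ} (ha : 1 ≤ a) (hI : HasOrder I a) : ∃ x, IsMaximalContact k I a x := by
  have key : ∀ i, i < a → ∃ f ∈ derivIdealIter k i I,
      f ∈ maximalIdeal R ^ (a - i) ∧ f ∉ maximalIdeal R ^ (a - i + 1) := by
    intro i
    induction i with
    | zero =>
      intro _
      obtain ⟨f, hf, hf'⟩ := SetLike.not_le_iff_exists.1 hI.not_le_pow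
      exact ⟨f, hf, hI.le_pow hf, hf'⟩
    | succ i ih =>
      intro hi
      obtain ⟨f, hf, hf1, hf2⟩ := ih (by omega)
      have h3 : ¬ ∀ d : Derivation k R R, d f ∈ maximalIdeal R ^ (a - i) := fun hall =>
        hf2 (h.mem_pow_succ_of_derivation (by omega) hf1 hall)
      push Not at h3
      obtain ⟨d, hd⟩ := h3
      refine ⟨d f, derivation_mem_derivIdealIter d hf, derivation_mem_pow d _ ?_, ?_⟩
      · rwa [show a - (i + 1) + 1 = a - i by omega]
      · rwa [show a - (i + 1) + 1 = a - i by omega]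
  obtain ⟨x, hx, hx1, hx2⟩ := key (a - 1) (by omega)
  rw [show a - (a - 1) = 1 by omega] at hx1 hx2
  exact ⟨x, hx, by simpa using hx1, hx2⟩

/-- This bound serves twice: I[2] is not the unit ideal, so the procedure continues, and the order
of I[2] is at least a!, so the exponents do not decrease. -/
theorem coefficientIdeal_map_ne_top {I : Ideal R} {a : ℕ} (hI : I ≤ maximalIdeal R ^ a) (x : R)
    [IsLocalRing (R ⧸ Ideal.span {x})] :
    (coefficientIdeal k I a).map (Ideal.Quotient.mk (Ideal.span {x})) ≤
      maximalIdeal (R ⧸ Ideal.span {x}) ^ a ! := by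
  rw [← map_maximalIdeal_mk, ← Ideal.map_pow]
  exact Ideal.map_mono (coefficientIdeal_le_pow hI)

/-- The inductive procedure of taking orders, maximal contact elements and restricted coefficient
ideals can be carried out. -/
theorem HasParameters.exists_isAssociated_aux [CharZero k] (n : ℕ) : ∀ {R : Type v} [CommRing R]
    [IsLocalRing R] [Algebra k R], HasParameters k R → ∀ s : Finset R, s.card ≤ n →
      Ideal.span (s : Set R) = maximalIdeal R → ∀ I : Ideal R, I ≠ ⊤ →
      ∃ (bs : List ℕ) (xs : List R), IsAssociated k bs R I xs := by
  induction n with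
  | zero =>
    intro R _ _ _ h s hs hspan I hI
    rw [Nat.le_zero, Finset.card_eq_zero] at hs
    subst hs
    rw [Finset.coe_empty, Ideal.span_empty] at hspan
    exact ⟨[], [], le_bot_iff.1 (hspan ▸ IsLocalRing.le_maximalIdeal hI), rfl⟩
  | succ n ih =>
    intro R _ _ _ h s hs hspan I hI
    have := h.noetherian
    by_cases hI0 : I = ⊥
    · exact ⟨[], [], hI0, rfl⟩
    · obtain ⟨a, ha, hIa⟩ := exists_hasOrder hI0 hI
      obtain ⟨x, hx⟩ := h.exists_isMaximalContact ha hIa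
      have hloc := isLocalRing_quotient hx.2.1
      obtain ⟨t, ht, htspan⟩ := exists_span_eq_maximalIdeal_quotient hs hspan hx.2.2
      obtain ⟨bs, xs, hbs⟩ := ih (h.quotient hx.2.2) t ht htspan
        ((coefficientIdeal k I a).map (Ideal.Quotient.mk (Ideal.span {x}))) (by
          intro htop
          have := coefficientIdeal_map_ne_top (k := k) hIa.le_pow x
          rw [htop] at this
          exact (maximalIdeal.isMaximal (R ⧸ Ideal.span {x})).ne_top
            (top_le_iff.1 (this.trans (Ideal.pow_le_self (Nat.factorial_ne_zero a)))))
      refine ⟨a :: bs, x :: xs.map (Function.surjInv Ideal.Quotient.mk_surjective), ha, hIa, x, _,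
        rfl, hx, hloc, ?_⟩
      simpa [List.map_map, Function.comp_def, Function.surjInv_eq] using hbs

theorem HasParameters.exists_isAssociated {k : Type u} {R : Type v} [Field k] [CommRing R]
    [IsLocalRing R] [Algebra k R] [CharZero k] (h : HasParameters k R) {I : Ideal R}
    (hI : I ≠ ⊤) : ∃ (bs : List ℕ) (xs : List R), IsAssociated k bs R I xs := by
  have := h.noetherian
  obtain ⟨s, hs⟩ := IsNoetherian.noetherian (maximalIdeal R)
  exact HasParameters.exists_isAssociated_aux s.card h s le_rfl hs I hI

end MaximalContact

end WeightedCenters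

namespace WeightedCenters

open IsLocalRing

/-! ### Bookkeeping for exponents and weights. -/

section Centers

variable {R : Type*}

/-- The weights `1 / a_i` of a center `(x_1^{a_1}, …, x_k^{a_k})`, given as a list of pairs. -/
def centerWeights (M : List (R × ℚ)) : List (R × ℚ) := M.map fun p => (p.1, p.2⁻¹)

theorem mem_centerWeights {M : List (R × ℚ)} {p : R × ℚ} (hp : p ∈ M) :
    (p.1, p.2⁻¹) ∈ centerWeights M := List.mem_map.2 ⟨p, hp, rfl⟩

theorem mem_weightedIdeal_centerWeights [CommRing R] {M : List (R × ℚ)} {p : R × ℚ} (hp : p ∈ M) :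
    p.1 ∈ weightedIdeal (centerWeights M) p.2⁻¹ := mem_weightedIdeal (mem_centerWeights hp)

theorem forall_mem_centerWeights {M : List (R × ℚ)} {P : R × ℚ → Prop} :
    (∀ p ∈ centerWeights M, P p) ↔ ∀ p ∈ M, P (p.1, p.2⁻¹) := by
  simp only [centerWeights, List.mem_map]
  exact ⟨fun h p hp => h _ ⟨p, hp, rfl⟩, by rintro h _ ⟨p, hp, rfl⟩; exact h p hp⟩

theorem mapElems_centerWeights [CommRing R] {S : Type*} [CommRing S] (e : R →+* S) (M : List (R × ℚ)) :
    mapElems e (centerWeights M) = centerWeights (mapElems e M) := by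
  simp [mapElems, centerWeights]

theorem mapElems_zip [CommRing R] {S : Type*} [CommRing S] (e : R →+* S) (xs : List R) (as : List ℚ) :
    mapElems e (xs.zip as) = (xs.map e).zip as := by
  rw [List.zip_map_left]
  rfl

theorem centerWeights_zip_map_div (xs : List R) (as : List ℚ) (D : ℚ) :
    centerWeights (xs.zip (as.map fun q => q / D)) =
      scaleWeights D (centerWeights (xs.zip as)) := by
  rw [List.zip_map_right]
  simp [centerWeights, scaleWeights, div_eq_mul_inv]

theorem mapElems_centerWeights_zip_map_div [CommRing R] {S : Type*} [CommRing S] (e : R →+* S) (xs : List R)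
    (as : List ℚ) (D : ℚ) :
    mapElems e (centerWeights (xs.zip (as.map fun q => q / D))) =
      scaleWeights D (centerWeights ((xs.map e).zip as)) := by
  rw [mapElems_centerWeights, mapElems_zip, centerWeights_zip_map_div]

theorem factorial_pred_mul {b : ℕ} (hb : 1 ≤ b) : ((b - 1)! : ℚ) * b = b ! := by
  rw [mul_comm]
  exact_mod_cast Nat.mul_factorial_pred (by omega)

end Centers

/-! ### The associated center is a center, and I has degree one in its filtration. -/

section Admissible

theorem IsAssociated.le_of_mem_exponents {k : Type u} [CommRing k] {R : Type v} [CommRing R]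
    [IsLocalRing R] [Algebra k R] {bs : List ℕ} {I : Ideal R} {xs : List R}
    (h : IsAssociated k bs R I xs) (hs : (exponents bs).Pairwise (· ≤ ·)) {c : ℕ}
    (hI : I ≤ maximalIdeal R ^ c) : ∀ a ∈ exponents bs, (c : ℚ) ≤ a := by
  cases bs with
  | nil => simp [exponents]
  | cons b bs =>
    have hb : c ≤ b := h.2.1.2 hI
    have hb' : (c : ℚ) ≤ b := Nat.cast_le.2 hb
    rw [exponents] at hs ⊢
    intro a ha
    rcases List.mem_cons.1 ha with rfl | ha
    · exact hb'
    · exact hb'.trans ((List.pairwise_cons.1 hs).1 a ha)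

/-- A center associated to `I` is a center, and `I` lies in the degree one part of its weighted
filtration. -/
theorem IsAssociated.isCenter_and_le {k : Type u} [Field k] [CharZero k] (bs : List ℕ) :
    ∀ {R : Type v} [CommRing R] [IsLocalRing R] [Algebra k R], HasParameters k R →
      ∀ {I : Ideal R} {xs : List R}, IsAssociated k bs R I xs →
      IsIndependent xs ∧ xs.length = (exponents bs).length ∧ (∀ a ∈ exponents bs, 0 < a) ∧
        (exponents bs).Pairwise (· ≤ ·) ∧
        I ≤ weightedIdeal (centerWeights (xs.zip (exponents bs))) 1 := by
  induction bs with
  | nil =>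
    rintro R _ _ _ - I xs ⟨rfl, rfl⟩
    simp [exponents, isIndependent_nil]
  | cons b bs ih =>
    rintro R _ _ _ hR I _ ⟨hb, hI, x, ys, rfl, ⟨-, hx, hx2⟩, hloc, hass⟩
    obtain ⟨hind, hlen, hpos, hsort, hle⟩ := ih (hR.quotient hx2) hass
    set q := Ideal.Quotient.mk (Ideal.span {x})
    set D : ℚ := ((b - 1)! : ℚ) with hD
    have hD0 : 0 < D := by rw [hD]; exact_mod_cast Nat.factorial_pos _
    have hb0 : (0 : ℚ) < b := by exact_mod_cast hb
    -- The exponents found for I[2] are at least b!, and b!/(b-1)! = b.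
    have hlow : ∀ a ∈ exponents bs, (b : ℚ) ≤ a / D := by
      intro a ha
      have := hass.le_of_mem_exponents hsort (coefficientIdeal_map_ne_top hI.le_pow x) a ha
      rw [le_div_iff₀ hD0, mul_comm, hD, factorial_pred_mul hb]
      exact this
    refine ⟨isIndependent_cons.2 ⟨hx2, hind⟩, ?_, ?_, ?_, ?_⟩
    · simp only [exponents, List.length_cons, List.length_map] at hlen ⊢
      omega
    · intro a ha
      rcases List.mem_cons.1 ha with rfl | ha
      · exact hb0
      · obtain ⟨a, ha', rfl⟩ := List.mem_map.1 ha
        exact div_pos (hpos a ha') hD0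
    · refine List.pairwise_cons.2 ⟨?_, List.pairwise_map.2
        (hsort.imp fun h => div_le_div_of_nonneg_right h hD0.le)⟩
      intro a ha
      obtain ⟨a, ha', rfl⟩ := List.mem_map.1 ha
      exact hlow a ha'
    · obtain ⟨d, hd⟩ := hR.exists_derivation_eq_one hx hx2
      intro f hf
      rw [exponents, List.zip_cons_cons]
      refine mem_weightedIdeal_of_iterate hd (inv_pos.2 hb0) (forall_mem_centerWeights.2 ?_) ?_
      · intro p hp
        obtain ⟨a, ha, h⟩ := List.mem_map.1 (List.of_mem_zip hp).2
        dsimp only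
        rw [← h]
        exact inv_anti₀ hb0 (hlow a ha)
      · intro i
        rcases le_or_gt b i with hi | hi
        · refine (isFiltration_weightedIdeal _).mem_of_nonpos ?_ _
          rw [sub_nonpos, ← div_eq_mul_inv, le_div_iff₀ hb0, one_mul]
          exact_mod_cast hi
        · change q (d^[i] f) ∈
            weightedIdeal (mapElems q (centerWeights (ys.zip ((exponents bs).map fun q => q / D)))) _
          rw [mapElems_centerWeights_zip_map_div]
          set L := centerWeights ((ys.map q).zip (exponents bs)) with hL
          -- This power lies in the restricted coefficient ideal. After rescaling by D = (b-1)! it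
          -- has degree D, and its root has degree D(b-i)/b! = 1 - i/b, the degree that the Taylor
          -- criterion requires of the i-th derivative.
          have h1 : q (d^[i] f) ^ (b ! / (b - i)) ∈ weightedIdeal L 1 := by
            refine hle ?_
            rw [← map_pow]
            exact Ideal.mem_map_of_mem _ (pow_mem_coefficientIdeal hi
              (iterate_derivation_mem_derivIdealIter d i hf))
          have hdvd : b - i ∣ b ! := Nat.dvd_factorial (by omega) (by omega)
          have hN : b ! / (b - i) ≠ 0 :=
            (Nat.div_pos (Nat.le_of_dvd (Nat.factorial_pos _) hdvd) (by omega)).ne'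
          have hbi : ((b - i : ℕ) : ℚ) ≠ 0 := by
            rw [Nat.cast_ne_zero]; omega
          rw [← weightedIdeal_scaleWeights hD0] at h1
          refine (hR.quotient hx2).mem_weightedIdeal_of_pow_mem ?_ ?_ ?_ hN
            ((isFiltration_weightedIdeal _).mem_of_le (le_of_eq ?_) h1)
          · rw [scaleWeights_map_fst, hL]
            have : (centerWeights ((ys.map q).zip (exponents bs))).map Prod.fst = ys.map q := by
              rw [centerWeights, List.map_map]
              change ((ys.map q).zip (exponents bs)).map Prod.fst = _
              exact List.map_fst_zip hlen.le
            rwa [this]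
          · simp only [scaleWeights, hL, centerWeights, List.map_map, List.mem_map]
            rintro _ ⟨p, hp, rfl⟩
            exact mul_pos hD0 (inv_pos.2 (hpos _ (List.of_mem_zip hp).2))
          · simp only [scaleWeights, hL, centerWeights, List.map_map, List.pairwise_map]
            have h2 : (((ys.map q).zip (exponents bs)).map Prod.snd).Pairwise (· ≤ ·) := by
              rwa [List.map_snd_zip hlen.ge]
            refine (List.pairwise_map.1 h2).imp_of_mem ?_
            intro p r hp _ hpr
            exact mul_le_mul_of_nonneg_left
              (inv_anti₀ (hpos _ (List.of_mem_zip hp).2) hpr) hD0.le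
          · rw [Nat.cast_div hdvd hbi, ← factorial_pred_mul hb, ← hD, Nat.cast_sub hi.le] at *
            field_simp

end Admissible

/-! ### Maximality of the invariant and uniqueness of the center. -/

section Maximality

theorem invLE_map_div {D : ℚ} (hD : 0 < D) : ∀ {l m : List ℚ},
    InvLE (l.map fun q => q * D) m → InvLE l (m.map fun q => q / D)
  | _, [], _ => by simp [InvLE]
  | [], _ :: _, h => by simp [InvLE] at h
  | a :: l, b :: m, h => by
    simp only [List.map_cons, InvLE] at h ⊢
    rcases h with h | ⟨h, h'⟩
    · exact Or.inl (by rwa [lt_div_iff₀ hD])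
    · exact Or.inr ⟨by rw [eq_div_iff hD.ne', h], invLE_map_div hD h'⟩

theorem invLE_antisymm : ∀ {l m : List ℚ}, InvLE l m → InvLE m l → l = m
  | [], [], _, _ => rfl
  | [], _ :: _, h, _ => by simp [InvLE] at h
  | _ :: _, [], _, h => by simp [InvLE] at h
  | a :: l, b :: m, h, h' => by
    simp only [InvLE] at h h'
    rcases h with h | ⟨rfl, h⟩
    · rcases h' with h' | ⟨rfl, -⟩
      · exact absurd h h'.asymm
      · exact absurd h (lt_irrefl _)
    · rcases h' with h' | ⟨-, h'⟩
      · exact absurd h' (lt_irrefl _)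
      · rw [invLE_antisymm h h']

variable {R : Type*} [CommRing R]

/-- The filtration which has `N` in degrees between `0` and `β` and `N ^ 2` from `β` on. -/
theorem isFiltration_sq (N : Ideal R) (β : ℚ) : IsFiltration fun t : ℚ =>
    if t ≤ 0 then ⊤ else if t < β then N else N ^ 2 := by
  have hle (t : ℚ) (ht : 0 < t) : (if t ≤ 0 then ⊤ else if t < β then N else N ^ 2) ≤ N := by
    rw [if_neg (not_le.2 ht)]
    split_ifs
    · exact le_rfl
    · exact Ideal.pow_le_self two_ne_zero
  have hanti : Antitone fun t : ℚ => if t ≤ 0 then ⊤ else if t < β then N else N ^ 2 := by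
    intro s t h
    dsimp only
    by_cases hs : s ≤ 0
    · simp [hs]
    · rw [if_neg hs, if_neg (fun ht => hs (h.trans ht))]
      split_ifs with h1 h2 h2
      · exact le_rfl
      · exact absurd (h.trans_lt h1) h2
      · exact Ideal.pow_le_self two_ne_zero
      · exact le_rfl
  refine ⟨hanti, fun t ht => by simp [ht], fun s t => ?_⟩
  rcases le_or_gt s 0 with hs | hs
  · exact Ideal.mul_le_right.trans (hanti (by linarith))
  rcases le_or_gt t 0 with ht | ht
  · exact Ideal.mul_le_left.trans (hanti (by linarith))
  refine (Ideal.mul_mono (hle s hs) (hle t ht)).trans ?_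
  rw [← pow_two, if_neg (not_le.2 (add_pos hs ht))]
  split_ifs
  · exact Ideal.pow_le_self two_ne_zero
  · exact le_rfl

/-- A parameter of weight `1 / b` in the weighted filtration can replace one of the parameters
of that weight. -/
theorem exists_exchange [IsLocalRing R] {b : ℚ} (hb : 0 < b) (M : List (R × ℚ)) :
    (∀ p ∈ M, p.1 ∈ maximalIdeal R) → (∀ p ∈ M, b ≤ p.2) → (M.map Prod.snd).Pairwise (· ≤ ·) →
    ∀ {x : R}, x ∈ weightedIdeal (centerWeights M) b⁻¹ → x ∉ maximalIdeal R ^ 2 →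
    ∃ M' : List (R × ℚ), M' ⊆ M ∧ M.map Prod.snd = b :: M'.map Prod.snd ∧
      ∀ p ∈ M, p.1 ∈ weightedIdeal (centerWeights ((x, b) :: M')) p.2⁻¹ := by
  induction M with
  | nil =>
    intro _ _ _ x hx hx2
    rw [centerWeights, List.map_nil, weightedIdeal_nil (inv_pos.2 hb), Ideal.mem_bot] at hx
    exact absurd (hx ▸ zero_mem _) hx2
  | cons p M ih =>
    obtain ⟨y, c⟩ := p
    intro hm hc hs x hx hx2
    rw [List.map_cons, List.pairwise_cons] at hs
    have hbc : b ≤ c := hc (y, c) (by simp)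
    rcases hbc.lt_or_eq with hlt | rfl
    · exfalso
      -- If all exponents exceed b, all weights are below 1/b, so an element of degree 1/b involves
      -- only products of at least two parameters and lies in m².
      have hle := weightedIdeal_le (isFiltration_sq (maximalIdeal R) b⁻¹)
        (L := centerWeights ((y, c) :: M)) (forall_mem_centerWeights.2 fun p hp => ?_) _ hx
      · simp only [lt_irrefl, if_false, if_neg (not_le.2 (inv_pos.2 hb))] at hle
        exact hx2 hle
      · have hbp : b < p.2 := by
          rcases List.mem_cons.1 hp with rfl | hp
          · exact hlt
          · exact hlt.trans_le (hs.1 _ (List.mem_map_of_mem hp))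
        dsimp only
        rw [if_neg (not_le.2 (inv_pos.2 (hb.trans hbp))), if_pos (inv_strictAnti₀ hb hbp)]
        exact hm p hp
    -- Write the new parameter as r + wy. If w is a unit, it replaces y. Otherwise wy is in m², so r
    -- is still outside m²; the exchange is made for r among the remaining parameters, and y is
    -- kept.
    · obtain ⟨r, hr, z, hz, rfl⟩ := Submodule.mem_sup.1 (weightedIdeal_cons_le (y, b⁻¹) _ _ hx)
      obtain ⟨w, rfl⟩ := Ideal.mem_span_singleton'.1 hz
      dsimp only at *
      by_cases hu : IsUnit w
      · obtain ⟨w, rfl⟩ := hu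
        refine ⟨M, List.subset_cons_self _ _, by simp, fun p hp => ?_⟩
        rcases List.mem_cons.1 hp with rfl | hp
        · have h1 : y = ↑w⁻¹ * ((r + ↑w * y) - r) := by simp
          dsimp only
          have h2 : r + ↑w * y ∈ weightedIdeal (centerWeights ((r + ↑w * y, b) :: M)) b⁻¹ :=
            mem_weightedIdeal_centerWeights (p := (r + ↑w * y, b)) (by simp)
          have h3 := weightedIdeal_mono_of_subset (L' := centerWeights ((r + ↑w * y, b) :: M))
            (List.subset_cons_self _ _) _ hr
          have h4 := Ideal.mul_mem_left _ (↑w⁻¹ : R) (sub_mem h2 h3)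
          rwa [← h1] at h4
        · exact mem_weightedIdeal_centerWeights (List.mem_cons_of_mem _ hp)
      · have hw : w ∈ maximalIdeal R := hu
        have hy : y ∈ maximalIdeal R := hm (y, b) (by simp)
        have hwy : w * y ∈ maximalIdeal R ^ 2 := by
          rw [pow_two]; exact Ideal.mul_mem_mul hw hy
        obtain ⟨M', hsub, hmap, hM'⟩ := ih (fun p hp => hm p (List.mem_cons_of_mem _ hp))
          (fun p hp => hc p (List.mem_cons_of_mem _ hp)) hs.2 hr
          (fun hr2 => hx2 (add_mem hr2 hwy))
        refine ⟨(y, b) :: M', List.cons_subset_cons _ hsub, ?_, fun p hp => ?_⟩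
        · rw [List.map_cons, List.map_cons, hmap]
        · rcases List.mem_cons.1 hp with rfl | hp
          · exact mem_weightedIdeal_centerWeights (p := (y, b)) (by simp)
          · refine weightedIdeal_mono (forall_mem_centerWeights.2 fun p hp => ?_) _ (hM' p hp)
            dsimp only
            rcases List.mem_cons.1 hp with rfl | hp
            · have h1 := mem_weightedIdeal_centerWeights
                (M := (r + w * y, b) :: (y, b) :: M') (p := (r + w * y, b)) (by simp)
              have h2 := mem_weightedIdeal_centerWeights
                (M := (r + w * y, b) :: (y, b) :: M') (p := (y, b)) (by simp)
              have h3 := sub_mem h1 (Ideal.mul_mem_left _ w h2)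
              rwa [add_sub_cancel_right] at h3
            · exact mem_weightedIdeal_centerWeights
                (List.mem_cons_of_mem _ (List.mem_cons_of_mem _ hp))

theorem weightedIdeal_eq_of_exchange {b : ℚ} {M M' : List (R × ℚ)} {x : R}
    (hx : x ∈ weightedIdeal (centerWeights M) b⁻¹) (hsub : M' ⊆ M)
    (hM : ∀ p ∈ M, p.1 ∈ weightedIdeal (centerWeights ((x, b) :: M')) p.2⁻¹) (t : ℚ) :
    weightedIdeal (centerWeights M) t = weightedIdeal (centerWeights ((x, b) :: M')) t := by
  refine le_antisymm (weightedIdeal_mono (forall_mem_centerWeights.2 hM) t)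
    (weightedIdeal_mono (forall_mem_centerWeights.2 fun p hp => ?_) t)
  rcases List.mem_cons.1 hp with rfl | hp
  · exact hx
  · exact mem_weightedIdeal_centerWeights (hsub hp)

/-- A lift from V(x) is determined up to a multiple of x. As x has the largest weight 1/b, this
ambiguity does not affect the degrees; for the same reason the lifts of the parameters are
arbitrary. -/
theorem weightedIdeal_le_of_restrict_le {b : ℚ} (hb : 0 < b) {x : R} {M N : List (R × ℚ)}
    (hM : ∀ p ∈ M, b ≤ p.2)
    (h : ∀ t, weightedIdeal (mapElems (Ideal.Quotient.mk (Ideal.span {x})) (centerWeights M)) t ≤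
      weightedIdeal (mapElems (Ideal.Quotient.mk (Ideal.span {x})) (centerWeights N)) t) (t : ℚ) :
    weightedIdeal (centerWeights ((x, b) :: M)) t ≤
      weightedIdeal (centerWeights ((x, b) :: N)) t := by
  refine weightedIdeal_mono (forall_mem_centerWeights.2 fun p hp => ?_) t
  have hx : x ∈ weightedIdeal (centerWeights ((x, b) :: N)) b⁻¹ :=
    mem_weightedIdeal_centerWeights (p := (x, b)) (by simp)
  rcases List.mem_cons.1 hp with rfl | hp
  · exact hx
  · have h1 : Ideal.Quotient.mk (Ideal.span {x}) p.1 ∈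
        weightedIdeal (mapElems (Ideal.Quotient.mk (Ideal.span {x})) (centerWeights M)) p.2⁻¹ :=
      mem_weightedIdeal (p := (Ideal.Quotient.mk (Ideal.span {x}) p.1, p.2⁻¹))
        (List.mem_map.2 ⟨_, mem_centerWeights hp, rfl⟩)
    obtain ⟨g, hg, r, hr⟩ := exists_of_mk_mem_weightedIdeal b⁻¹ (h _ h1)
    dsimp only
    rw [hr]
    exact add_mem hg (Ideal.mul_mem_right _ _
      ((isFiltration_weightedIdeal _).mem_of_le (inv_anti₀ hb (hM p hp)) hx))

/-- The invariant of an associated center is the largest one among all admissible centers, and an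
admissible center with the same invariant has the same weighted filtration. -/
theorem IsAssociated.invLE_and_eq {k : Type u} [CommRing k] (bs : List ℕ) :
    ∀ {R : Type v} [CommRing R] [IsLocalRing R] [Algebra k R]
      {I : Ideal R} {xs : List R}, IsAssociated k bs R I xs →
      ∀ M : List (R × ℚ), (∀ p ∈ M, p.1 ∈ maximalIdeal R) → (∀ p ∈ M, 0 < p.2) →
      (M.map Prod.snd).Pairwise (· ≤ ·) → I ≤ weightedIdeal (centerWeights M) 1 →
      InvLE (M.map Prod.snd) (exponents bs) ∧ (M.map Prod.snd = exponents bs →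
        ∀ t, weightedIdeal (centerWeights M) t =
          weightedIdeal (centerWeights (xs.zip (exponents bs))) t) := by
  induction bs with
  | nil =>
    rintro R _ _ _ I xs ⟨rfl, rfl⟩ M - - - -
    refine ⟨by simp [InvLE, exponents], fun h => ?_⟩
    rw [exponents, List.map_eq_nil_iff] at h
    subst h
    simp
  | cons b bs ih =>
    rintro R _ _ _ I _ ⟨hb1, hI, x, ys, rfl, ⟨hxD, hx, hx2⟩, hloc, hass⟩ M hm hpos hs hle
    set q := Ideal.Quotient.mk (Ideal.span {x})
    set D : ℚ := ((b - 1)! : ℚ) with hD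
    have hD0 : 0 < D := by rw [hD]; exact_mod_cast Nat.factorial_pos _
    have hb0 : (0 : ℚ) < b := by exact_mod_cast hb1
    cases M with
    | nil =>
      rw [centerWeights, List.map_nil, weightedIdeal_nil one_pos, le_bot_iff] at hle
      subst hle
      exact absurd bot_le hI.not_le_pow
    | cons p1 M1 =>
      obtain ⟨y1, c1⟩ := p1
      have hc1 : 0 < c1 := hpos (y1, c1) (by simp)
      have hc1' : ∀ p ∈ (y1, c1) :: M1, c1 ≤ p.2 := by
        rw [List.map_cons, List.pairwise_cons] at hs
        intro p hp
        rcases List.mem_cons.1 hp with rfl | hp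
        · exact le_rfl
        · exact hs.1 _ (List.mem_map_of_mem hp)
      -- All weights are at most 1/c1, so an ideal of degree 1 lies in m^⌈c1⌉; compare with the
      -- order b.
      have hc1b : c1 ≤ b := by
        have h1 := weightedIdeal_le_pow (N := maximalIdeal R) hc1
          (L := centerWeights ((y1, c1) :: M1)) (forall_mem_centerWeights.2 fun p hp =>
            ⟨hm p hp, by
              dsimp only
              rw [← div_eq_mul_inv, div_le_one (hpos p hp)]
              exact hc1' p hp⟩) 1
        rw [mul_one] at h1
        have h2 : ⌈c1⌉₊ ≤ b := hI.2 (hle.trans h1)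
        exact (Nat.le_ceil c1).trans (Nat.cast_le.2 h2)
      rcases hc1b.lt_or_eq with hlt | hcb
      · refine ⟨Or.inl hlt, fun h => ?_⟩
        rw [List.map_cons, exponents, List.cons.injEq] at h
        exact absurd h.1 hlt.ne
      · subst hcb
        generalize hMdef : (y1, (b : ℚ)) :: M1 = M at *
        have hJ := isFiltration_weightedIdeal (centerWeights M)
        have hder : DerivationsLower k (weightedIdeal (centerWeights M)) (b : ℚ)⁻¹ :=
          derivationsLower_weightedIdeal (inv_nonneg.2 hb0.le)
            (forall_mem_centerWeights.2 fun p hp => inv_anti₀ hb0 (hc1' p hp))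
        -- The maximal contact element arises from I by at most b - 1 derivations, each costing at
        -- most 1/b: its degree is at least 1 - (b-1)/b.
        have hxJ : x ∈ weightedIdeal (centerWeights M) (b : ℚ)⁻¹ := by
          have := hder.derivIdealIter_le hJ (inv_nonneg.2 hb0.le) hle (b - 1) hxD
          refine hJ.mem_of_le (le_of_eq ?_) this
          rw [Nat.cast_sub hb1]
          field_simp
          simp
        obtain ⟨M', hsub, hmap, hM'⟩ := exists_exchange hb0 M hm hc1' hs hxJ hx2
        have hJeq := weightedIdeal_eq_of_exchange hxJ hsub hM'
        rw [hmap] at hs ⊢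
        have hsM' := List.pairwise_cons.1 hs
        -- The piece G_{b!} has degree b!/b = (b-1)! = D.
        have hcoef : coefficientIdeal k I b ≤ weightedIdeal (centerWeights ((x, (b : ℚ)) :: M')) D := by
          rw [← hJeq]
          have := hder.gradedPiece_le hJ (inv_nonneg.2 hb0.le) (I := I) (a := b)
            (by rwa [mul_inv_cancel₀ hb0.ne']) b !
          refine this.trans (le_of_eq ?_)
          rw [← factorial_pred_mul hb1, ← hD, mul_inv_cancel_right₀ hb0.ne']
        -- Multiplying the exponents by D divides the weights by D, so that I[2] has degree 1 and
        -- the induction hypothesis applies.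
        let Mq : List ((R ⧸ Ideal.span {x}) × ℚ) := M'.map fun p => (q p.1, p.2 * D)
        have hMq : scaleWeights D (centerWeights Mq) = mapElems q (centerWeights M') := by
          simp only [scaleWeights, centerWeights, mapElems, Mq, List.map_map]
          refine List.map_congr_left fun p _ => ?_
          simp only [Function.comp_apply, mul_inv]
          rw [mul_left_comm, mul_inv_cancel₀ hD0.ne', mul_one]
        have hMqsnd : Mq.map Prod.snd = (M'.map Prod.snd).map fun q => q * D := by
          simp [Mq, Function.comp_def]
        have hmapI : (coefficientIdeal k I b).map q ≤ weightedIdeal (centerWeights Mq) 1 := by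
          rw [← weightedIdeal_scaleWeights hD0, hMq, mul_one, Ideal.map_le_iff_le_comap]
          intro f hf
          exact mk_mem_weightedIdeal_of_cons (hcoef hf)
        obtain ⟨hinv, heq⟩ := ih hass Mq
          (by
            intro p hp
            obtain ⟨p, hp', rfl⟩ := List.mem_map.1 hp
            exact mk_mem_maximalIdeal_iff.2 (hm p (hsub hp')))
          (by
            intro p hp
            obtain ⟨p, hp', rfl⟩ := List.mem_map.1 hp
            exact mul_pos (hpos p (hsub hp')) hD0)
          (by
            rw [hMqsnd, List.pairwise_map]
            exact hsM'.2.imp fun h => mul_le_mul_of_nonneg_right h hD0.le)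
          hmapI
        refine ⟨Or.inr ⟨rfl, invLE_map_div hD0 (hMqsnd ▸ hinv)⟩, fun h t => ?_⟩
        rw [exponents, List.cons.injEq] at h
        have h2 : Mq.map Prod.snd = exponents bs := by
          rw [hMqsnd, h.2, List.map_map]
          conv_rhs => rw [← List.map_id (exponents bs)]
          refine List.map_congr_left fun a _ => ?_
          simp [hD0.ne', ← hD]
        have hrestr (t : ℚ) : weightedIdeal (mapElems q (centerWeights M')) t =
            weightedIdeal (mapElems q (centerWeights
              (ys.zip ((exponents bs).map fun q => q / D)))) t := by
          rw [mapElems_centerWeights_zip_map_div, ← hMq]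
          have e1 : t = D * (D⁻¹ * t) := by rw [mul_inv_cancel_left₀ hD0.ne']
          rw [e1, weightedIdeal_scaleWeights hD0, weightedIdeal_scaleWeights hD0, heq h2]
        rw [hJeq, exponents, List.zip_cons_cons]
        refine le_antisymm (weightedIdeal_le_of_restrict_le hb0 ?_ (fun t => (hrestr t).le) t)
          (weightedIdeal_le_of_restrict_le hb0 ?_ (fun t => (hrestr t).ge) t)
        · intro p hp
          exact hsM'.1 _ (List.mem_map_of_mem hp)
        · intro p hp
          refine hsM'.1 _ ?_
          rw [h.2]
          exact (List.of_mem_zip hp).2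

end Maximality

end WeightedCenters

namespace WeightedCenters

open IsLocalRing

/-! ### Arithmetic of the rational multiples of a valuation. -/

section ScaledVal

variable {K : Type u} [Field K] (V : ValuationSubring K)

/-- The additive valuation of a nonzero element. -/
noncomputable def unitVal {f : K} (hf : f ≠ 0) : DivisibleHull (AddValueGroup V) :=
  DivisibleHull.coe (Additive.ofMul
    (Units.mk0 (V.valuation f) ((Valuation.ne_zero_iff V.valuation).mpr hf))⁻¹)

theorem scaledVal_zero (q : ℚ) : scaledVal V q 0 = ⊤ := dif_pos rfl

theorem scaledVal_of_ne_zero (q : ℚ) {f : K} (hf : f ≠ 0) :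
    scaledVal V q f = ((q • unitVal V hf : DivisibleHull (AddValueGroup V)) : QValues V) :=
  dif_neg hf

theorem unitVal_le_iff {f g : K} (hf : f ≠ 0) (hg : g ≠ 0) :
    unitVal V hf ≤ unitVal V hg ↔ V.valuation g ≤ V.valuation f := by
  rw [unitVal, unitVal, DivisibleHull.mk_le_mk]
  simp only [PNat.val_ofNat, one_smul]
  rw [Additive.ofMul_le, inv_le_inv_iff, ← Units.val_le_val]
  rfl

theorem unitVal_mul {f g : K} (hf : f ≠ 0) (hg : g ≠ 0) :
    unitVal V (mul_ne_zero hf hg) = unitVal V hf + unitVal V hg := by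
  rw [unitVal, unitVal, unitVal, ← DivisibleHull.coe_add, ← ofMul_mul, ← mul_inv]
  congr 4
  ext
  simp

theorem unitVal_pow {f : K} (hf : f ≠ 0) (n : ℕ) :
    unitVal V (pow_ne_zero n hf) = (n : ℚ) • unitVal V hf := by
  induction n with
  | zero =>
    have h := unitVal_mul V (pow_ne_zero 0 hf) (pow_ne_zero 0 hf)
    have h2 : unitVal V (mul_ne_zero (pow_ne_zero 0 hf) (pow_ne_zero 0 hf)) =
      unitVal V (pow_ne_zero 0 hf) := by simp [unitVal]
    rw [h2] at h
    simpa using h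
  | succ n ih =>
    have h := unitVal_mul V (pow_ne_zero n hf) hf
    have h2 : unitVal V (mul_ne_zero (pow_ne_zero n hf) hf) =
      unitVal V (pow_ne_zero (n + 1) hf) := by simp [unitVal, pow_succ]
    rw [← h2, h, ih, Nat.cast_succ, add_smul, one_smul]

theorem zero_le_unitVal {f : K} (hf : f ≠ 0) (h : f ∈ V) : 0 ≤ unitVal V hf := by
  have h1 := unitVal_pow V hf 0
  rw [Nat.cast_zero, zero_smul] at h1
  rw [← h1, unitVal_le_iff]
  simpa using (V.valuation_le_one_iff f).2 h

variable {V}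

theorem coe_le_scaledVal_mul {a b : DivisibleHull (AddValueGroup V)} {f g : K}
    (hf : (a : QValues V) ≤ scaledVal V 1 f) (hg : (b : QValues V) ≤ scaledVal V 1 g) :
    ((a + b : DivisibleHull (AddValueGroup V)) : QValues V) ≤ scaledVal V 1 (f * g) := by
  by_cases hf0 : f = 0
  · rw [hf0, zero_mul, scaledVal_zero]; exact le_top
  by_cases hg0 : g = 0
  · rw [hg0, mul_zero, scaledVal_zero]; exact le_top
  rw [scaledVal_of_ne_zero V 1 hf0, WithTop.coe_le_coe, one_smul] at hf
  rw [scaledVal_of_ne_zero V 1 hg0, WithTop.coe_le_coe, one_smul] at hg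
  rw [scaledVal_of_ne_zero V 1 (mul_ne_zero hf0 hg0), WithTop.coe_le_coe, one_smul, unitVal_mul V hf0 hg0]
  exact add_le_add hf hg

theorem scaledVal_one_le_iff {f g : K} :
    scaledVal V 1 f ≤ scaledVal V 1 g ↔ V.valuation g ≤ V.valuation f := by
  by_cases hg0 : g = 0
  · simp [hg0, scaledVal_zero]
  by_cases hf0 : f = 0
  · simp [hf0, scaledVal_zero, hg0, scaledVal_of_ne_zero V 1 hg0]
  rw [scaledVal_of_ne_zero V 1 hf0, scaledVal_of_ne_zero V 1 hg0, WithTop.coe_le_coe, one_smul,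
    one_smul, unitVal_le_iff]

theorem le_scaledVal_add {a : QValues V} {f g : K} (hf : a ≤ scaledVal V 1 f)
    (hg : a ≤ scaledVal V 1 g) : a ≤ scaledVal V 1 (f + g) := by
  rcases le_total (V.valuation f) (V.valuation g) with h | h
  · exact hg.trans (scaledVal_one_le_iff.2 ((V.valuation.map_add f g).trans (max_le h le_rfl)))
  · exact hf.trans (scaledVal_one_le_iff.2 ((V.valuation.map_add f g).trans (max_le le_rfl h)))

theorem coe_le_scaledVal_of_nonpos {a : DivisibleHull (AddValueGroup V)} (ha : a ≤ 0) {f : K}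
    (hf : f ∈ V) : (a : QValues V) ≤ scaledVal V 1 f := by
  by_cases hf0 : f = 0
  · rw [hf0, scaledVal_zero]; exact le_top
  rw [scaledVal_of_ne_zero V 1 hf0, WithTop.coe_le_coe, one_smul]
  exact ha.trans (zero_le_unitVal V hf0 hf)

theorem coe_le_scaledVal_iff {a : DivisibleHull (AddValueGroup V)} {q : ℚ} (hq : 0 < q) {f : K} :
    (a : QValues V) ≤ scaledVal V q f ↔
      ((q⁻¹ • a : DivisibleHull (AddValueGroup V)) : QValues V) ≤ scaledVal V 1 f := by
  by_cases hf0 : f = 0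
  · simp [hf0, scaledVal_zero]
  rw [scaledVal_of_ne_zero V _ hf0, scaledVal_of_ne_zero V _ hf0, WithTop.coe_le_coe,
    WithTop.coe_le_coe, one_smul, inv_smul_le_iff_of_pos hq]

theorem zero_le_scaledVal {q : ℚ} (hq : 0 < q) {f : K} (hf : f ∈ V) :
    ((0 : DivisibleHull (AddValueGroup V)) : QValues V) ≤ scaledVal V q f := by
  rw [coe_le_scaledVal_iff hq, smul_zero]
  exact coe_le_scaledVal_of_nonpos le_rfl hf

/-- Clearing the denominator of q gives an inequality in the multiplicative value group, which can
be transported to an equivalent valuation. -/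
theorem valuation_pow_le_of_scaledVal_le {q : ℚ} {m n : ℕ} (hq : (n : ℚ) * q = m) {f x : K}
    (h : scaledVal V q x ≤ scaledVal V 1 f) : V.valuation f ^ n ≤ V.valuation x ^ m := by
  by_cases hn : n = 0
  · subst hn
    have : m = 0 := by
      rw [Nat.cast_zero, zero_mul] at hq
      exact_mod_cast hq.symm
    rw [this, pow_zero, pow_zero]
  by_cases hf0 : f = 0
  · rw [hf0, map_zero, zero_pow hn]; exact zero_le
  by_cases hx0 : x = 0
  · rw [hx0, scaledVal_zero, scaledVal_of_ne_zero V _ hf0, top_le_iff] at h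
    exact absurd h (WithTop.coe_ne_top)
  rw [scaledVal_of_ne_zero V _ hf0, scaledVal_of_ne_zero V _ hx0, WithTop.coe_le_coe,
    one_smul] at h
  rw [← map_pow, ← map_pow, ← unitVal_le_iff V (pow_ne_zero m hx0) (pow_ne_zero n hf0),
    unitVal_pow V hx0, unitVal_pow V hf0, ← hq, mul_smul]
  exact smul_le_smul_of_nonneg_left h (Nat.cast_nonneg n)

theorem le_foldr_min_iff {α : Type*} [LinearOrder α] [OrderTop α] {l : List α} {a : α} :
    a ≤ l.foldr min ⊤ ↔ ∀ b ∈ l, a ≤ b := by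
  induction l with
  | nil => simp
  | cons b l ih => simp [ih]

theorem foldr_min_eq_top_or_mem {α : Type*} [LinearOrder α] [OrderTop α] (l : List α) :
    l = [] ∨ l.foldr min ⊤ ∈ l := by
  induction l with
  | nil => exact Or.inl rfl
  | cons b l ih =>
    right
    rcases ih with rfl | h
    · simp
    · rcases le_total b (l.foldr min ⊤) with hb | hb
      · simp [min_eq_left hb]
      · rw [List.foldr_cons, min_eq_right hb]; exact List.mem_cons_of_mem _ h

end ScaledVal

/-! ### Monomial valuations detect membership in the weighted filtration. -/

section MonomialValuation

variable {R : Type*} [CommRing R]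

open WithZero in
/-- The valuation of a separated weighted filtration with integral associated graded ring. -/
theorem IsGradedDomain.exists_valuation [Nontrivial R] {L : List (R × ℚ)} (h : IsGradedDomain L)
    (hsep : ∀ f : R, f ≠ 0 → ∃ t : ℕ, f ∉ weightedIdeal L t)
    (h1 : (1 : R) ∉ weightedIdeal L 1) :
    ∃ v : Valuation R (WithZero (Multiplicative ℤ)), (∀ f, f ≠ 0 → v f ≠ 0) ∧
      ∀ (f : R) (t : ℕ), v f ≤ exp (-(t : ℤ)) ↔ f ∈ weightedIdeal L t := by
  classical
  have hJ := isFiltration_weightedIdeal L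
  choose ord hord hord' using fun f : {f : R // f ≠ 0} =>
    exists_mem_weightedIdeal_not_mem_succ (hsep f.1 f.2)
  have hiff (f : {f : R // f ≠ 0}) (t : ℕ) : f.1 ∈ weightedIdeal L t ↔ t ≤ ord f := by
    constructor
    · intro hf
      by_contra hlt
      refine hord' f (hJ.mem_of_le ?_ hf)
      exact_mod_cast Nat.succ_le_of_lt (not_le.1 hlt)
    · intro ht
      refine hJ.mem_of_le ?_ (hord f)
      exact_mod_cast ht
  let w : R → WithZero (Multiplicative ℤ) := fun f =>
    if hf : f = 0 then 0 else exp (-(ord ⟨f, hf⟩ : ℤ))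
  have hw0 : w 0 = 0 := dif_pos rfl
  have hw (f : R) (hf : f ≠ 0) : w f = exp (-(ord ⟨f, hf⟩ : ℤ)) := dif_neg hf
  have hle (f : R) (t : ℕ) : w f ≤ exp (-(t : ℤ)) ↔ f ∈ weightedIdeal L t := by
    by_cases hf : f = 0
    · simp [hf, hw0]
    · rw [hw f hf, exp_le_exp, hiff ⟨f, hf⟩ t]
      omega
  have hadd (f g : R) : w (f + g) ≤ max (w f) (w g) := by
    by_cases hf : f = 0
    · simp [hf]
    by_cases hg : g = 0
    · simp [hg]
    rcases le_total (w f) (w g) with hfg | hfg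
    · rw [max_eq_right hfg]
      rw [hw g hg] at hfg ⊢
      rw [hle] at hfg ⊢
      exact add_mem hfg ((hiff ⟨g, hg⟩ _).2 le_rfl)
    · rw [max_eq_left hfg]
      rw [hw f hf] at hfg ⊢
      rw [hle] at hfg ⊢
      exact add_mem ((hiff ⟨f, hf⟩ _).2 le_rfl) hfg
  have hmul (f g : R) : w (f * g) = w f * w g := by
    by_cases hf : f = 0
    · simp [hf, hw0]
    by_cases hg : g = 0
    · simp [hg, hw0]
    have hfg := h.mul_ne_zero hsep hf hg
    rw [hw f hf, hw g hg, hw _ hfg, ← exp_add, exp_inj]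
    have h2 : ord ⟨f, hf⟩ + ord ⟨g, hg⟩ ≤ ord ⟨f * g, hfg⟩ := by
      rw [← hiff]
      push_cast
      exact hJ.mul_mem ((hiff ⟨f, hf⟩ _).2 le_rfl) ((hiff ⟨g, hg⟩ _).2 le_rfl)
    have h3 : ¬ ord ⟨f, hf⟩ + ord ⟨g, hg⟩ + 1 ≤ ord ⟨f * g, hfg⟩ := by
      rw [← hiff]
      intro hmem
      rcases h _ _ f g (hord ⟨f, hf⟩) (hord ⟨g, hg⟩) (by exact_mod_cast hmem) with h4 | h4
      · exact hord' ⟨f, hf⟩ h4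
      · exact hord' ⟨g, hg⟩ h4
    omega
  have hone : w 1 = 1 := by
    have h2 : ¬ 1 ≤ ord ⟨1, one_ne_zero⟩ := by
      rw [← hiff]
      simpa using h1
    rw [hw 1 one_ne_zero, show ord ⟨1, one_ne_zero⟩ = 0 by omega]
    simp
  refine ⟨⟨⟨⟨w, hw0⟩, hone, hmul⟩, hadd⟩, fun f hf => ?_, hle⟩
  change w f ≠ 0
  rw [hw f hf]
  exact exp_ne_zero

/-- Comparison of a weighted filtration with a filtration in which the remaining parameters have
comparatively small weight. -/
theorem weightedIdeal_append_le (N : Ideal R) {L : List (R × ℚ)}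
    (hL : ∀ p ∈ L, ∃ n : ℕ, p.2 = n) {zs : List R} (hzs : ∀ z ∈ zs, z ∈ N) {m : ℕ} (hm : 0 < m)
    (c : ℕ) :
    weightedIdeal (scaleWeights m L ++ zs.map fun z => (z, (1 : ℚ))) ((m : ℚ) * c) ≤
      weightedIdeal L c ⊔ N ^ m := by
  have hJ := isFiltration_weightedIdeal L
  have hm' : (0 : ℚ) < m := Nat.cast_pos.2 hm
  -- In degree mc, the terms with s ≥ c lie in degree c of the filtration of L, while s ≤ c - 1
  -- leaves a power of N with exponent at least m.
  have hK : IsFiltration fun t : ℚ => ⨆ s : ℕ, weightedIdeal L s * N ^ ⌈t - m * s⌉₊ := by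
    refine ⟨fun s t h => ?_, fun t ht => ?_, fun s t => ?_⟩
    · exact iSup_mono fun i => Ideal.mul_mono_right
        (Ideal.pow_le_pow_right (Nat.ceil_mono (by linarith)))
    · refine eq_top_iff.2 (le_iSup_of_le 0 ?_)
      rw [hJ.eq_top _ (by simp), Nat.ceil_eq_zero.2 (by simpa using ht)]
      simp
    · rw [Submodule.iSup_mul]
      refine iSup_le fun i => ?_
      rw [Submodule.mul_iSup]
      refine iSup_le fun j => ?_
      refine le_iSup_of_le (i + j) ?_
      rw [mul_mul_mul_comm, ← pow_add]
      refine Ideal.mul_mono ?_ (Ideal.pow_le_pow_right ?_)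
      · push_cast
        exact hJ.mul_le _ _
      · refine le_trans (le_of_eq ?_) (Nat.ceil_add_le _ _)
        congr 1
        push_cast
        ring
  refine (weightedIdeal_le hK ?_ _).trans ?_
  · intro p hp
    rcases List.mem_append.1 hp with hp | hp
    · obtain ⟨p, hp', rfl⟩ := List.mem_map.1 hp
      obtain ⟨n, hn⟩ := hL p hp'
      refine Submodule.mem_iSup_of_mem n ?_
      rw [hn, sub_self, Nat.ceil_zero, pow_zero, Ideal.one_eq_top, Ideal.mul_top, ← hn]
      exact mem_weightedIdeal hp'
    · obtain ⟨z, hz, rfl⟩ := List.mem_map.1 hp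
      refine Submodule.mem_iSup_of_mem 0 ?_
      rw [hJ.eq_top _ (by simp), Ideal.top_mul]
      simpa using hzs z hz
  · refine iSup_le fun s => ?_
    rcases le_or_gt c s with hs | hs
    · refine Ideal.mul_le_left.trans (le_trans (hJ.antitone ?_) le_sup_left)
      exact_mod_cast hs
    · refine Ideal.mul_le_right.trans (le_trans (Ideal.pow_le_pow_right ?_) le_sup_right)
      rw [← Nat.cast_le (α := ℚ)]
      refine le_trans ?_ (Nat.le_ceil _)
      have : ((s : ℚ) + 1) ≤ c := by exact_mod_cast hs
      nlinarith

theorem mem_of_forall_mem_sup_pow [IsLocalRing R] [IsNoetherianRing R] {N : Ideal R} {f : R}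
    (h : ∀ m : ℕ, 0 < m → f ∈ N ⊔ maximalIdeal R ^ m) : f ∈ N := by
  have h1 := Ideal.iInf_pow_smul_eq_bot_of_isLocalRing (M := R ⧸ N) (maximalIdeal R)
    (maximalIdeal.isMaximal R).ne_top
  rw [← Ideal.Quotient.eq_zero_iff_mem, ← Submodule.mem_bot R, ← h1, Submodule.mem_iInf]
  intro i
  have h2 : f ∈ N ⊔ maximalIdeal R ^ i :=
    (sup_le_sup_left (Ideal.pow_le_pow_right (Nat.le_succ i)) N) (h (i + 1) i.succ_pos)
  obtain ⟨a, ha, b, hb, rfl⟩ := Submodule.mem_sup.1 h2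
  rw [map_add, Ideal.Quotient.eq_zero_iff_mem.2 ha, zero_add]
  have : Ideal.Quotient.mk N b = b • (1 : R ⧸ N) := by
    rw [Algebra.smul_def, mul_one]; rfl
  rw [this]
  exact Submodule.smul_mem_smul hb trivial

open WithZero in
/-- If `v(f) ≥ min_i a_i v(x_i)` for all valuation rings dominating the local ring, then `f` lies in
the degree one part of the weighted filtration of the center `(x_1^{a_1}, …, x_k^{a_k})`. -/
theorem HasParameters.mem_weightedIdeal_of_valuation {k : Type*} [Field k] [CharZero k]
    {R : Type u} [CommRing R] [IsLocalRing R] [IsDomain R] [Algebra k R]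
    (hR : HasParameters k R) {K : Type u} [Field K] [Algebra R K] [IsFractionRing R K]
    {M : List (R × ℚ)} (hind : IsIndependent (M.map Prod.fst)) (hpos : ∀ p ∈ M, 0 < p.2)
    (hs : (M.map Prod.snd).Pairwise (· ≤ ·)) {f : R}
    (h : ∀ V : ValuationSubring K, (∀ r : R, algebraMap R K r ∈ V) →
      (∀ r ∈ maximalIdeal R, V.valuation (algebraMap R K r) < 1) →
      (M.map fun p => scaledVal V p.2 (algebraMap R K p.1)).foldr min ⊤ ≤
        scaledVal V 1 (algebraMap R K f)) :
    f ∈ weightedIdeal (centerWeights M) 1 := by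
  have := hR.noetherian
  obtain ⟨c, hc, hcz⟩ := exists_common_denominator ((centerWeights M).map Prod.snd)
  have hc' : (0 : ℚ) < c := Nat.cast_pos.2 hc
  have hnat : ∀ p ∈ M, ∃ n : ℕ, 0 < n ∧ (c : ℚ) * p.2⁻¹ = n := by
    intro p hp
    obtain ⟨z, hz⟩ := hcz p.2⁻¹ (List.mem_map_of_mem (mem_centerWeights hp))
    exact exists_nat_of_pos_of_eq_int (mul_pos hc' (inv_pos.2 (hpos p hp))) hz
  obtain ⟨zs, hzs, hspan⟩ := hR.exists_extension hind
  rw [← weightedIdeal_scaleWeights hc', mul_one]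
  -- A monomial valuation must give the additional parameters positive weight to be centered at m.
  -- They get weight 1, the given ones m times an integral weight; the resulting error in m^m
  -- disappears on letting m grow.
  refine mem_of_forall_mem_sup_pow fun m hm => ?_
  have hm' : (0 : ℚ) < m := Nat.cast_pos.2 hm
  refine weightedIdeal_append_le (maximalIdeal R) (zs := zs) (L := scaleWeights c (centerWeights M))
    ?_ (fun z hz => hzs.1 z (List.mem_append_right _ hz)) hm c ?_
  · intro p hp
    obtain ⟨p, hp', rfl⟩ := List.mem_map.1 hp
    obtain ⟨p, hp'', rfl⟩ := List.mem_map.1 hp'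
    obtain ⟨n, -, hn⟩ := hnat p hp''
    exact ⟨n, hn⟩
  set L : List (R × ℚ) :=
    scaleWeights m (scaleWeights c (centerWeights M)) ++ zs.map fun z => (z, (1 : ℚ)) with hLdef
  have hLM : ∀ p ∈ M, (p.1, (m : ℚ) * (c * p.2⁻¹)) ∈ L := fun p hp =>
    List.mem_append_left _ (List.mem_map.2 ⟨(p.1, c * p.2⁻¹),
      List.mem_map.2 ⟨(p.1, p.2⁻¹), mem_centerWeights hp, rfl⟩, rfl⟩)
  have hLcases : ∀ q ∈ L, (∃ p ∈ M, q = (p.1, (m : ℚ) * (c * p.2⁻¹))) ∨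
      ∃ z ∈ zs, q = (z, 1) := by
    intro q hq
    rcases List.mem_append.1 hq with hq | hq
    · obtain ⟨p, hp', rfl⟩ := List.mem_map.1 hq
      obtain ⟨p, hp'', rfl⟩ := List.mem_map.1 hp'
      obtain ⟨p, hp''', rfl⟩ := List.mem_map.1 hp''
      exact Or.inl ⟨p, hp''', rfl⟩
    · obtain ⟨z, hz, rfl⟩ := List.mem_map.1 hq
      exact Or.inr ⟨z, hz, rfl⟩
  have hLfst : L.map Prod.fst = M.map Prod.fst ++ zs := by
    rw [hLdef, List.map_append, scaleWeights_map_fst, scaleWeights_map_fst]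
    simp [centerWeights, Function.comp_def]
  have hLnat : ∀ q ∈ L, ∃ n : ℕ, 0 < n ∧ q.2 = n := by
    intro q hq
    rcases hLcases q hq with ⟨p, hp, rfl⟩ | ⟨z, -, rfl⟩
    · obtain ⟨n, hn, hn'⟩ := hnat p hp
      exact ⟨m * n, Nat.mul_pos hm hn, by dsimp only; rw [hn']; push_cast; rfl⟩
    · exact ⟨1, one_pos, by simp⟩
  have hLmem : ∀ q ∈ L, q.1 ∈ maximalIdeal R := by
    intro q hq
    exact hzs.1 _ (hLfst ▸ List.mem_map_of_mem hq)
  -- All weights are positive integers and the elements of L generate the maximal ideal, so the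
  -- valuation ring will dominate R.
  have hmJ : maximalIdeal R ≤ weightedIdeal L 1 := by
    refine hspan.trans (Ideal.span_le.2 ?_)
    intro z hz
    have hz' : z ∈ L.map Prod.fst := hLfst ▸ hz
    obtain ⟨q, hq, rfl⟩ := List.mem_map.1 hz'
    obtain ⟨n, hn, hn'⟩ := hLnat q hq
    refine (isFiltration_weightedIdeal L).mem_of_le ?_ (mem_weightedIdeal hq)
    rw [hn']
    exact_mod_cast hn
  have hgr : IsGradedDomain L := by
    refine hR.isGradedDomain L (hLfst ▸ hzs) hLnat ?_
    have hs' := List.pairwise_map.1 hs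
    refine List.pairwise_append.2 ⟨?_, ?_, ?_⟩
    · simp only [scaleWeights, centerWeights, List.map_map, List.pairwise_map]
      refine hs'.imp_of_mem fun {p r} hp _ hpr => ?_
      exact mul_le_mul_of_nonneg_left (mul_le_mul_of_nonneg_left
        (inv_anti₀ (hpos p hp) hpr) hc'.le) hm'.le
    · exact List.pairwise_map.2 (List.pairwise_iff_forall_sublist.2 fun _ => le_rfl)
    · intro q hq z hz
      obtain ⟨z, -, rfl⟩ := List.mem_map.1 hz
      obtain ⟨n, hn, hn'⟩ := hLnat q (List.mem_append_left _ hq)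
      rw [hn']
      exact Nat.one_le_cast.2 hn
  have h1 : (1 : R) ∉ weightedIdeal L 1 := by
    intro h1
    obtain ⟨W, hW0, hW⟩ : ∃ W : ℚ, 0 < W ∧ ∀ p ∈ L, W * p.2 ≤ 1 := by
      clear_value L
      clear h1 hmJ hgr hLfst hLcases hLM hLmem hLdef
      induction L with
      | nil => exact ⟨1, one_pos, by simp⟩
      | cons p L ih =>
        obtain ⟨W, h0, hW⟩ := ih fun q hq => hLnat q (List.mem_cons_of_mem _ hq)
        obtain ⟨n, hn, hn'⟩ := hLnat p (by simp)
        have hp : 0 < p.2 := by rw [hn']; exact_mod_cast hn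
        refine ⟨min W p.2⁻¹, lt_min h0 (inv_pos.2 hp), fun r hr => ?_⟩
        rcases List.mem_cons.1 hr with rfl | hr
        · exact (mul_le_mul_of_nonneg_right (min_le_right _ _) hp.le).trans_eq
            (inv_mul_cancel₀ hp.ne')
        · obtain ⟨n, -, hn'⟩ := hLnat r (List.mem_cons_of_mem _ hr)
          exact (mul_le_mul_of_nonneg_right (min_le_left _ _)
            (by rw [hn']; exact Nat.cast_nonneg n)).trans (hW r hr)
    have h2 := weightedIdeal_le_pow hW0 (fun p hp => ⟨hLmem p hp, hW p hp⟩) 1 h1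
    rw [mul_one] at h2
    have h3 := Ideal.pow_le_self (Nat.ceil_pos.2 hW0).ne' h2
    exact (maximalIdeal.isMaximal R).ne_top ((Ideal.eq_top_iff_one _).2 h3)
  obtain ⟨w, hw0, hw⟩ := hgr.exists_valuation
    (fun f hf => exists_not_mem_weightedIdeal hLmem hf) h1
  have hsupp : nonZeroDivisors R ≤ w.supp.primeCompl := fun r hr hr' =>
    hw0 r (nonZeroDivisors.ne_zero hr) hr'
  let wK := w.extendToLocalization hsupp K
  have hwK (r : R) : wK (algebraMap R K r) = w r :=
    Valuation.extendToLocalization_apply_map_apply w hsupp K r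
  have hequiv := wK.isEquiv_valuation_valuationSubring
  have key := h wK.valuationSubring (fun r => by
      rw [Valuation.mem_valuationSubring_iff, hwK]
      have := (hw r 0).2 ((isFiltration_weightedIdeal L).mem_of_nonpos (by simp) r)
      simpa using this)
    (fun r hr => by
      rw [← hequiv.lt_one_iff_lt_one, hwK]
      refine ((hw r 1).2 (by simpa using hmJ hr)).trans_lt ?_
      rw [← exp_zero, exp_lt_exp]
      simp)
  -- For the empty center the value is ⊤, which forces f = 0. Otherwise the minimum is attained at
  -- one of the parameters.
  rcases foldr_min_eq_top_or_mem (M.map fun p =>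
    scaledVal wK.valuationSubring p.2 (algebraMap R K p.1)) with hnil | hmem
  · rw [hnil, List.foldr_nil, top_le_iff] at key
    have hf : f = 0 := by
      by_contra hf
      rw [scaledVal_of_ne_zero _ _ ((map_ne_zero_iff _ (IsFractionRing.injective R K)).2 hf)] at key
      exact WithTop.coe_ne_top key
    rw [hf]
    exact zero_mem _
  · obtain ⟨p, hp, hpeq⟩ := List.mem_map.1 hmem
    rw [← hpeq] at key
    obtain ⟨n, hn, hn'⟩ := hnat p hp
    have hq : (n : ℚ) * p.2 = c := by
      rw [← hn', mul_assoc, inv_mul_cancel₀ (hpos p hp).ne', mul_one]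
    have h2 := valuation_pow_le_of_scaledVal_le hq key
    rw [← map_pow wK.valuationSubring.valuation, ← map_pow wK.valuationSubring.valuation,
      ← hequiv, map_pow, map_pow, hwK, hwK] at h2
    have h3 : w p.1 ≤ exp (-((m * n : ℕ) : ℤ)) := by
      rw [hw]
      have := mem_weightedIdeal (hLM p hp)
      rw [hn'] at this
      push_cast
      exact this
    -- With n = c/a, the inequality a v(x) ≤ v(f) says that f^n has at least the order of x^c, which
    -- is at least mnc; so f has order at least mc.
    have h4 : w f ^ n ≤ exp (-((m * c : ℕ) : ℤ)) ^ n := by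
      refine h2.trans ((pow_le_pow_left₀ zero_le h3 c).trans (le_of_eq ?_))
      rw [← exp_nsmul, ← exp_nsmul]
      congr 1
      push_cast
      ring
    have h5 := (pow_le_pow_iff_left₀ zero_le zero_le hn.ne').1 h4
    rw [hw] at h5
    push_cast at h5
    exact h5

end MonomialValuation

end WeightedCenters

namespace WeightedCenters

open IsLocalRing

/-! ### Smooth local rings have enough derivations. -/

section Smooth

/-- The section s splits r into a constant part and an element of m, both well defined modulo m².
The derivation applies the functional, which kills m², to the second part; the Leibniz rule holds
because s is multiplicative. -/
theorem exists_derivation_of_algHom_section {k R : Type*} [Field k] [CommRing R] [IsLocalRing R]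
    [Algebra k R] (s : ResidueField R →ₐ[k] R ⧸ maximalIdeal R ^ 2)
    (hs : ∀ r : R, ∃ t : R, s (residue R r) = Ideal.Quotient.mk _ t ∧ r - t ∈ maximalIdeal R)
    (l : R → R)
    (hadd : ∀ y ∈ maximalIdeal R, ∀ z ∈ maximalIdeal R,
      l (y + z) - (l y + l z) ∈ maximalIdeal R)
    (hmul : ∀ r, ∀ z ∈ maximalIdeal R, l (r * z) - r * l z ∈ maximalIdeal R) :
    ∃ d : Derivation k R (ResidueField R), ∀ z ∈ maximalIdeal R, d z = residue R (l z) := by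
  let b : R → ResidueField R := fun z => residue R (l z)
  have hbadd (y z : R) (hy : y ∈ maximalIdeal R) (hz : z ∈ maximalIdeal R) :
      b (y + z) = b y + b z := by
    have := (residue_eq_zero_iff _).2 (hadd y hy z hz)
    rwa [map_sub, map_add, sub_eq_zero] at this
  have hbmul (r z : R) (hz : z ∈ maximalIdeal R) : b (r * z) = residue R r * b z := by
    have := (residue_eq_zero_iff _).2 (hmul r z hz)
    rwa [map_sub, map_mul, sub_eq_zero] at this
  have hbsq (z : R) (hz : z ∈ maximalIdeal R ^ 2) : b z = 0 := by
    rw [pow_two] at hz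
    have : z ∈ maximalIdeal R ∧ b z = 0 := by
      refine Submodule.mul_induction_on hz ?_ ?_
      · intro y hy z hz
        exact ⟨Ideal.mul_mem_left _ _ hz, by
          rw [hbmul y z hz, (residue_eq_zero_iff y).2 hy, zero_mul]⟩
      · rintro y z ⟨hy, hy'⟩ ⟨hz, hz'⟩
        exact ⟨add_mem hy hz, by rw [hbadd y z hy hz, hy', hz', add_zero]⟩
    exact this.2
  have hbcongr (y z : R) (hz : z ∈ maximalIdeal R) (h : y - z ∈ maximalIdeal R ^ 2) :
      b y = b z := by
    have := hbadd (y - z) z (Ideal.pow_le_self two_ne_zero h) hz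
    rwa [sub_add_cancel, hbsq _ h, zero_add] at this
  choose t ht htm using hs
  have htz (z : R) (hz : z ∈ maximalIdeal R) : t z ∈ maximalIdeal R ^ 2 := by
    rw [← Ideal.Quotient.eq_zero_iff_mem, ← ht, (residue_eq_zero_iff z).2 hz, map_zero]
  let D : R →ₗ[k] ResidueField R :=
    { toFun := fun r => b (r - t r)
      map_add' := fun x y => by
        rw [← hbadd _ _ (htm x) (htm y)]
        refine hbcongr _ _ (add_mem (htm x) (htm y)) ?_
        have h1 : x + y - t (x + y) - (x - t x + (y - t y)) = t x + t y - t (x + y) := by ring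
        rw [h1, ← Ideal.Quotient.eq_zero_iff_mem, map_sub, map_add, ← ht, ← ht, ← ht, map_add,
          map_add, sub_self]
      map_smul' := fun c x => by
        have h0 : c • b (x - t x) = b (algebraMap k R c * (x - t x)) := by
          rw [hbmul _ _ (htm x), Algebra.smul_def]; rfl
        rw [RingHom.id_apply, h0]
        refine hbcongr _ _ (Ideal.mul_mem_left _ _ (htm x)) ?_
        have h1 : c • x - t (c • x) - algebraMap k R c * (x - t x) =
          algebraMap k R c * t x - t (c • x) := by rw [Algebra.smul_def]; ring
        rw [h1, ← Ideal.Quotient.eq_zero_iff_mem, map_sub, map_mul, ← ht, ← ht,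
          Algebra.smul_def c x, map_mul, map_mul, sub_eq_zero]
        congr 1
        exact (s.commutes c).symm }
  refine ⟨Derivation.mk' D fun x y => ?_, fun z hz => ?_⟩
  · change b (x * y - t (x * y)) = x • b (y - t y) + y • b (x - t x)
    have h2 : y • b (x - t x) = b (t y * (x - t x)) := by
      rw [hbmul _ _ (htm x), Algebra.smul_def]
      congr 1
      have := (residue_eq_zero_iff _).2 (htm y)
      rwa [map_sub, sub_eq_zero] at this
    have h3 : x • b (y - t y) = b (x * (y - t y)) := by
      rw [hbmul _ _ (htm y), Algebra.smul_def]; rfl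
    rw [h2, h3, ← hbadd _ _ (Ideal.mul_mem_left _ _ (htm y)) (Ideal.mul_mem_left _ _ (htm x))]
    refine hbcongr _ _ (add_mem (Ideal.mul_mem_left _ _ (htm y))
      (Ideal.mul_mem_left _ _ (htm x))) ?_
    have h1 : x * y - t (x * y) - (x * (y - t y) + t y * (x - t x)) = t x * t y - t (x * y) := by
      ring
    rw [h1, ← Ideal.Quotient.eq_zero_iff_mem, map_sub, map_mul, ← ht, ← ht, ← ht, map_mul,
      map_mul, sub_self]
  · change b (z - t z) = b z
    refine hbcongr _ _ hz ?_
    rw [sub_sub_cancel_left]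
    exact neg_mem (htz z hz)

/-- In characteristic 0 the residue field is formally smooth over k, so it lifts to R/m² and the
functional extends to a derivation into the residue field. As the Kähler differentials of R are
projective, this derivation lifts to R. -/
theorem HasParameters.of_formallySmooth {k R : Type*} [Field k] [CharZero k] [CommRing R]
    [IsLocalRing R] [IsNoetherianRing R] [Algebra k R] [Algebra.FormallySmooth k R]
    [Algebra.EssFiniteType k R] : HasParameters k R := by
  refine ⟨inferInstance, fun l hadd hmul => ?_⟩
  have : Algebra.EssFiniteType k (ResidueField R) :=
    Algebra.EssFiniteType.of_surjective (IsScalarTower.toAlgHom k R (ResidueField R))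
      residue_surjective
  have : Algebra.FormallySmooth k (ResidueField R) := Algebra.FormallySmooth.of_perfectField
  let q : R ⧸ maximalIdeal R ^ 2 →ₐ[k] ResidueField R :=
    Ideal.Quotient.factorₐ k (Ideal.pow_le_self two_ne_zero)
  have hqmk (r : R) : q (Ideal.Quotient.mk _ r) = residue R r := rfl
  have hqs : Function.Surjective q := fun a => by
    obtain ⟨r, rfl⟩ := residue_surjective a
    exact ⟨_, hqmk r⟩
  have hker : IsNilpotent (RingHom.ker (q : R ⧸ maximalIdeal R ^ 2 →+* ResidueField R)) := by
    refine ⟨2, le_bot_iff.1 ?_⟩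
    have h1 : RingHom.ker (q : R ⧸ maximalIdeal R ^ 2 →+* ResidueField R) ≤
        (maximalIdeal R).map (Ideal.Quotient.mk (maximalIdeal R ^ 2)) := by
      intro a ha
      obtain ⟨r, rfl⟩ := Ideal.Quotient.mk_surjective a
      exact Ideal.mem_map_of_mem _ ((residue_eq_zero_iff r).1 ha)
    refine (Ideal.pow_right_mono h1 2).trans ?_
    rw [← Ideal.map_pow, Ideal.map_quotient_self]
  let s := Algebra.FormallySmooth.liftOfSurjective (AlgHom.id k (ResidueField R)) q hqs hker
  have hs (a : ResidueField R) : q (s a) = a :=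
    Algebra.FormallySmooth.liftOfSurjective_apply (AlgHom.id k (ResidueField R)) q hqs hker a
  obtain ⟨d, hd⟩ := exists_derivation_of_algHom_section s (fun r => by
    obtain ⟨t, ht⟩ := Ideal.Quotient.mk_surjective (s (residue R r))
    refine ⟨t, ht.symm, ?_⟩
    rw [← residue_eq_zero_iff, map_sub, sub_eq_zero, ← hqmk t, ht, hs]) l hadd hmul
  obtain ⟨g, hg⟩ := Module.projective_lifting_property
    (IsScalarTower.toAlgHom R R (ResidueField R)).toLinearMap d.liftKaehlerDifferential
    residue_surjective
  refine ⟨g.compDer (KaehlerDifferential.D k R), fun z hz => ?_⟩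
  rw [← residue_eq_zero_iff, map_sub, sub_eq_zero, ← hd z hz]
  have := LinearMap.congr_fun hg (KaehlerDifferential.D k R z)
  rw [Derivation.liftKaehlerDifferential_comp_D] at this
  exact this

theorem hasParameters_stalk {k : Type u} [Field k] [CharZero k] {Y : Scheme.{u}}
    (f : Y ⟶ Spec (CommRingCat.of k)) [AlgebraicGeometry.Smooth f] (p : Y) :
    letI : Algebra k (Y.presheaf.stalk p) := (stalkStructureMap f p).toAlgebra
    HasParameters k (Y.presheaf.stalk p) := by
  let : Algebra k (Y.presheaf.stalk p) := (stalkStructureMap f p).toAlgebra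
  have : IsLocallyNoetherian Y := LocallyOfFiniteType.isLocallyNoetherian f
  obtain ⟨_, ⟨V, hV, rfl⟩, hpV, -⟩ :=
    Y.isBasis_affineOpens.exists_subset_of_mem_open (Set.mem_univ p) isOpen_univ
  let g : CommRingCat.of k ⟶ Γ(Y, V) :=
    (Scheme.ΓSpecIso (CommRingCat.of k)).inv ≫ f.appLE ⊤ V le_top
  have hg : g.hom.Smooth := by
    have h1 := f.smooth_appLE (isAffineOpen_top _) hV le_top
    exact RingHom.Smooth.comp (RingHom.Smooth.of_bijective
      (ConcreteCategory.bijective_of_isIso (Scheme.ΓSpecIso (CommRingCat.of k)).inv)) h1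
  let : Algebra k Γ(Y, V) := g.hom.toAlgebra
  let : Algebra Γ(Y, V) (Y.presheaf.stalk p) := Y.presheaf.algebra_section_stalk ⟨p, hpV⟩
  have : IsScalarTower k Γ(Y, V) (Y.presheaf.stalk p) := by
    refine IsScalarTower.of_algebraMap_eq' ?_
    change (stalkStructureMap f p) = (g ≫ Y.presheaf.germ V p hpV).hom
    rw [stalkStructureMap]
    congr 1
    simp only [g, Scheme.Hom.appLE, Category.assoc]
    exact congrArg (fun h => (Scheme.ΓSpecIso (CommRingCat.of k)).inv ≫ f.appTop ≫ h)
      (Y.presheaf.germ_res (homOfLE le_top) p hpV).symm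
  have hsm : Algebra.Smooth k Γ(Y, V) := hg
  have hloc := hV.isLocalization_stalk ⟨p, hpV⟩
  have : Algebra.FormallySmooth Γ(Y, V) (Y.presheaf.stalk p) :=
    Algebra.FormallySmooth.of_isLocalization (hV.primeIdealOf ⟨p, hpV⟩).asIdeal.primeCompl
  have : Algebra.FormallySmooth k (Y.presheaf.stalk p) :=
    Algebra.FormallySmooth.comp k Γ(Y, V) _
  have : Algebra.EssFiniteType Γ(Y, V) (Y.presheaf.stalk p) :=
    Algebra.EssFiniteType.of_isLocalization _ (hV.primeIdealOf ⟨p, hpV⟩).asIdeal.primeCompl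
  have : Algebra.EssFiniteType k (Y.presheaf.stalk p) :=
    Algebra.EssFiniteType.comp k Γ(Y, V) _
  exact HasParameters.of_formallySmooth

end Smooth

end WeightedCenters

namespace WeightedCenters

open IsLocalRing

/-! ### Admissibility over a neighbourhood and the weighted filtration of the stalk. -/

section ZariskiRiemann

theorem IsPartialParameterSystem.ne_zero {R : Type*} [CommRing R] [IsLocalRing R] {xs : List R}
    (h : IsPartialParameterSystem xs) {x : R} (hx : x ∈ xs) : x ≠ 0 := by
  obtain ⟨hm, hli⟩ := h
  obtain ⟨i, rfl⟩ := List.get_of_mem hx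
  intro h0
  apply hli.ne_zero i
  rw [Ideal.toCotangent_eq_zero]
  change xs.get i ∈ _
  rw [h0]
  exact zero_mem _

section HasGrowth

variable {K : Type u} [Field K]

/-- `v(f) ≥ t γ` for all `γ ≥ 0` bounded above by `c`. -/
def HasGrowth (V : ValuationSubring K) (c : QValues V) (t : ℚ) (f : K) : Prop :=
  ∀ γ : DivisibleHull (AddValueGroup V), 0 ≤ γ → (γ : QValues V) ≤ c →
    ((t • γ : DivisibleHull (AddValueGroup V)) : QValues V) ≤ scaledVal V 1 f

variable {V : ValuationSubring K} {c : QValues V} {s t : ℚ} {f g : K}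

theorem hasGrowth_zero : HasGrowth V c t 0 := fun γ _ _ => by
  rw [scaledVal_zero]; exact le_top

theorem HasGrowth.add (hf : HasGrowth V c t f) (hg : HasGrowth V c t g) :
    HasGrowth V c t (f + g) :=
  fun γ h0 hγ => le_scaledVal_add (hf γ h0 hγ) (hg γ h0 hγ)

theorem HasGrowth.mul (hf : HasGrowth V c s f) (hg : HasGrowth V c t g) :
    HasGrowth V c (s + t) (f * g) := fun γ h0 hγ => by
  rw [add_smul]
  exact coe_le_scaledVal_mul (hf γ h0 hγ) (hg γ h0 hγ)

theorem HasGrowth.mono (hf : HasGrowth V c t f) (h : s ≤ t) : HasGrowth V c s f :=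
  fun γ h0 hγ => (WithTop.coe_le_coe.2 (smul_le_smul_of_nonneg_right h h0)).trans (hf γ h0 hγ)

theorem hasGrowth_of_nonpos (ht : t ≤ 0) (hf : f ∈ V) : HasGrowth V c t f :=
  fun _ h0 _ => coe_le_scaledVal_of_nonpos (smul_nonpos_of_nonpos_of_nonneg ht h0) hf

end HasGrowth

theorem stalkIdeal_eq_map {Y : Scheme.{u}} (I : Y.IdealSheafData) (U : Y.affineOpens) {y : Y} (hy : y ∈ U.1) :
    stalkIdeal I y = (I.ideal U).map (Y.presheaf.germ U.1 y hy).hom := by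
  have hres {V W : Y.affineOpens} (h : V ≤ W) (hy : y ∈ V.1) :
      (I.ideal W).map (Y.presheaf.germ W.1 y (h hy)).hom =
        (I.ideal V).map (Y.presheaf.germ V.1 y hy).hom := by
    rw [← I.map_ideal h, Ideal.map_map, ← CommRingCat.hom_comp]
    exact congrArg (fun e => (I.ideal W).map (CommRingCat.Hom.hom e))
      (Y.presheaf.germ_res (homOfLE h : V.1 ⟶ W.1) y hy).symm
  refine le_antisymm (iSup₂_le fun V hV => ?_)
    (le_iSup₂_of_le (f := fun (U : Y.affineOpens) (h : y ∈ U.1) =>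
      (I.ideal U).map (Y.presheaf.germ U.1 y h).hom) U hy le_rfl)
  obtain ⟨_, ⟨W, hW, rfl⟩, hyW, hWsub⟩ :=
    Y.isBasis_affineOpens.exists_subset_of_mem_open (show y ∈ U.1 ⊓ V.1 from ⟨hy, hV⟩)
      (U.1 ⊓ V.1).isOpen
  rw [hres (V := ⟨W, hW⟩) (W := V) (fun z hz => (hWsub hz).2) hyW,
    hres (V := ⟨W, hW⟩) (W := U) (fun z hz => (hWsub hz).1) hyW]

variable {Y : Scheme.{u}} [IsIntegral Y]

/-- The filter of sets of points of the Zariski–Riemann space that contain all points centered in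
some neighbourhood of `p`. -/
def zrNhds (p : Y) : Filter (ZRPoint Y) := (nhds p).comap ZRPoint.center

theorem eventually_zrNhds_iff {p : Y} {P : ZRPoint Y → Prop} :
    (∀ᶠ v in zrNhds p, P v) ↔
      ∃ U : Y.Opens, p ∈ U ∧ ∀ v : ZRPoint Y, v.center ∈ U → P v := by
  rw [zrNhds, Filter.eventually_comap, eventually_nhds_iff]
  constructor
  · rintro ⟨t, ht, hto, hpt⟩
    exact ⟨⟨t, hto⟩, hpt, fun v hv => ht _ hv v rfl⟩
  · rintro ⟨U, hpU, hU⟩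
    exact ⟨U, fun y hy v hv => hU v (hv ▸ hy), U.isOpen, hpU⟩

theorem algebraMap_germ_eq {U : Y.Opens} (s : Γ(Y, U)) {p q : Y} (hp : p ∈ U) (hq : q ∈ U) :
    algebraMap (Y.presheaf.stalk p) Y.functionField (Y.presheaf.germ U p hp s) =
      algebraMap (Y.presheaf.stalk q) Y.functionField (Y.presheaf.germ U q hq s) := by
  have : Nonempty U := ⟨⟨p, hp⟩⟩
  rw [Scheme.algebraMap_germ_eq_germToFunctionField, Scheme.algebraMap_germ_eq_germToFunctionField]

theorem eventually_mem_ring {p : Y} (r : Y.presheaf.stalk p) :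
    ∀ᶠ v in zrNhds p, algebraMap _ Y.functionField r ∈ v.ring := by
  obtain ⟨U, hpU, s, rfl⟩ := Y.presheaf.exists_germ_eq r
  refine eventually_zrNhds_iff.2 ⟨U, hpU, fun v hv => ?_⟩
  rw [algebraMap_germ_eq s hpU hv]
  exact v.stalk_le _

theorem centerValue_eq {p : Y} (xs : List (Y.presheaf.stalk p)) (as : List ℚ) (v : ZRPoint Y) :
    centerValue xs as v = ((xs.zip as).map fun q =>
      scaledVal v.ring q.2 (algebraMap _ Y.functionField q.1)).foldr min ⊤ := by
  rw [centerValue, List.map_zip_eq_zipWith]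
  rfl

/-- The germs `h` with `v(h) ≥ t γ` for all `v` over a neighbourhood of `p` and all `γ ≥ 0` bounded
above by the value of the center. -/
noncomputable def valuativeFiltration {p : Y} (xs : List (Y.presheaf.stalk p)) (as : List ℚ)
    (t : ℚ) : Ideal (Y.presheaf.stalk p) where
  carrier := {h | ∀ᶠ v in zrNhds p,
    HasGrowth v.ring (centerValue xs as v) t (algebraMap _ Y.functionField h)}
  zero_mem' := by
    rw [Set.mem_ofPred_eq, map_zero]
    exact Filter.Eventually.of_forall fun v => hasGrowth_zero
  add_mem' {g h} hg hh := by
    rw [Set.mem_ofPred_eq] at hg hh ⊢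
    filter_upwards [hg, hh] with v hg hh
    rw [map_add]
    exact hg.add hh
  smul_mem' r h hh := by
    rw [Set.mem_ofPred_eq] at hh ⊢
    filter_upwards [hh, eventually_mem_ring r] with v hh hr
    rw [smul_eq_mul, map_mul]
    simpa using (hasGrowth_of_nonpos le_rfl hr).mul hh

theorem mem_valuativeFiltration_iff {p : Y} {xs : List (Y.presheaf.stalk p)} {as : List ℚ}
    {t : ℚ} {h : Y.presheaf.stalk p} : h ∈ valuativeFiltration xs as t ↔ ∀ᶠ v in zrNhds p,
      HasGrowth v.ring (centerValue xs as v) t (algebraMap _ Y.functionField h) := Iff.rfl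

theorem isFiltration_valuativeFiltration {p : Y} (xs : List (Y.presheaf.stalk p))
    (as : List ℚ) : IsFiltration (valuativeFiltration xs as) where
  antitone s t hst h hh := by
    rw [mem_valuativeFiltration_iff] at hh ⊢
    exact hh.mono fun v hv => hv.mono hst
  eq_top t ht := by
    refine eq_top_iff.2 fun h _ => mem_valuativeFiltration_iff.2 ?_
    exact (eventually_mem_ring h).mono fun v hv => hasGrowth_of_nonpos ht hv
  mul_le s t := by
    refine Ideal.mul_le.2 fun g hg h hh => ?_
    rw [mem_valuativeFiltration_iff] at hg hh ⊢
    filter_upwards [hg, hh] with v hg hh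
    rw [map_mul]
    exact hg.mul hh

theorem mem_valuativeFiltration {p : Y} {xs : List (Y.presheaf.stalk p)} {as : List ℚ}
    {x : Y.presheaf.stalk p} {a : ℚ} (ha : 0 < a) (hx : (x, a) ∈ xs.zip as) :
    x ∈ valuativeFiltration xs as a⁻¹ := by
  refine mem_valuativeFiltration_iff.2 (Filter.Eventually.of_forall fun v γ _ hγ => ?_)
  rw [centerValue_eq, le_foldr_min_iff] at hγ
  exact (coe_le_scaledVal_iff ha).1 (hγ _ (List.mem_map.2 ⟨_, hx, rfl⟩))

/-- The germs whose values grow with the center form a filtration with x_i in degree 1/a_i, so it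
contains the weighted filtration by minimality of the latter. -/
theorem eventually_centerValue_le {p : Y} {xs : List (Y.presheaf.stalk p)} {as : List ℚ}
    (hx : ∀ x ∈ xs, x ≠ 0) (ha : ∀ a ∈ as, 0 < a) {q : ℚ} (hq : 0 < q)
    {h : Y.presheaf.stalk p} (hh : h ∈ weightedIdeal (centerWeights (xs.zip as)) q⁻¹) :
    ∀ᶠ v in zrNhds p, centerValue xs as v ≤ scaledVal v.ring q (algebraMap _ Y.functionField h) := by
  rcases List.eq_nil_or_concat (xs.zip as) with hnil | ⟨l, e, hl⟩
  · rw [hnil, centerWeights, List.map_nil, weightedIdeal_nil (inv_pos.2 hq), Ideal.mem_bot] at hh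
    refine Filter.Eventually.of_forall fun v => ?_
    rw [hh, map_zero, scaledVal_zero]
    exact le_top
  have hne : xs.zip as ≠ [] := by simp [hl]
  have hmem : h ∈ valuativeFiltration xs as q⁻¹ := by
    refine weightedIdeal_le (isFiltration_valuativeFiltration xs as)
      (forall_mem_centerWeights (P := fun p => p.1 ∈ valuativeFiltration xs as p.2).2
        fun e he => ?_) _ hh
    exact mem_valuativeFiltration (ha _ (List.of_mem_zip he).2) he
  have hring : ∀ᶠ v in zrNhds p, ∀ x ∈ xs, algebraMap _ Y.functionField x ∈ v.ring := by
    have := (Filter.eventually_all_finite (l := zrNhds p) xs.finite_toSet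
      (p := fun x v => algebraMap _ Y.functionField x ∈ v.ring)).2 fun x _ => eventually_mem_ring x
    exact this
  rw [mem_valuativeFiltration_iff] at hmem
  filter_upwards [hmem, hring] with v hv hvr
  -- The parameters are nonzero and regular near p, so the value of a nonempty center is finite and
  -- nonnegative, and can serve as γ in `HasGrowth`.
  have hval : ∃ γ : DivisibleHull (AddValueGroup v.ring), centerValue xs as v = γ ∧ 0 ≤ γ := by
    rcases foldr_min_eq_top_or_mem ((xs.zip as).map fun q =>
      scaledVal v.ring q.2 (algebraMap _ Y.functionField q.1)) with h1 | h1
    · exact absurd (List.map_eq_nil_iff.1 h1) hne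
    · rw [← centerValue_eq] at h1
      obtain ⟨e, he, heq⟩ := List.mem_map.1 h1
      have hmem := List.of_mem_zip (a := e.1) (b := e.2) he
      have he0 : algebraMap _ Y.functionField e.1 ≠ 0 := by
        simpa using hx _ hmem.1
      have h0 := zero_le_scaledVal (ha _ hmem.2) (hvr _ hmem.1)
      rw [scaledVal_of_ne_zero _ _ he0] at h0 heq
      exact ⟨_, heq.symm, WithTop.coe_le_coe.1 h0⟩
  obtain ⟨γ, hγ, h0⟩ := hval
  rw [hγ, coe_le_scaledVal_iff hq]
  exact hv γ h0 hγ.ge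

theorem exists_isLeast_scaledVal_of_span {A K : Type u} [CommRing A] [DecidableEq A] [Field K]
    [Algebra A K] (V : ValuationSubring K) (hV : ∀ r : A, algebraMap A K r ∈ V) (s : Finset A) :
    ∃ g ∈ insert 0 s, IsLeast ((fun h : A => scaledVal V 1 (algebraMap A K h)) ''
      (Ideal.span (s : Set A) : Ideal A)) (scaledVal V 1 (algebraMap A K g)) := by
  -- Adding 0 to the generators gives a nonempty set and covers the zero ideal, whose value is ⊤.
  obtain ⟨g, hg, hmax⟩ := Finset.exists_max_image (insert 0 s)
    (fun h => V.valuation (algebraMap A K h)) ⟨0, Finset.mem_insert_self _ _⟩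
  refine ⟨g, hg, ⟨g, ?_, rfl⟩, ?_⟩
  · rcases Finset.mem_insert.1 hg with rfl | hg
    · exact zero_mem _
    · exact Ideal.subset_span hg
  · rintro _ ⟨h, hh, rfl⟩
    refine scaledVal_one_le_iff.2 ?_
    refine Submodule.span_induction (p := fun h _ =>
      V.valuation (algebraMap A K h) ≤ V.valuation (algebraMap A K g)) ?_ ?_ ?_ ?_ hh
    · exact fun x hx => hmax x (Finset.mem_insert_of_mem hx)
    · rw [map_zero, map_zero]; exact zero_le
    · intro x y _ _ hx hy
      rw [map_add]
      exact (V.valuation.map_add _ _).trans (max_le hx hy)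
    · intro r x _ hx
      rw [smul_eq_mul, map_mul, map_mul]
      exact (mul_le_of_le_one_left' ((V.valuation_le_one_iff _).2 (hV r))).trans hx

/-- On an affine neighbourhood I has finitely many generators. Each satisfies the inequality near p,
and at every v centered nearby the value of I is attained at one of them. -/
theorem isAdmissibleAt_of_stalkIdeal_le [IsLocallyNoetherian Y] (I : Y.IdealSheafData) {p : Y}
    {xs : List (Y.presheaf.stalk p)} {as : List ℚ}
    (hx : ∀ x ∈ xs, x ≠ 0) (ha : ∀ a ∈ as, 0 < a)
    (h : stalkIdeal I p ≤ weightedIdeal (centerWeights (xs.zip as)) 1) :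
    IsAdmissibleAt I xs as := by
  classical
  obtain ⟨_, ⟨V, hV, rfl⟩, hpV, -⟩ :=
    Y.isBasis_affineOpens.exists_subset_of_mem_open (Set.mem_univ p) isOpen_univ
  have := IsLocallyNoetherian.component_noetherian ⟨V, hV⟩
  obtain ⟨s, hs⟩ := IsNoetherian.noetherian (I.ideal ⟨V, hV⟩)
  have hgen : ∀ᶠ v in zrNhds p, ∀ g ∈ s, centerValue xs as v ≤
      scaledVal v.ring 1 (algebraMap _ Y.functionField (Y.presheaf.germ V p hpV g)) := by
    refine (Filter.eventually_all_finset s).2 fun g hg => ?_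
    refine eventually_centerValue_le hx ha one_pos ?_
    rw [inv_one]
    apply h
    rw [stalkIdeal_eq_map I ⟨V, hV⟩ hpV]
    exact Ideal.mem_map_of_mem _ (hs ▸ Submodule.subset_span hg)
  have hVmem : ∀ᶠ v in zrNhds p, v.center ∈ V := eventually_zrNhds_iff.2 ⟨V, hpV, fun _ h => h⟩
  refine eventually_zrNhds_iff.1 ?_
  filter_upwards [hgen, hVmem] with v hv hvV
  obtain ⟨g, hg, hleast⟩ := exists_isLeast_scaledVal_of_span v.ring v.stalk_le
    (s.image (Y.presheaf.germ V v.center hvV).hom)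
  refine ⟨scaledVal v.ring 1 (algebraMap _ Y.functionField g), ?_, ?_⟩
  · rw [IsIdealValue, stalkIdeal_eq_map I ⟨V, hV⟩ hvV, ← hs]
    rw [Finset.coe_image, ← Ideal.map_span] at hleast
    exact hleast
  · rcases Finset.mem_insert.1 hg with rfl | hg
    · rw [map_zero, scaledVal_zero]; exact le_top
    · obtain ⟨r, hr, rfl⟩ := Finset.mem_image.1 hg
      have := hv r hr
      rwa [algebraMap_germ_eq r hpV hvV] at this

theorem stalkIdeal_le_of_isAdmissibleAt {k : Type u} [Field k] [CharZero k] {p : Y}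
    [Algebra k (Y.presheaf.stalk p)] (hR : HasParameters k (Y.presheaf.stalk p))
    {I : Y.IdealSheafData} {xs : List (Y.presheaf.stalk p)} {as : List ℚ} (hc : IsCenter xs as)
    (h : IsAdmissibleAt I xs as) :
    stalkIdeal I p ≤ weightedIdeal (centerWeights (xs.zip as)) 1 := by
  obtain ⟨hlen, hind, hpos, hsort⟩ := hc
  obtain ⟨U, hpU, hU⟩ := h
  intro f hf
  refine hR.mem_weightedIdeal_of_valuation (K := Y.functionField) ?_
    (fun e he => hpos _ (List.of_mem_zip (a := e.1) (b := e.2) he).2) ?_ fun V hV hdom => ?_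
  · rw [List.map_fst_zip hlen.le]
    exact isPartialParameterSystem_iff.1 hind
  · rwa [List.map_snd_zip hlen.ge]
  -- Only the valuation rings centered at p itself are needed.
  · obtain ⟨g, hg, hle⟩ := hU ⟨V, p, hV, hdom⟩ hpU
    rw [centerValue_eq] at hle
    exact hle.trans (hg.2 ⟨f, hf, rfl⟩)

theorem eventually_centerValue_le_of_weightedIdeal_eq {p : Y}
    {xs ys : List (Y.presheaf.stalk p)} {as bs : List ℚ} (hx : ∀ x ∈ xs, x ≠ 0)
    (ha : ∀ a ∈ as, 0 < a) (hb : ∀ b ∈ bs, 0 < b)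
    (h : ∀ t, weightedIdeal (centerWeights (ys.zip bs)) t =
      weightedIdeal (centerWeights (xs.zip as)) t) :
    ∀ᶠ v in zrNhds p, centerValue xs as v ≤ centerValue ys bs v := by
  have key : ∀ᶠ v in zrNhds p, ∀ e ∈ ys.zip bs, centerValue xs as v ≤
      scaledVal v.ring e.2 (algebraMap _ Y.functionField e.1) := by
    refine (Filter.eventually_all_finite (l := zrNhds p) (ys.zip bs).finite_toSet
      (p := fun e v => centerValue xs as v ≤
        scaledVal v.ring e.2 (algebraMap _ Y.functionField e.1))).2 fun e he => ?_
    refine eventually_centerValue_le hx ha (hb _ (List.of_mem_zip (a := e.1) (b := e.2) he).2) ?_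
    rw [← h]
    exact mem_weightedIdeal (mem_centerWeights he)
  filter_upwards [key] with v hv
  rw [centerValue_eq ys, le_foldr_min_iff]
  intro b hb
  obtain ⟨e, he, rfl⟩ := List.mem_map.1 hb
  exact hv e he

theorem sameCenterAt_of_weightedIdeal_eq {p : Y}
    {xs ys : List (Y.presheaf.stalk p)} {as bs : List ℚ} (hx : IsCenter xs as)
    (hy : IsCenter ys bs)
    (h : ∀ t, weightedIdeal (centerWeights (ys.zip bs)) t =
      weightedIdeal (centerWeights (xs.zip as)) t) :
    SameCenterAt xs as ys bs := by
  refine eventually_zrNhds_iff.1 ?_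
  filter_upwards [eventually_centerValue_le_of_weightedIdeal_eq
      (fun _ => hx.2.1.ne_zero) hx.2.2.1 hy.2.2.1 h,
    eventually_centerValue_le_of_weightedIdeal_eq
      (fun _ => hy.2.1.ne_zero) hy.2.2.1 hx.2.2.1 fun t => (h t).symm] with v h1 h2
  exact le_antisymm h1 h2

end ZariskiRiemann

end WeightedCenters

namespace WeightedCenters

open IsLocalRing

/-! ### Assembly of the theorem. -/

section Smooth

variable {k : Type u} [Field k] [CharZero k] {Y : Scheme.{u}} [AlgebraicGeometry.IsIntegral Y]
  {f : Y ⟶ Spec (CommRingCat.of k)} [AlgebraicGeometry.Smooth f] {I : Y.IdealSheafData} {p : Y}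
  {bs : List ℕ} {xs : List (Y.presheaf.stalk p)}

theorem exists_isAssociatedAt {Y : Scheme.{u}} {f : Y ⟶ Spec (CommRingCat.of k)}
    [AlgebraicGeometry.Smooth f] {I : Y.IdealSheafData} {p : Y} (hI : stalkIdeal I p ≠ ⊤) :
    ∃ (bs : List ℕ) (xs : List (Y.presheaf.stalk p)), IsAssociatedAt f I p bs xs := by
  let : Algebra k (Y.presheaf.stalk p) := (stalkStructureMap f p).toAlgebra
  exact (hasParameters_stalk f p).exists_isAssociated hI

theorem IsAssociatedAt.isCenter_and_isAdmissibleAt (h : IsAssociatedAt f I p bs xs) :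
    IsCenter xs (exponents bs) ∧ IsAdmissibleAt I xs (exponents bs) := by
  let : Algebra k (Y.presheaf.stalk p) := (stalkStructureMap f p).toAlgebra
  have : IsLocallyNoetherian Y := LocallyOfFiniteType.isLocallyNoetherian f
  obtain ⟨hind, hlen, hpos, hsort, hle⟩ :=
    IsAssociated.isCenter_and_le bs (hasParameters_stalk f p) h
  have hps := isPartialParameterSystem_iff.2 hind
  exact ⟨⟨hlen, hps, hpos, hsort⟩,
    isAdmissibleAt_of_stalkIdeal_le I (fun _ => hps.ne_zero) hpos hle⟩

theorem IsAssociatedAt.invLE_and_sameCenterAt (h : IsAssociatedAt f I p bs xs)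
    {ys : List (Y.presheaf.stalk p)} {cs : List ℚ} (hc : IsCenter ys cs)
    (ha : IsAdmissibleAt I ys cs) :
    InvLE cs (exponents bs) ∧
      (cs = exponents bs → SameCenterAt xs (exponents bs) ys cs) := by
  let : Algebra k (Y.presheaf.stalk p) := (stalkStructureMap f p).toAlgebra
  have hle := stalkIdeal_le_of_isAdmissibleAt (hasParameters_stalk f p) hc ha
  have hsnd : (ys.zip cs).map Prod.snd = cs := List.map_snd_zip hc.1.ge
  have key := IsAssociated.invLE_and_eq bs h (ys.zip cs)
    (fun e he => (isPartialParameterSystem_iff.1 hc.2.1).1 _ (List.of_mem_zip (a := e.1) (b := e.2) he).1)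
    (fun e he => hc.2.2.1 _ (List.of_mem_zip (a := e.1) (b := e.2) he).2)
    (by rw [hsnd]; exact hc.2.2.2) hle
  rw [hsnd] at key
  exact ⟨key.1, fun heq => sameCenterAt_of_weightedIdeal_eq
    h.isCenter_and_isAdmissibleAt.1 hc (key.2 heq)⟩

/-- Both centers are admissible, so maximality bounds each invariant by the other; no comparison of
maximal contact hypersurfaces is needed. -/
theorem IsAssociatedAt.exponents_eq {bs' : List ℕ} {xs' : List (Y.presheaf.stalk p)}
    (h : IsAssociatedAt f I p bs xs) (h' : IsAssociatedAt f I p bs' xs') :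
    exponents bs = exponents bs' :=
  invLE_antisymm
    (h'.invLE_and_sameCenterAt h.isCenter_and_isAdmissibleAt.1 h.isCenter_and_isAdmissibleAt.2).1
    (h.invLE_and_sameCenterAt h'.isCenter_and_isAdmissibleAt.1 h'.isCenter_and_isAdmissibleAt.2).1

theorem IsAssociatedAt.exponents_eq_invariantAt (h : IsAssociatedAt f I p bs xs) :
    exponents bs = invariantAt f I p := by
  have hex : ∃ bs : List ℕ, ∃ xs : List (Y.presheaf.stalk p), IsAssociatedAt f I p bs xs :=
    ⟨bs, xs, h⟩
  rw [invariantAt, dif_pos hex]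
  exact h.exponents_eq hex.choose_spec.choose_spec

end Smooth

end WeightedCenters

theorem mainTheorem4 {k : Type u} [Field k] [CharZero k]
    {Y : AlgebraicGeometry.Scheme.{u}} [AlgebraicGeometry.IsIntegral Y]
    (f : Y ⟶ AlgebraicGeometry.Spec (CommRingCat.of k)) [AlgebraicGeometry.Smooth f]
    (I : Y.IdealSheafData) (p : Y) (hp : WeightedCenters.stalkIdeal I p ≠ ⊤) :
    -- the procedure can be carried out, and every way to do so yields the invariant
    ((∃ (bs : List ℕ) (xs : List (Y.presheaf.stalk p)),
        WeightedCenters.IsAssociatedAt f I p bs xs) ∧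
      ∀ (bs : List ℕ) (xs : List (Y.presheaf.stalk p)),
        WeightedCenters.IsAssociatedAt f I p bs xs →
          WeightedCenters.exponents bs = WeightedCenters.invariantAt f I p) ∧
    -- (1) every associated center is an admissible center
    (∀ (bs : List ℕ) (xs : List (Y.presheaf.stalk p)),
        WeightedCenters.IsAssociatedAt f I p bs xs →
          WeightedCenters.IsCenter xs (WeightedCenters.invariantAt f I p) ∧
          WeightedCenters.IsAdmissibleAt I xs (WeightedCenters.invariantAt f I p)) ∧
    -- (2) the invariant is the maximum of the invariants of the admissible centers
    ((∃ ys : List (Y.presheaf.stalk p),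
        WeightedCenters.IsCenter ys (WeightedCenters.invariantAt f I p) ∧
        WeightedCenters.IsAdmissibleAt I ys (WeightedCenters.invariantAt f I p)) ∧
      ∀ (ys : List (Y.presheaf.stalk p)) (cs : List ℚ),
        WeightedCenters.IsCenter ys cs → WeightedCenters.IsAdmissibleAt I ys cs →
          WeightedCenters.InvLE cs (WeightedCenters.invariantAt f I p)) ∧
    -- (3) an associated center is the only admissible center with that invariant
    (∀ (bs : List ℕ) (xs : List (Y.presheaf.stalk p)),
        WeightedCenters.IsAssociatedAt f I p bs xs →
        ∀ ys : List (Y.presheaf.stalk p),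
          WeightedCenters.IsCenter ys (WeightedCenters.invariantAt f I p) →
          WeightedCenters.IsAdmissibleAt I ys (WeightedCenters.invariantAt f I p) →
            WeightedCenters.SameCenterAt xs (WeightedCenters.invariantAt f I p)
              ys (WeightedCenters.invariantAt f I p)) := by
  obtain ⟨bs₀, xs₀, h₀⟩ := WeightedCenters.exists_isAssociatedAt (f := f) hp
  refine ⟨⟨⟨bs₀, xs₀, h₀⟩, fun bs xs h => h.exponents_eq_invariantAt⟩, fun bs xs h => ?_,
    ⟨⟨xs₀, ?_⟩, fun ys cs hc ha => ?_⟩, fun bs xs h ys hc ha => ?_⟩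
  · rw [← h.exponents_eq_invariantAt]
    exact h.isCenter_and_isAdmissibleAt
  · rw [← h₀.exponents_eq_invariantAt]
    exact h₀.isCenter_and_isAdmissibleAt
  · rw [← h₀.exponents_eq_invariantAt]
    exact (h₀.invLE_and_sameCenterAt hc ha).1
  · rw [← h.exponents_eq_invariantAt] at hc ha ⊢
    exact (h.invLE_and_sameCenterAt hc ha).2 rfl
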